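/- **Theorem 4.1.** Conventions. A *ptm* (principally thick manifold) is a noetherian scheme $X$ with nilradical $\mathcal N$ such that the reduction $\widetilde X=X^{\mathrm{red}}$ is regular, each $\mathcal N^n/\mathcal N^{n+1}$ ($n\ge 0$) is flat over $\mathcal O_{\widetilde X}$, and $\mathcal N$ is locally principal. A *modification* is a proper morphism inducing an isomorphism of dense open subschemes; a modification $f\colon Y\to X$ of ptms has *trivial reduction* if $\widetilde f\colon\widetilde Y\to\widetilde X$ is an isomorphism. An *ordered boundary* on $X$ is a divisor $E=\sum_{i=1}^l E_i$, where the $E_i$ are effective Cartier divisors on $X$ whose restrictions $\widetilde E_i=E_i\times_X\widetilde X$ are regular and have simple normal crossings: at each $x\in X$ suitable local equations of the $E_i$ passing through $x$ induce pairwise different members of one regular system of parameters of $\mathcal O_{\widetilde X,x}$. A *component* of $\widetilde E_i$ is a closed (possibly empty) union of connected components of $\widetilde E_i$. If $Z\to X$ induces an isomorphism $\widetilde Z\cong\widetilde X$, a component of $\widetilde E_i$ is also regarded as a closed subscheme of $\widetilde Z\subset Z$. Blowing up such a component again gives an $X$-scheme with reduction $\widetilde X$, so one can form finite sequences of such blowings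 up. Statement. Fix $l\ge 0$. To every datum consisting of a modification $f\colon Y\to X$ of ptms with trivial reduction and an ordered boundary $E=\sum_{i=1}^lE_i$ on $X$ such that $f$ is an isomorphism over $X\setminus E$, one can associate 1. a finite sequence $Y'\dashrightarrow Y$ of blowings up of components of the $\widetilde E_i$'s, and 2. a splitting of the composed morphism $f'\colon Y'\to Y\to X$ into a finite sequence $Y'=X_m\to\cdots\to X_0=X$ of blowings up of components of the $\widetilde E_i$'s, functorially with respect to smooth morphisms of ptms in the following sense. Let $g\colon\overline X\to X$ be a smooth morphism of ptms, $\overline f\colon\overline Y=Y\times_X\overline X\to\overline X$ the base change of $f$, and $\overline E_i=E_i\times_X\overline X$. Then both sequences associated with $(\overline f,\overline E)$ are obtained from those associated with $(f,E)$ by base change along $g$ and removal of all blowings up with empty center, and the resulting morphisms from $\overline Y'$ to $Y'=X_m$ agree. -/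

import Mathlib

open CategoryTheory CategoryTheory.Limits AlgebraicGeometry TopologicalSpace

universe u

namespace PTM

section Algebra

/-- The quotient of a local ring by its nilradical is local. -/
instance isLocalRing_quotient_nilradical (R : Type*) [CommRing R] [IsLocalRing R] :
    IsLocalRing (R ⧸ nilradical R) :=
  haveI : Nontrivial (R ⧸ nilradical R) := Ideal.Quotient.nontrivial_iff.mpr (by
    rw [Ideal.ne_top_iff_one, mem_nilradical]
    exact not_isNilpotent_one)
  IsLocalRing.of_surjective' (Ideal.Quotient.mk (nilradical R)) Ideal.Quotient.mk_surjective

/-- `s` is a regular system of parameters of the local ring `R`: a family of `dim R` elements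
that generates the maximal ideal. -/
def IsRegularParameters {R : Type*} [CommRing R] [IsLocalRing R] {d : ℕ} (s : Fin d → R) : Prop :=
  Ideal.span (Set.range s) = IsLocalRing.maximalIdeal R ∧ (d : WithBot ℕ∞) = ringKrullDim R

end Algebra

section Schemes

/-- The local ring `𝒪_{X^red, x} = 𝒪_{X, x} / nilradical` of the reduction of `X` at `x`. -/
abbrev ReducedStalk (X : Scheme.{u}) (x : X) : Type u :=
  X.presheaf.stalk x ⧸ nilradical (X.presheaf.stalk x)

/-- A principally thick manifold: a locally noetherian scheme whose reduction is regular, which is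
normally flat along its reduction (all the modules `N ^ n / N ^ (n + 1)`, where `N` is the
nilradical, are flat over `𝒪_X / N`), and whose nilradical is locally principal. -/
structure IsPTM (X : Scheme.{u}) : Prop where
  locallyNoetherian : IsLocallyNoetherian X
  regular : ∀ x : X, IsRegularLocalRing (ReducedStalk X x)
  normallyFlat : ∀ (U : X.affineOpens) (n : ℕ),
    Module.Flat (Γ(X, U) ⧸ nilradical Γ(X, U))
      (↥(nilradical Γ(X, U) ^ n) ⧸
        (nilradical Γ(X, U) • ⊤ : Submodule Γ(X, U) ↥(nilradical Γ(X, U) ^ n)))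
  nilprincipal : ∀ x : X, ∃ U : X.affineOpens, x ∈ U.1 ∧
    (nilradical Γ(X, U)).IsPrincipal

/-- The reduction `X^red` of a scheme. -/
noncomputable abbrev reduction (X : Scheme.{u}) : Scheme.{u} := X.nilradical.subscheme

lemma nilradical_le_map {Y X : Scheme.{u}} (f : Y ⟶ X) :
    X.nilradical ≤ Y.nilradical.map f := by
  rw [← Scheme.IdealSheafData.vanishingIdeal_top, ← Scheme.IdealSheafData.vanishingIdeal_top,
    Scheme.IdealSheafData.map_vanishingIdeal]
  exact Scheme.IdealSheafData.vanishingIdeal_antimono le_top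

/-- The morphism `f^red : Y^red ⟶ X^red` induced by `f : Y ⟶ X`. -/
noncomputable def reductionMap {Y X : Scheme.{u}} (f : Y ⟶ X) : reduction Y ⟶ reduction X :=
  Scheme.IdealSheafData.subschemeMap Y.nilradical X.nilradical f (nilradical_le_map f)

/-- A modification: a proper morphism that induces an isomorphism of dense open subschemes. -/
def IsModification {Y X : Scheme.{u}} (f : Y ⟶ X) : Prop :=
  IsProper f ∧ ∃ U : X.Opens, Dense (U : Set X) ∧ Dense ((f ⁻¹ᵁ U : Y.Opens) : Set Y) ∧
    IsIso (f ∣_ U)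

/-- A modification with trivial reduction: a modification whose reduction is an isomorphism. -/
def IsModificationTrivialReduction {Y X : Scheme.{u}} (f : Y ⟶ X) : Prop :=
  IsModification f ∧ IsIso (reductionMap f)

/-- The closed subscheme with ideal sheaf `I` is an effective Cartier divisor: locally `I` is
generated by one non-zero-divisor. -/
def IsCartier {X : Scheme.{u}} (I : X.IdealSheafData) : Prop :=
  ∀ x : X, ∃ U : X.affineOpens, x ∈ U.1 ∧
    ∃ t ∈ nonZeroDivisors Γ(X, U), I.ideal U = Ideal.span {t}

/-- `q : Z' ⟶ Z` is the blowing up of `Z` along the closed subscheme with ideal sheaf `I`: it is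
the universal morphism such that the inverse image of that subscheme is an effective Cartier
divisor. -/
def IsBlowup {Z' Z : Scheme.{u}} (q : Z' ⟶ Z) (I : Z.IdealSheafData) : Prop :=
  IsCartier (I.comap q) ∧
    ∀ (W : Scheme.{u}) (g : W ⟶ Z), IsCartier (I.comap g) → ∃! k : W ⟶ Z', k ≫ q = g

/-- The divisors `E i` on `X`, given by their ideal sheaves, are the components of an ordered
boundary `∑ i, E i`: they are effective Cartier divisors, and their restrictions to the reduction
of `X` are regular and have simple normal crossings. That is, at each point `x` there are
local equations `t i` of the `E i` such that those of the `E i` passing through `x` induce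
pairwise different members of one regular system of parameters of `𝒪_{X^red, x}`. -/
def IsOrderedBoundary {X : Scheme.{u}} {l : ℕ} (E : Fin l → X.IdealSheafData) : Prop :=
  ∀ x : X, ∃ (U : X.affineOpens) (hx : x ∈ U.1) (t : Fin l → Γ(X, U)),
    (∀ i, t i ∈ nonZeroDivisors Γ(X, U) ∧ (E i).ideal U = Ideal.span {t i}) ∧
    ∃ (d : ℕ) (s : Fin d → ReducedStalk X x) (j : {i : Fin l // x ∈ (E i).support} ↪ Fin d),
      IsRegularParameters s ∧
      ∀ i, Ideal.Quotient.mk (nilradical (X.presheaf.stalk x))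
        (X.presheaf.germ U.1 x hx (t i.1)) = s (j i)

/-- The complement `X ∖ E` of the divisor `E = ∑ i, E i`. -/
noncomputable def boundaryCompl {X : Scheme.{u}} {l : ℕ} (E : Fin l → X.IdealSheafData) :
    X.Opens :=
  (∏ i, E i).support.compl

/-- `C` is (the set of points of) a component of the reduction of the divisor `D`, i.e. a closed
union of connected components of it. The empty union is allowed. -/
def IsComponent {X : Scheme.{u}} (C : Closeds X) (D : X.IdealSheafData) : Prop :=
  C ≤ D.support ∧ ∀ x ∈ C, connectedComponentIn (D.support : Set X) x ⊆ C

/-- The inverse image of a closed subset. -/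
def preimage {Z X : Scheme.{u}} (h : Z ⟶ X) (C : Closeds X) : Closeds Z :=
  C.preimage h.continuous

/-- The ideal sheaf of the closed subset `C` of `X` viewed as a reduced closed subscheme of `Z`.
When the reduction of `h : Z ⟶ X` is an isomorphism and `C` is a component of a divisor with
regular (hence reduced) reduction, it defines that component, viewed as a closed subscheme of
`X^red = Z^red` and hence of `Z`. -/
noncomputable def center {Z X : Scheme.{u}} (h : Z ⟶ X) (C : Closeds X) : Z.IdealSheafData :=
  Scheme.IdealSheafData.vanishingIdeal (preimage h C)

/-- A sequence of blowings up `Z_m ⟶ ⋯ ⟶ Z_1 ⟶ Z_0 = Z` of an `X`-scheme `h : Z ⟶ X`, where each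
center is a component of the reduction of one of the divisors `E i` on `X`, viewed as a reduced
closed subscheme of `Z_j`. -/
inductive BlowupSequence {X : Scheme.{u}} {l : ℕ} (E : Fin l → X.IdealSheafData) :
    {Z : Scheme.{u}} → (Z ⟶ X) → Type (u + 1)
  | nil {Z : Scheme.{u}} (h : Z ⟶ X) : BlowupSequence E h
  | cons {Z Z₁ : Scheme.{u}} (h : Z ⟶ X) (i : Fin l) (C : Closeds X) (hC : IsComponent C (E i))
      (q : Z₁ ⟶ Z) (hq : IsBlowup q (center h C)) (S : BlowupSequence E (q ≫ h)) :
      BlowupSequence E h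

namespace BlowupSequence

variable {X : Scheme.{u}} {l : ℕ} {E : Fin l → X.IdealSheafData}

/-- The last scheme `Z_m` of a sequence of blowings up. -/
def top {Z : Scheme.{u}} {h : Z ⟶ X} : BlowupSequence E h → Scheme.{u}
  | nil (Z := Z) _ => Z
  | cons _ _ _ _ _ _ S => S.top

/-- The composition `Z_m ⟶ Z` of a sequence of blowings up. -/
def map {Z : Scheme.{u}} {h : Z ⟶ X} : (S : BlowupSequence E h) → (S.top ⟶ Z)
  | nil (Z := Z) _ => 𝟙 Z
  | cons _ _ _ _ q _ S => S.map ≫ q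

/-- `IsPullbackOf g φ S' S ψ`: the sequence of blowings up `S'` of `Z'` is obtained from the
sequence `S` of `Z` by pulling it back along `φ : Z' ⟶ Z` (a base change of `g : X' ⟶ X`) and
removing all blowings up with empty centers; `ψ` is the resulting morphism between the last
schemes of the two sequences. -/
inductive IsPullbackOf {X' : Scheme.{u}} {E' : Fin l → X'.IdealSheafData} (g : X' ⟶ X) :
    {Z' Z : Scheme.{u}} → {h' : Z' ⟶ X'} → {h : Z ⟶ X} → (φ : Z' ⟶ Z) →
    (S' : BlowupSequence E' h') → (S : BlowupSequence E h) → (S'.top ⟶ S.top) → Prop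
  | nil {Z' Z : Scheme.{u}} (h' : Z' ⟶ X') (h : Z ⟶ X) (φ : Z' ⟶ Z) :
      IsPullbackOf g φ (BlowupSequence.nil (E := E') h') (BlowupSequence.nil (E := E) h) φ
  | step {Z' Z Z₁' Z₁ : Scheme.{u}} (h' : Z' ⟶ X') (h : Z ⟶ X) (φ : Z' ⟶ Z)
      (i : Fin l) (C : Closeds X) (hC : IsComponent C (E i))
      (q : Z₁ ⟶ Z) (hq : IsBlowup q (center h C)) (S : BlowupSequence E (q ≫ h))
      (hC' : IsComponent (preimage g C) (E' i))
      (q' : Z₁' ⟶ Z') (hq' : IsBlowup q' (center h' (preimage g C)))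
      (S' : BlowupSequence E' (q' ≫ h'))
      (nonempty : preimage g C ≠ ⊥)
      (φ₁ : Z₁' ⟶ Z₁) (isPullback : IsPullback φ₁ q' q φ)
      (ψ : S'.top ⟶ S.top) (rest : IsPullbackOf g φ₁ S' S ψ) :
      IsPullbackOf g φ (BlowupSequence.cons h' i (preimage g C) hC' q' hq' S')
        (BlowupSequence.cons h i C hC q hq S) ψ
  | skip {Z' Z Z₁ : Scheme.{u}} (h' : Z' ⟶ X') (h : Z ⟶ X) (φ : Z' ⟶ Z)
      (i : Fin l) (C : Closeds X) (hC : IsComponent C (E i))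
      (q : Z₁ ⟶ Z) (hq : IsBlowup q (center h C)) (S : BlowupSequence E (q ≫ h))
      (S' : BlowupSequence E' h')
      (empty : preimage g C = ⊥)
      (φ₁ : Z' ⟶ Z₁) (isPullback : IsPullback φ₁ (𝟙 Z') q φ)
      (ψ : S'.top ⟶ S.top) (rest : IsPullbackOf g φ₁ S' S ψ) :
      IsPullbackOf g φ S' (BlowupSequence.cons h i C hC q hq S) ψ

end BlowupSequence

/-- A modification `f : Y ⟶ X` of noetherian ptms with trivial reduction, together with an ordered
boundary `E = ∑ i, E i` on `X` such that `f` is an isomorphism over `X ∖ E`. -/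
structure Datum (l : ℕ) where
  X : Scheme.{u}
  Y : Scheme.{u}
  f : Y ⟶ X
  E : Fin l → X.IdealSheafData
  compactSpace_X : CompactSpace X
  isPTM_X : IsPTM X
  isPTM_Y : IsPTM Y
  modification : IsModificationTrivialReduction f
  boundary : IsOrderedBoundary E
  isIso_compl : IsIso (f ∣_ boundaryCompl E)

/-- `D'` is the pullback of the datum `D` along a smooth morphism `D'.X ⟶ D.X`. -/
structure SmoothPullback {l : ℕ} (D' D : Datum.{u} l) where
  g : D'.X ⟶ D.X
  smooth : Smooth g
  gY : D'.Y ⟶ D.Y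
  isPullback : IsPullback gY D'.f D.f g
  comap_E : ∀ i, D'.E i = (D.E i).comap g

/-- A factorization for the datum `D`: a sequence `Y' ⇢ Y` of blowings up of components of the
reductions of the `E i`, and a splitting of the composition `Y' ⟶ Y ⟶ X` into such blowings up
(of `X`), up to an isomorphism of `Y'` with the last scheme of the second sequence. -/
structure Factorization {l : ℕ} (D : Datum.{u} l) where
  seqY : BlowupSequence D.E D.f
  seqX : BlowupSequence D.E (𝟙 D.X)
  e : seqY.top ≅ seqX.top
  w : e.hom ≫ seqX.map = seqY.map ≫ D.f

/-- The factorization `F'` is the pullback of `F` (up to blowings up with empty centers). -/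
def Factorization.IsPullbackOf {l : ℕ} {D' D : Datum.{u} l} (m : SmoothPullback D' D)
    (F' : Factorization D') (F : Factorization D) : Prop :=
  ∃ (ψY : F'.seqY.top ⟶ F.seqY.top) (ψX : F'.seqX.top ⟶ F.seqX.top),
    BlowupSequence.IsPullbackOf m.g m.gY F'.seqY F.seqY ψY ∧
    BlowupSequence.IsPullbackOf m.g m.g F'.seqX F.seqX ψX ∧
    F'.e.hom ≫ ψX = ψY ≫ F.e.hom

end Schemes

end PTM

/-! Locally over `X`, the morphism `f` is an injection `A → B` of rings with the same reduction and
with principal nilradicals `(ε)` and `(η)`; it becomes an isomorphism once `T = ∏ tᵢ`, the product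
of equations of the `Eᵢ`, is inverted (`Datum.exists_chart`). In such a thickening a component with
equation `t` has the ideal `(t, η)`. Since `η` is nilpotent, this ideal becomes invertible only if
`t` becomes regular and divides `η` (`regular_and_dvd_of_span_pair`). So the blowing up is affine
over its base and adjoins `η / t`. The reduction stays the same and the new nilradical is `(η / t)`
(`IsThickMod.dilatation`), so a sequence of blowings up with equations `sⱼ` amounts to adjoining `η
/ ∏ sⱼ` (`IsChart.blowupSequence`).

By normal flatness, near a point `x` either `η` vanishes or everything that kills `η` modulo `η²` is
nilpotent. In the second case `ε = a η + d η²`, where `a` divides a power of `T` modulo nilpotents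
near `x`. In the stalk of the reduction, a domain, the `tᵢ` through `x` are primes none of which
divides another, so `a` is a unit times `m = ∏ tᵢ ^ nᵢ` up to nilpotents
(`IsChart.exists_isOrderChart`). At points of `Eᵢ` the exponent `nᵢ` does not depend on choices
(`IsOrderChart.le`). Hence the locus in `Eᵢ` where `nᵢ > k` is open and closed in `Eᵢ`, so it is a
legitimate center.

Blowing up these loci in `Y`, for all `i` and all `k` below the maximum of `nᵢ`, gives locally
`B[e]` with `e = η / m`. There `ε = m² e (v + c e)` with `v` a unit, and `v + c e` is a unit because
`e` is nilpotent. So `A[ε / m²] → B[η / m]` sends `ε / m²` to a unit times `e`, and it is bijective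
(`IsThickMod.exists_ringEquiv`). Performing the same list of blowings up twice on `X` therefore
reaches the same scheme. The local isomorphisms glue, because morphisms over `X` into such a scheme
are unique when the `Eᵢ` pull back to Cartier divisors on the source (`HasCharts.hom_ext`).

Functoriality: a smooth base change preserves radical ideals (`isRadical_map_of_smooth`), hence
nilradicals and centers, and by flatness it preserves blowings up. So the `nᵢ` and the loci pull
back, and the centers that become empty are exactly those with `k` at least the new maximum. The
resulting morphisms agree by the same uniqueness. -/

namespace PTM

open IsLocalRing

/-! ### Regular systems of parameters consist of primes -/

section RegularLocal

lemma span_quotient_eq_maximalIdeal {R : Type*} [CommRing R] [IsLocalRing R] {n : ℕ}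
    (x : R) [IsLocalRing (R ⧸ Ideal.span {x})] (s : Fin n → R)
    (hs : Ideal.span (insert x (Set.range s)) = maximalIdeal R) :
    Ideal.span (Set.range (fun i => Ideal.Quotient.mk (Ideal.span {x}) (s i))) =
      maximalIdeal (R ⧸ Ideal.span {x}) := by
  have h1 : (maximalIdeal R).map (Ideal.Quotient.mk (Ideal.span {x})) =
      maximalIdeal (R ⧸ Ideal.span {x}) :=
    IsLocalRing.map_maximalIdeal_of_surjective _ Ideal.Quotient.mk_surjective
  rw [← h1, ← hs, Ideal.map_span, Set.image_insert_eq]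
  have h0 : Ideal.Quotient.mk (Ideal.span {x}) x = 0 :=
    Ideal.Quotient.eq_zero_iff_mem.mpr (Ideal.mem_span_singleton_self x)
  rw [h0, ← Set.range_comp]
  exact (Submodule.span_insert_zero).symm

lemma isLocalRing_quotient_span_singleton {R : Type*} [CommRing R] [IsLocalRing R] {x : R}
    (hx : x ∈ maximalIdeal R) : IsLocalRing (R ⧸ Ideal.span {x}) :=
  haveI : Nontrivial (R ⧸ Ideal.span {x}) := Ideal.Quotient.nontrivial_iff.mpr fun h =>
    (maximalIdeal.isMaximal R).ne_top (top_le_iff.mp (h ▸ (Ideal.span_le.mpr (by simpa using hx))))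
  IsLocalRing.of_surjective' (Ideal.Quotient.mk _) Ideal.Quotient.mk_surjective

lemma le_ringKrullDim_quotient {R : Type*} [CommRing R] [IsLocalRing R] [IsNoetherianRing R]
    {n : ℕ} {x : R} (hx : x ∈ maximalIdeal R) (hd : ((n + 1 : ℕ) : WithBot ℕ∞) ≤ ringKrullDim R) :
    (n : WithBot ℕ∞) ≤ ringKrullDim (R ⧸ Ideal.span {x}) := by
  have h := ringKrullDim_le_ringKrullDim_quotient_add_card (R := R) {x} (by
    simpa [IsLocalRing.ringJacobson_eq_maximalIdeal] using hx)
  have h2 : ((n + 1 : ℕ) : WithBot ℕ∞) ≤ ringKrullDim (R ⧸ Ideal.span {x}) + 1 := by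
    rw [← Finset.coe_singleton]
    simpa using hd.trans h
  rw [Nat.cast_add, Nat.cast_one] at h2
  exact (WithBot.add_le_add_iff_right' (c := 1) WithBot.one_ne_bot
    (fun h => ENat.one_ne_top (WithBot.coe_injective h))).mp h2

/-- A noetherian local ring whose maximal ideal is generated by at most `dim R` elements is a
domain. -/
theorem isDomain_of_span_eq_maximalIdeal (n : ℕ) : ∀ (R : Type*) [CommRing R] [IsLocalRing R]
    [IsNoetherianRing R] (s : Fin n → R), Ideal.span (Set.range s) = maximalIdeal R →
    (n : WithBot ℕ∞) ≤ ringKrullDim R → IsDomain R := by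
  induction n with
  | zero =>
    intro R _ _ _ s hs _
    have h : maximalIdeal R = ⊥ := by rw [← hs]; simp
    exact (IsLocalRing.isField_iff_maximalIdeal_eq.mpr h).isDomain
  | succ n ih =>
    intro R _ _ _ s hs hd
    have hnm : maximalIdeal R ∉ minimalPrimes R := by
      intro hm
      have h0 : (maximalIdeal R).height = 0 := Ideal.height_eq_zero_iff.mpr hm
      have := IsLocalRing.maximalIdeal_height_eq_ringKrullDim (R := R)
      rw [h0] at this
      rw [← this] at hd
      have h3 : ((n + 1 : ℕ) : ℕ∞) ≤ 0 := by exact_mod_cast hd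
      simp at h3
    -- Prime avoidance, with the square of the maximal ideal as the one ideal allowed not to be
    -- prime. If the maximal ideal were contained in its square, Nakayama would make it zero and
    -- hence a minimal prime.
    obtain ⟨x, hxm, hx⟩ : ∃ x ∈ maximalIdeal R, x ∉ maximalIdeal R ^ 2 ∧
        ∀ p ∈ minimalPrimes R, x ∉ p := by
      by_contra hcon
      push Not at hcon
      have hsub : (maximalIdeal R : Set R) ⊆
          ⋃ i ∈ insert (maximalIdeal R ^ 2) (minimalPrimes R), (i : Set R) := by
        intro x hx
        by_cases h2 : x ∈ maximalIdeal R ^ 2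
        · exact Set.mem_biUnion (Set.mem_insert _ _) h2
        · obtain ⟨p, hp, hxp⟩ := hcon x hx h2
          exact Set.mem_biUnion (Set.mem_insert_of_mem _ hp) hxp
      obtain ⟨p, hp, hle⟩ := (Ideal.subset_union_prime_finite (f := id)
        ((minimalPrimes.finite_of_isNoetherianRing R).insert (maximalIdeal R ^ 2))
        (maximalIdeal R ^ 2) (maximalIdeal R ^ 2) (by
          rintro i (rfl | hi) h1 h2
          · exact absurd rfl h1
          · exact hi.1.1)).mp hsub
      rcases hp with rfl | hp
      · have hm0 : maximalIdeal R = ⊥ := by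
          refine Submodule.eq_bot_of_le_smul_of_le_jacobson_bot (maximalIdeal R) _
            (IsNoetherian.noetherian _) ?_ (IsLocalRing.maximalIdeal_le_jacobson _)
          simpa [pow_two] using hle
        exact hnm (by
          rw [hm0]
          have : IsDomain R := (IsLocalRing.isField_iff_maximalIdeal_eq.mpr hm0).isDomain
          simp [IsDomain.minimalPrimes_eq_singleton_bot])
      · have hpp : p.IsPrime := hp.1.1
        have : maximalIdeal R = p := (maximalIdeal.isMaximal R).eq_of_le hpp.ne_top hle
        exact hnm (this ▸ hp)
    obtain ⟨hx2, hxp⟩ := hx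
    have := isLocalRing_quotient_span_singleton hxm
    rw [← hs] at hxm
    obtain ⟨a, ha⟩ := (Ideal.mem_span_range_iff_exists_fun).mp hxm
    rw [hs] at hxm
    have hsm : ∀ i, s i ∈ maximalIdeal R := fun i => hs ▸ Ideal.subset_span ⟨i, rfl⟩
    -- As `x` is not in the square of the maximal ideal, some coefficient is a unit, so `x` can
    -- replace `s i` as a generator.
    obtain ⟨i, hi⟩ : ∃ i, IsUnit (a i) := by
      by_contra hcon
      push Not at hcon
      apply hx2
      rw [← ha, pow_two]
      exact Ideal.sum_mem _ fun i _ => Ideal.mul_mem_mul ((mem_maximalIdeal _).mpr (hcon i)) (hsm i)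
    have hspan : Ideal.span (insert x (Set.range (s ∘ i.succAbove))) = maximalIdeal R := by
      apply le_antisymm
      · rw [Ideal.span_le]
        rintro _ (rfl | ⟨j, rfl⟩)
        · exact hxm
        · exact hsm _
      · rw [← hs, Ideal.span_le]
        rintro _ ⟨j, rfl⟩
        have hj : ∀ j, s (i.succAbove j) ∈
            Ideal.span (insert x (Set.range (s ∘ i.succAbove))) := fun j =>
          Ideal.subset_span (Set.mem_insert_of_mem _ ⟨j, rfl⟩)
        rcases Fin.eq_self_or_eq_succAbove i j with rfl | ⟨k, rfl⟩
        · rw [Fin.sum_univ_succAbove _ j] at ha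
          have : a j * s j ∈ Ideal.span (insert x (Set.range (s ∘ j.succAbove))) := by
            have h1 : a j * s j = x - ∑ k, a (j.succAbove k) * s (j.succAbove k) := by
              rw [← ha]; ring
            rw [h1]
            exact Ideal.sub_mem _ (Ideal.subset_span (Set.mem_insert _ _))
              (Ideal.sum_mem _ fun k _ => Ideal.mul_mem_left _ _ (hj k))
          exact (Ideal.unit_mul_mem_iff_mem _ hi).mp this
        · exact hj k
    have hdom : IsDomain (R ⧸ Ideal.span {x}) :=
      ih _ _ (span_quotient_eq_maximalIdeal x _ hspan) (le_ringKrullDim_quotient hxm hd)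
    have hprime : (Ideal.span {x}).IsPrime := (Ideal.Quotient.isDomain_iff_prime _).mp hdom
    obtain ⟨q, hq, hqx⟩ := Ideal.exists_minimalPrimes_le (show (⊥ : Ideal R) ≤ Ideal.span {x} from
      bot_le)
    have hqp : q.IsPrime := hq.1.1
    have hxq : x ∉ q := hxp q hq
    -- An element `r * x` of `q` has `r ∈ q` because `x ∉ q`. So `q` is contained in the maximal
    -- ideal times `q`, and Nakayama applies.
    have hq0 : q = ⊥ := by
      refine Submodule.eq_bot_of_le_smul_of_le_jacobson_bot (maximalIdeal R) _
        (IsNoetherian.noetherian _) ?_ (IsLocalRing.maximalIdeal_le_jacobson _)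
      intro y hy
      obtain ⟨r, rfl⟩ := Ideal.mem_span_singleton'.mp (hqx hy)
      rw [mul_comm]
      exact Submodule.smul_mem_smul hxm ((hqp.mem_or_mem hy).resolve_right hxq)
    rw [hq0] at hqp
    exact IsDomain.of_bot_isPrime R

lemma IsRegularParameters.isDomain {R : Type*} [CommRing R] [IsLocalRing R] [IsNoetherianRing R]
    {d : ℕ} {s : Fin d → R} (hs : IsRegularParameters s) : IsDomain R :=
  isDomain_of_span_eq_maximalIdeal d R s hs.1 hs.2.le

/-- Otherwise `s j` would be superfluous and fewer than `dim R` elements would generate the maximal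
ideal. -/
lemma IsRegularParameters.not_dvd {R : Type*} [CommRing R] [IsLocalRing R] [IsNoetherianRing R]
    {d : ℕ} {s : Fin d → R} (hs : IsRegularParameters s) {i j : Fin d} (hij : i ≠ j) :
    ¬ s i ∣ s j := by
  intro hdvd
  have h1 : Ideal.span (s '' {j}ᶜ) = maximalIdeal R := by
    rw [← hs.1]
    apply le_antisymm (Ideal.span_mono (Set.image_subset_range _ _))
    rw [Ideal.span_le]
    rintro _ ⟨k, rfl⟩
    by_cases hk : k = j
    · subst hk
      exact Ideal.mem_of_dvd _ hdvd (Ideal.subset_span ⟨i, hij, rfl⟩)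
    · exact Ideal.subset_span ⟨k, hk, rfl⟩
  have h2 := ringKrullDim_le_spanFinrank_maximalIdeal (R := R)
  have h3 : (maximalIdeal R).spanFinrank ≤ d - 1 := by
    rw [← h1]
    refine (Submodule.spanFinrank_span_le_ncard_of_finite (Set.toFinite _)).trans ?_
    refine (Set.ncard_image_le (Set.toFinite _)).trans ?_
    rw [Set.ncard_compl]
    simp
  rw [← hs.2] at h2
  have h4 : d ≤ (maximalIdeal R).spanFinrank := by exact_mod_cast h2
  have := j.pos
  omega

/-- The quotient by `s i` again has a maximal ideal generated by at most as many elements as its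
dimension, so it is a domain. Counting generators excludes `s i = 0`. -/
lemma IsRegularParameters.prime {R : Type*} [CommRing R] [IsLocalRing R] [IsNoetherianRing R]
    {d : ℕ} {s : Fin d → R} (hs : IsRegularParameters s) (i : Fin d) : Prime (s i) := by
  obtain ⟨d, rfl⟩ : ∃ d', d = d' + 1 := ⟨d - 1, by have := i.pos; omega⟩
  have hm : s i ∈ maximalIdeal R := hs.1 ▸ Ideal.subset_span ⟨i, rfl⟩
  have := isLocalRing_quotient_span_singleton hm
  have hspan : Ideal.span (insert (s i) (Set.range (s ∘ i.succAbove))) = maximalIdeal R := by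
    rw [← hs.1]
    congr 1
    ext y
    constructor
    · rintro (rfl | ⟨k, rfl⟩)
      exacts [⟨_, rfl⟩, ⟨_, rfl⟩]
    · rintro ⟨k, rfl⟩
      rcases Fin.eq_self_or_eq_succAbove i k with rfl | ⟨k, rfl⟩
      exacts [Set.mem_insert _ _, Set.mem_insert_of_mem _ ⟨k, rfl⟩]
  have hdom := isDomain_of_span_eq_maximalIdeal d (R ⧸ Ideal.span {s i}) _
    (span_quotient_eq_maximalIdeal _ _ hspan) (le_ringKrullDim_quotient hm hs.2.le)
  have hp := (Ideal.Quotient.isDomain_iff_prime _).mp hdom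
  refine (Ideal.span_singleton_prime ?_).mp hp
  intro h0
  have h1 : (s '' {i}ᶜ).ncard ≤ d := by
    refine (Set.ncard_image_le (Set.toFinite _)).trans ?_
    rw [Set.ncard_compl]
    simp
  have h2 : Ideal.span (s '' {i}ᶜ) = maximalIdeal R := by
    rw [← hs.1]
    apply le_antisymm (Ideal.span_mono (Set.image_subset_range _ _))
    rw [Ideal.span_le]
    rintro _ ⟨k, rfl⟩
    by_cases hk : k = i
    · subst hk; rw [h0]; exact zero_mem _
    · exact Ideal.subset_span ⟨k, hk, rfl⟩
  have h3 := ringKrullDim_le_spanFinrank_maximalIdeal (R := R)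
  rw [← hs.2] at h3
  have h4 : d + 1 ≤ (maximalIdeal R).spanFinrank := by exact_mod_cast h3
  rw [← h2] at h4
  have := (Submodule.spanFinrank_span_le_ncard_of_finite (R := R)
    (Set.toFinite (s '' {i}ᶜ))).trans h1
  exact absurd (h4.trans this) (by omega)

end RegularLocal

end PTM

namespace PTM

/-! ### Pushouts of rings, flatness, and radical ideals under smooth maps -/

section Algebra

lemma exists_comp_eq_of_surjective {A B C : Type*} [CommRing A] [CommRing B] [CommRing C]
    {f : A →+* B} (hf : Function.Surjective f) {g : A →+* C}
    (h : RingHom.ker f ≤ RingHom.ker g) : ∃ k : B →+* C, k.comp f = g :=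
  ⟨RingHom.liftOfSurjective f hf ⟨g, h⟩,
    RingHom.liftOfRightInverse_comp f _ (Function.rightInverse_surjInv hf) ⟨g, h⟩⟩

/-- Every element of a pushout of commutative rings is a sum of products. -/
lemma pushout_induction {A A' B B' : CommRingCat.{u}} {φ : A ⟶ B} {g : A ⟶ A'} {b : B ⟶ B'}
    {φ' : A' ⟶ B'} (H : IsPushout φ g b φ') {P : B' → Prop} (h0 : P 0)
    (hadd : ∀ x y, P x → P y → P (x + y)) (hmul : ∀ x y, P (b.hom x * φ'.hom y)) (z : B') : P z := by
  algebraize [φ.hom, g.hom, b.hom, φ'.hom, b.hom.comp φ.hom]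
  have : IsScalarTower A A' B' := .of_algebraMap_eq' (by
    have := congr(($H.w).hom)
    simpa [RingHom.algebraMap_toAlgebra] using this)
  have hp : Algebra.IsPushout A B A' B' := CommRingCat.isPushout_iff_isPushout.mp H
  obtain ⟨z, rfl⟩ := (Algebra.IsPushout.equiv A B A' B').surjective z
  induction z with
  | zero => simpa using h0
  | add x y hx hy => rw [map_add]; exact hadd _ _ hx hy
  | tmul x y => rw [Algebra.IsPushout.equiv_tmul]; exact hmul x y

lemma pushout_flat {A A' B B' : CommRingCat.{u}} {φ : A ⟶ B} {g : A ⟶ A'} {b : B ⟶ B'}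
    {φ' : A' ⟶ B'} (H : IsPushout φ g b φ') (hg : g.hom.Flat) : b.hom.Flat := by
  algebraize [φ.hom, g.hom, b.hom, φ'.hom, b.hom.comp φ.hom]
  have : IsScalarTower A A' B' := .of_algebraMap_eq' (by
    have := congr(($H.w).hom)
    simpa [RingHom.algebraMap_toAlgebra] using this)
  have hp : Algebra.IsPushout A A' B B' := (CommRingCat.isPushout_iff_isPushout.mp H).symm
  exact RingHom.Flat.isStableUnderBaseChange A A' B B' hg

lemma pushout_injective {A A' B B' : CommRingCat.{u}} {φ : A ⟶ B} {g : A ⟶ A'} {b : B ⟶ B'}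
    {φ' : A' ⟶ B'} (H : IsPushout φ g b φ') (hg : g.hom.Flat) (hφ : Function.Injective φ.hom) :
    Function.Injective φ'.hom := by
  algebraize [φ.hom, g.hom, b.hom, φ'.hom, b.hom.comp φ.hom]
  have : IsScalarTower A A' B' := .of_algebraMap_eq' (by
    have := congr(($H.w).hom)
    simpa [RingHom.algebraMap_toAlgebra] using this)
  have hp : Algebra.IsPushout A B A' B' := CommRingCat.isPushout_iff_isPushout.mp H
  have h := Algebra.TensorProduct.includeRight_injective (R := A) (A := B) (B := A') hφ
  have h2 : ⇑φ'.hom = (Algebra.IsPushout.equiv A B A' B') ∘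
      (Algebra.TensorProduct.includeRight : A' →ₐ[A] _) := by
    ext x
    simp [Algebra.IsPushout.equiv_tmul]
    rfl
  rw [h2]
  exact (Algebra.IsPushout.equiv A B A' B').injective.comp h

/-- The kernel of a surjection generates the kernel of its base change. -/
lemma pushout_ker {A A' B B' : CommRingCat.{u}} {φ : A ⟶ B} {g : A ⟶ A'} {b : B ⟶ B'}
    {φ' : A' ⟶ B'} (H : IsPushout φ g b φ') (hφ : Function.Surjective φ.hom) :
    RingHom.ker φ'.hom = (RingHom.ker φ.hom).map g.hom := by
  apply le_antisymm
  -- The map `A' → A' ⧸ J` agrees on `A` with a map from `B`, so it factors through the pushout and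
  -- kills the kernel of `φ'`.
  · let J := (RingHom.ker φ.hom).map g.hom
    let π : A' ⟶ CommRingCat.of (A' ⧸ J) := CommRingCat.ofHom (Ideal.Quotient.mk J)
    obtain ⟨k, hk⟩ := exists_comp_eq_of_surjective hφ
      (g := (Ideal.Quotient.mk J).comp g.hom) (fun x hx => by
        rw [RingHom.mem_ker, RingHom.comp_apply, Ideal.Quotient.eq_zero_iff_mem]
        exact Ideal.mem_map_of_mem _ hx)
    let χ : B ⟶ CommRingCat.of (A' ⧸ J) := CommRingCat.ofHom k
    have hχ : φ ≫ χ = g ≫ π := CommRingCat.hom_ext hk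
    intro x hx
    have h1 : π.hom x = (H.desc χ π hχ).hom (φ'.hom x) := by
      rw [← CommRingCat.comp_apply, H.inr_desc]
    rw [RingHom.mem_ker.mp hx, map_zero] at h1
    exact Ideal.Quotient.eq_zero_iff_mem.mp h1
  · rw [Ideal.map_le_iff_le_comap]
    intro x hx
    have : φ'.hom (g.hom x) = b.hom (φ.hom x) := by
      rw [← CommRingCat.comp_apply, ← CommRingCat.comp_apply, H.w]
    rw [Ideal.mem_comap, RingHom.mem_ker, this, RingHom.mem_ker.mp hx, map_zero]

lemma _root_.RingHom.Flat.map_mem_nonZeroDivisors {A B : Type*} [CommRing A] [CommRing B]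
    {φ : A →+* B} (hφ : φ.Flat) {t : A} (ht : t ∈ nonZeroDivisors A) :
    φ t ∈ nonZeroDivisors B := by
  algebraize [φ]
  rw [mem_nonZeroDivisors_iff_right]
  intro x hx
  refine Module.Flat.isSMulRegular_of_nonZeroDivisors (M := B) ht ?_
  simpa [Algebra.smul_def, mul_comm, RingHom.algebraMap_toAlgebra] using hx

/-- If `φ : A → B` is flat, then the annihilator of `φ a` is generated by that of `a`. -/
lemma _root_.RingHom.Flat.mem_map_annihilator {A B : Type*} [CommRing A] [CommRing B]
    {φ : A →+* B} (hφ : φ.Flat) {a : A} {b : B} (h : φ a * b = 0) {I : Ideal A}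
    (hI : ∀ x, a * x = 0 → x ∈ I) : b ∈ I.map φ := by
  algebraize [φ]
  -- The equational criterion of flatness writes `b` as a combination of elements of `A` that kill
  -- `a`.
  obtain ⟨k, c, y, h1, h2⟩ := Module.Flat.isTrivialRelation_of_sum_smul_eq_zero
    (ι := Unit) (f := fun _ => a) (x := fun _ => b) (by simpa [Algebra.smul_def, RingHom.algebraMap_toAlgebra] using h)
  rw [show b = _ from h1 ()]
  refine Ideal.sum_mem _ fun j _ => ?_
  rw [Algebra.smul_def]
  exact Ideal.mul_mem_right _ _ (Ideal.mem_map_of_mem φ (hI _ (by simpa using h2 j)))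

open Polynomial in
/-- A smooth algebra over a reduced ring is reduced: nilpotents of `S` times `X` are integral
elements of `S[X]`, and integral closure commutes with smooth base change. -/
theorem isReduced_of_smooth {R S : Type*} [CommRing R] [CommRing S] [Algebra R S]
    [Algebra.Smooth R S] [IsReduced R] : IsReduced S := by
  -- In an integral equation for `p` of positive degree, the top coefficient is a power of the
  -- leading coefficient of `p`, which would vanish since `R` is reduced.
  have key : ∀ p : R[X], IsIntegral R p → p.natDegree = 0 := by
    intro p hp
    by_contra hd
    obtain ⟨f, hf, hf0⟩ := hp
    have hp0 : p ≠ 0 := by rintro rfl; simp at hd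
    have hn : f.natDegree ≠ 0 := by
      intro h
      rw [hf.natDegree_eq_zero.mp h] at hf0
      simp only [eval₂_one] at hf0
      have : Subsingleton R[X] := subsingleton_of_zero_eq_one hf0.symm
      exact hp0 (Subsingleton.elim _ _)
    have hlc : p.leadingCoeff ^ f.natDegree = 0 := by
      rw [eval₂_eq_sum_range, Finset.sum_range_succ, hf.coeff_natDegree] at hf0
      have h := congr(coeff $hf0 (f.natDegree * p.natDegree))
      rw [coeff_add, finsetSum_coeff, Finset.sum_eq_zero, zero_add, map_one, one_mul,
        coeff_pow_mul_natDegree, coeff_zero] at h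
      · exact h
      · intro i hi
        rw [Finset.mem_range] at hi
        change (C (f.coeff i) * p ^ i).coeff _ = 0
        rw [coeff_C_mul, coeff_eq_zero_of_natDegree_lt (p := p ^ i), mul_zero]
        refine (natDegree_pow_le).trans_lt ?_
        exact Nat.mul_lt_mul_of_pos_right hi (Nat.pos_of_ne_zero hd)
    exact hp0 (leadingCoeff_eq_zero.mp (pow_eq_zero_iff hn |>.mp hlc))
  constructor
  intro s hs
  have hint : IsIntegral S (TensorProduct.tmul R s (X : R[X])) := by
    obtain ⟨n, hn⟩ := hs
    have : (TensorProduct.tmul R s (X : R[X])) ^ n = 0 := by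
      rw [Algebra.TensorProduct.tmul_pow, hn, TensorProduct.zero_tmul]
    exact IsIntegral.of_pow (n := n + 1) (by omega) (by rw [pow_succ, this, zero_mul]; exact isIntegral_zero)
  obtain ⟨z, hz⟩ := (TensorProduct.toIntegralClosure_bijective_of_smooth (R := R) (S := S)
    (B := R[X])).2 ⟨_, hint⟩
  let c : R[X] →ₗ[R] R := lcoeff R 1
  let c' := (TensorProduct.rid R S).toLinearMap ∘ₗ LinearMap.lTensor S c
  -- The linear coefficient kills everything that comes from the integral closure of `R` in `R[X]`,
  -- but it sends `s ⊗ X` to `s`.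
  have h0 : ∀ z : TensorProduct R S (integralClosure R R[X]),
      c' (TensorProduct.toIntegralClosure R S R[X] z : TensorProduct R S R[X]) = 0 := by
    intro z
    induction z with
    | zero => simp
    | add x y hx hy => simp only [map_add, Subalgebra.coe_add, hx, hy, add_zero]
    | tmul x y =>
      have : (y : R[X]).coeff 1 = 0 := by
        apply coeff_eq_zero_of_natDegree_lt
        rw [key y y.2]; exact one_pos
      change c' (TensorProduct.tmul R x (y : R[X])) = 0
      simp [c', c, this]
  have := h0 z
  rw [hz] at this
  simpa [c', c] using this

/-- Radical ideals generate radical ideals in smooth algebras. -/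
lemma isRadical_map_of_smooth {A B : Type u} [CommRing A] [CommRing B] {φ : A →+* B}
    (hφ : φ.Smooth) {I : Ideal A} (hI : I.IsRadical) : (I.map φ).IsRadical := by
  algebraize [φ]
  have hr : IsReduced (A ⧸ I) := (Ideal.isRadical_iff_quotient_reduced I).mp hI
  have : Algebra.Smooth (A ⧸ I) (TensorProduct A (A ⧸ I) B) := Algebra.Smooth.baseChange A B (A ⧸ I)
  have h2 : IsReduced (TensorProduct A (A ⧸ I) B) := isReduced_of_smooth (R := A ⧸ I)
  rw [Ideal.isRadical_iff_quotient_reduced]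
  exact isReduced_of_injective _ (Algebra.TensorProduct.quotIdealMapEquivQuotTensor B I).injective
end Algebra

end PTM

namespace PTM

/-! ### Dilatations: adjoining `ε / t` for nilpotent `ε` -/

section Dilatation

open Polynomial

/-- `φ : A → B` identifies `B` with the dilatation `A[ε / t]` of `A`, where `ε` is nilpotent. -/
structure IsDilatation {A B : Type*} [CommRing A] [CommRing B] (φ : A →+* B) (t ε : A) : Prop where
  injective : Function.Injective φ
  regular : φ t ∈ nonZeroDivisors B
  nilpotent : IsNilpotent ε
  generator : ∃ e : B, φ t * e = φ ε ∧ ∀ b, ∃ p : A[X], p.eval₂ φ e = b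

/-- Homogenization: the denominators of a polynomial in `ε / t` can be cleared uniformly. -/
lemma exists_pow_mul_eval₂ {A : Type*} [CommRing A] (t ε : A) (p : A[X]) :
    ∃ (n : ℕ) (a : A), ∀ (C : Type u) [CommRing C] (ψ : A →+* C) (c : C), ψ t * c = ψ ε →
      ψ t ^ n * p.eval₂ ψ c = ψ a := by
  induction p using Polynomial.induction_on' with
  | add p q hp hq =>
    obtain ⟨n, a, h⟩ := hp
    obtain ⟨m, b, h'⟩ := hq
    refine ⟨n + m, t ^ m * a + t ^ n * b, fun C _ ψ c hc => ?_⟩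
    rw [eval₂_add, map_add, map_mul, map_mul, ← h C ψ c hc, ← h' C ψ c hc, map_pow, map_pow]
    ring
  | monomial n x =>
    refine ⟨n, x * ε ^ n, fun C _ ψ c hc => ?_⟩
    rw [eval₂_monomial, map_mul, map_pow, ← hc, mul_pow]
    ring

lemma IsDilatation.hom_ext {A B C : Type*} [CommRing A] [CommRing B] [CommRing C] {φ : A →+* B}
    {t ε : A} (h : IsDilatation φ t ε) {χ₁ χ₂ : B →+* C} (h12 : χ₁.comp φ = χ₂.comp φ)
    (ht : χ₁ (φ t) ∈ nonZeroDivisors C) : χ₁ = χ₂ := by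
  obtain ⟨e, he, hgen⟩ := h.generator
  have h0 : ∀ a, χ₁ (φ a) = χ₂ (φ a) := fun a => RingHom.congr_fun h12 a
  have he' : χ₁ e = χ₂ e := by
    have : χ₁ (φ t) * (χ₁ e - χ₂ e) = 0 := by
      rw [mul_sub, ← map_mul, he, h0 t, ← map_mul, he, h0, sub_self]
    exact sub_eq_zero.mp ((mul_left_mem_nonZeroDivisors_eq_zero_iff ht).mp this)
  ext b
  obtain ⟨p, rfl⟩ := hgen b
  rw [hom_eval₂, hom_eval₂, h12, he']

/-- The lift sends `ε / t` to `c`. A polynomial relation satisfied by `ε / t` becomes, after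
multiplication by a power of `t`, an element of `A` that is zero since `φ` is injective; regularity
of `ψ t` then gives the same relation for `c`. -/
lemma IsDilatation.exists_lift {A B C : Type u} [CommRing A] [CommRing B] [CommRing C]
    {φ : A →+* B} {t ε : A} (h : IsDilatation φ t ε) (ψ : A →+* C) (ht : ψ t ∈ nonZeroDivisors C)
    {c : C} (hc : ψ t * c = ψ ε) : ∃ χ : B →+* C, χ.comp φ = ψ := by
  obtain ⟨e, he, hgen⟩ := h.generator
  have hs : Function.Surjective (eval₂RingHom φ e) := hgen
  obtain ⟨χ, hχ⟩ := exists_comp_eq_of_surjective hs (g := eval₂RingHom ψ c) (fun p hp => by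
    obtain ⟨n, a, hna⟩ := exists_pow_mul_eval₂.{u} t ε p
    have h1 := hna B φ e he
    rw [RingHom.mem_ker, coe_eval₂RingHom] at hp
    rw [hp, mul_zero, eq_comm, map_eq_zero_iff φ h.injective] at h1
    have h2 := hna C ψ c hc
    rw [h1, map_zero] at h2
    exact (mul_left_mem_nonZeroDivisors_eq_zero_iff (pow_mem ht n)).mp h2)
  refine ⟨χ, ?_⟩
  ext a
  simpa using RingHom.congr_fun hχ (Polynomial.C a)

/-- The model is the subring of the localization `A_t` generated over `A` by `ε / t`. -/
lemma exists_isDilatation {A : Type u} [CommRing A] {t ε : A} (ht : t ∈ nonZeroDivisors A)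
    (hε : IsNilpotent ε) : ∃ (B : Type u) (_ : CommRing B) (φ : A →+* B), IsDilatation φ t ε := by
  let e : Localization.Away t := IsLocalization.mk' _ ε (⟨t, 1, pow_one t⟩ : Submonoid.powers t)
  have hinj : Function.Injective (algebraMap A (Localization.Away t)) :=
    IsLocalization.injective _ (Submonoid.powers_le.mpr ht)
  have he : algebraMap A (Localization.Away t) t * e = algebraMap A _ ε :=
    IsLocalization.mk'_spec' (Localization.Away t) ε (⟨t, 1, pow_one t⟩ : Submonoid.powers t)
  refine ⟨(aeval e : A[X] →ₐ[A] Localization.Away t).range, inferInstance, algebraMap A _, ?_⟩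
  have hu : algebraMap A (Localization.Away t) t ∈ nonZeroDivisors (Localization.Away t) :=
    (IsLocalization.Away.algebraMap_isUnit t).mem_nonZeroDivisors
  refine ⟨fun a b hab => hinj (congrArg Subtype.val hab), ?_, hε,
    ⟨e, X, by simp⟩, Subtype.ext he, ?_⟩
  · rw [mem_nonZeroDivisors_iff_right]
    intro x hx
    exact Subtype.ext ((mul_right_mem_nonZeroDivisors_eq_zero_iff hu).mp (congrArg Subtype.val hx))
  · rintro ⟨_, p, rfl⟩
    refine ⟨p, Subtype.ext ?_⟩
    rw [← aeval_def]
    exact (aeval_algHom_apply (Subalgebra.val _) _ p).symm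

/-- Successive division: `e = ε / t` equals `t'` times the new generator `ε / (t * t')`, so
polynomials in the former are polynomials in the latter. -/
lemma IsDilatation.comp {A B C : Type*} [CommRing A] [CommRing B] [CommRing C] {φ : A →+* B}
    {ψ : B →+* C} {t ε : A} {t' : A} {e : B} (h : IsDilatation φ t ε) (he : φ t * e = φ ε)
    (h' : IsDilatation ψ (φ t') e) : IsDilatation (ψ.comp φ) (t * t') ε := by
  obtain ⟨e₀, he₀, hgen⟩ := h.generator
  have : e₀ = e := by
    have : φ t * (e₀ - e) = 0 := by rw [mul_sub, he₀, he, sub_self]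
    exact sub_eq_zero.mp ((mul_left_mem_nonZeroDivisors_eq_zero_iff h.regular).mp this)
  subst this
  obtain ⟨e', he', hgen'⟩ := h'.generator
  have hsub : ∀ b, ∃ p : A[X], p.eval₂ (ψ.comp φ) e' = ψ b := by
    intro b
    obtain ⟨p, rfl⟩ := hgen b
    refine ⟨p.comp (Polynomial.C t' * X), ?_⟩
    rw [eval₂_comp, hom_eval₂, eval₂_mul, eval₂_C, eval₂_X, RingHom.comp_apply, he']
  -- Clearing denominators turns an element of `C` killed by `t` into an element of `B` killed by
  -- `t`, where `t` is regular.
  have htt : ψ (φ t) ∈ nonZeroDivisors C := by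
    rw [mem_nonZeroDivisors_iff_right]
    intro c hc
    obtain ⟨p, rfl⟩ := hgen' c
    obtain ⟨n, b, hnb⟩ := exists_pow_mul_eval₂ (φ t') e₀ p
    have h1 := hnb C ψ e' he'
    have h2 : ψ (b * φ t) = 0 := by rw [map_mul, ← h1, mul_assoc, hc, mul_zero]
    rw [map_eq_zero_iff ψ h'.injective, mul_right_mem_nonZeroDivisors_eq_zero_iff h.regular] at h2
    rw [h2, map_zero] at h1
    exact (mul_left_mem_nonZeroDivisors_eq_zero_iff (pow_mem h'.regular n)).mp h1
  refine ⟨h'.injective.comp h.injective, ?_, h.nilpotent, e', ?_, ?_⟩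
  · rw [RingHom.comp_apply, map_mul, map_mul]
    exact mul_mem htt h'.regular
  · rw [RingHom.comp_apply, RingHom.comp_apply, map_mul, map_mul, mul_assoc, he', ← map_mul, he₀]
  · intro c
    obtain ⟨p, rfl⟩ := hgen' c
    induction p using Polynomial.induction_on' with
    | add p q hp hq =>
      obtain ⟨p', hp'⟩ := hp
      obtain ⟨q', hq'⟩ := hq
      exact ⟨p' + q', by rw [eval₂_add, eval₂_add, hp', hq']⟩
    | monomial n b =>
      obtain ⟨p', hp'⟩ := hsub b
      exact ⟨p' * X ^ n, by rw [eval₂_mul, hp', eval₂_X_pow, eval₂_monomial]⟩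

lemma IsDilatation.baseChange {A A' B B' : CommRingCat.{u}} {φ : A ⟶ B} {g : A ⟶ A'} {b : B ⟶ B'}
    {φ' : A' ⟶ B'} (H : IsPushout φ g b φ') (hg : g.hom.Flat) {t ε : A}
    (h : IsDilatation φ.hom t ε) : IsDilatation φ'.hom (g.hom t) (g.hom ε) := by
  have hw : ∀ a, φ'.hom (g.hom a) = b.hom (φ.hom a) := fun a => by
    rw [← CommRingCat.comp_apply, ← CommRingCat.comp_apply, H.w]
  obtain ⟨e, he, hgen⟩ := h.generator
  refine ⟨pushout_injective H hg h.injective, ?_, h.nilpotent.map _, b.hom e, ?_, ?_⟩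
  · rw [hw]
    exact (pushout_flat H hg).map_mem_nonZeroDivisors h.regular
  · rw [hw, hw, ← map_mul, he]
  · intro z
    induction z using pushout_induction H with
    | h0 => exact ⟨0, eval₂_zero _ _⟩
    | hadd x y hx hy =>
      obtain ⟨p, rfl⟩ := hx
      obtain ⟨q, rfl⟩ := hy
      exact ⟨p + q, eval₂_add _ _⟩
    | hmul x y =>
      obtain ⟨p, rfl⟩ := hgen x
      refine ⟨p.map g.hom * Polynomial.C y, ?_⟩
      rw [eval₂_mul, eval₂_C, eval₂_map, hom_eval₂]
      congr 2
      ext a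
      exact hw a

/-- Transport of dilatations along isomorphisms of the source and the target. -/
lemma IsDilatation.of_iso {A A' B B' : CommRingCat.{u}} {φ : A ⟶ B} {g : A ⟶ A'} {b : B ⟶ B'}
    {φ' : A' ⟶ B'} (hw : φ ≫ b = g ≫ φ') [IsIso g] [IsIso b] {t ε : A}
    (h : IsDilatation φ'.hom (g.hom t) (g.hom ε)) : IsDilatation φ.hom t ε := by
  have hp : IsPushout φ' (inv g) (inv b) φ := .of_vert_isIso ⟨by
    rw [IsIso.comp_inv_eq, Category.assoc, hw, IsIso.inv_hom_id_assoc]⟩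
  have hfl : (inv g).hom.Flat := RingHom.Flat.of_bijective (ConcreteCategory.bijective_of_isIso _)
  have := h.baseChange hp hfl
  rwa [← CommRingCat.comp_apply, ← CommRingCat.comp_apply, IsIso.hom_inv_id] at this

end Dilatation

/-! ### Modifications of thickenings and the comparison of two dilatations -/

section Birational

/-- `φ : A → B` is a finite modification of nilpotent thickenings of the same reduced ring, trivial
outside the zero set of `T`, and `B` has a principal nilradical. -/
structure IsThickMod {A B : Type*} [CommRing A] [CommRing B] (φ : A →+* B) (T : A) : Prop where
  injective : Function.Injective φ
  regular : φ T ∈ nonZeroDivisors B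
  torsion : ∀ b, ∃ (k : ℕ) (a : A), φ T ^ k * b = φ a
  principal : ∃ η, nilradical B = Ideal.span {η}
  surjective : ∀ b, ∃ a, b - φ a ∈ nilradical B

lemma IsThickMod.mem_nilradical {A B : Type*} [CommRing A] [CommRing B] {φ : A →+* B} {T : A}
    (h : IsThickMod φ T) {a : A} : φ a ∈ nilradical B ↔ a ∈ nilradical A := by
  rw [_root_.mem_nilradical, _root_.mem_nilradical, IsNilpotent.map_iff h.injective]

/-- Every element of `C` is an element of `B` plus a multiple of the nilpotent `e = η / s`. So the
reduction does not change, and `e` generates the nilradical, as `η = s * e`. The denominators divide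
powers of `T`. -/
lemma IsThickMod.dilatation {A B C : Type*} [CommRing A] [CommRing B] [CommRing C] {φ : A →+* B}
    {T : A} (h : IsThickMod φ T) {s : A} {η : B} {q : ℕ} (hs : s ∣ T ^ q) (hη : nilradical B = Ideal.span {η})
    {ψ : B →+* C} (hψ : IsDilatation ψ (φ s) η) :
    IsThickMod (ψ.comp φ) T ∧
      ∀ e, ψ (φ s) * e = ψ η → nilradical C = Ideal.span {e} := by
  obtain ⟨e, he, hgen⟩ := hψ.generator
  have htor : ∀ c, ∃ (k : ℕ) (b : B), ψ (φ s) ^ k * c = ψ b := by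
    intro c
    obtain ⟨p, rfl⟩ := hgen c
    obtain ⟨n, a, h⟩ := exists_pow_mul_eval₂ (φ s) η p
    exact ⟨n, a, h _ ψ e he⟩
  have henil : e ∈ nilradical C := by
    obtain ⟨n, hn⟩ := hψ.nilpotent
    refine ⟨n, ?_⟩
    have : ψ (φ s) ^ n * e ^ n = 0 := by rw [← mul_pow, he, ← map_pow, hn, map_zero]
    exact (mul_left_mem_nonZeroDivisors_eq_zero_iff (pow_mem hψ.regular n)).mp this
  have hdec : ∀ c, ∃ b d, c = ψ b + e * d := by
    intro c
    obtain ⟨p, rfl⟩ := hgen c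
    induction p using Polynomial.induction_on' with
    | add p q hp hq =>
      obtain ⟨b, d, hb⟩ := hp
      obtain ⟨b', d', hb'⟩ := hq
      refine ⟨b + b', d + d', ?_⟩
      rw [Polynomial.eval₂_add, hb, hb', map_add]
      ring
    | monomial n x =>
      rw [Polynomial.eval₂_monomial]
      cases n with
      | zero => exact ⟨x, 0, by simp⟩
      | succ n => exact ⟨0, ψ x * e ^ n, by rw [map_zero, zero_add, pow_succ]; ring⟩
  have hnil : nilradical C = Ideal.span {e} := by
    apply le_antisymm
    · intro c hc
      obtain ⟨b, d, rfl⟩ := hdec c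
      have h1 : ψ b ∈ nilradical C :=
        (Ideal.add_mem_iff_left _ (Ideal.mul_mem_right d _ henil)).mp hc
      rw [_root_.mem_nilradical, IsNilpotent.map_iff hψ.injective, ← _root_.mem_nilradical, hη,
        Ideal.mem_span_singleton'] at h1
      obtain ⟨x, rfl⟩ := h1
      rw [map_mul, ← he]
      exact Ideal.mem_span_singleton.mpr ⟨ψ x * ψ (φ s) + d, by ring⟩
    · rw [Ideal.span_le]
      simpa using henil
  refine ⟨⟨hψ.injective.comp h.injective, ?_, ?_, ⟨e, hnil⟩, ?_⟩, ?_⟩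
  · rw [mem_nonZeroDivisors_iff_right]
    intro c hc
    obtain ⟨k, b, hb⟩ := htor c
    have h2 : ψ (b * φ T) = 0 := by
      rw [map_mul, ← hb, mul_assoc]; exact mul_eq_zero_of_right _ hc
    rw [map_eq_zero_iff ψ hψ.injective, mul_right_mem_nonZeroDivisors_eq_zero_iff h.regular] at h2
    rw [h2, map_zero] at hb
    exact (mul_left_mem_nonZeroDivisors_eq_zero_iff (pow_mem hψ.regular k)).mp hb
  · intro c
    obtain ⟨k, b, hb⟩ := htor c
    obtain ⟨m, a, ha⟩ := h.torsion b
    obtain ⟨r, hr⟩ := hs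
    refine ⟨m + q * k, r ^ k * a, ?_⟩
    have h1 : ψ (φ a) = ψ (φ T) ^ m * ψ b := by rw [← ha, map_mul, map_pow]
    have h2 : ψ (φ T) ^ q = ψ (φ s) * ψ (φ r) := by rw [← map_pow, ← map_pow, hr, map_mul, map_mul]
    simp only [RingHom.comp_apply, map_mul, map_pow]
    rw [h1, ← hb, pow_add, pow_mul, h2]
    ring
  · intro c
    obtain ⟨b, d, rfl⟩ := hdec c
    obtain ⟨a, ha⟩ := h.surjective b
    refine ⟨a, ?_⟩
    have h1 : ψ b + e * d - (ψ.comp φ) a = ψ (b - φ a) + e * d := by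
      rw [map_sub, RingHom.comp_apply]; ring
    rw [h1]
    refine Ideal.add_mem _ ?_ (Ideal.mul_mem_right d _ henil)
    exact (IsNilpotent.map ha ψ : IsNilpotent _)
  · intro e' he'
    have : e' = e := by
      have : ψ (φ s) * (e' - e) = 0 := by rw [mul_sub, he, he', sub_self]
      exact sub_eq_zero.mp ((mul_left_mem_nonZeroDivisors_eq_zero_iff hψ.regular).mp this)
    rw [this, hnil]

/-- Every element of `B'` is the image of one of `A'` up to the ideal generated by the nilradical of
`B`. Such an image is nilpotent only if the element of `A'` is, so the assumption on the nilradical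
of `A'` carries over to `B'`. -/
lemma IsThickMod.baseChange {A A' B B' : CommRingCat.{u}} {φ : A ⟶ B} {g : A ⟶ A'} {b : B ⟶ B'}
    {φ' : A' ⟶ B'} (H : IsPushout φ g b φ') (hg : g.hom.Flat)
    (hnil : nilradical A' = (nilradical A).map g.hom) {T : A}
    (h : IsThickMod φ.hom T) :
    IsThickMod φ'.hom (g.hom T) ∧ nilradical B' = (nilradical B).map b.hom := by
  have hw : ∀ a, φ'.hom (g.hom a) = b.hom (φ.hom a) := fun a => by
    rw [← CommRingCat.comp_apply, ← CommRingCat.comp_apply, H.w]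
  have hinj := pushout_injective H hg h.injective
  have hle : (nilradical B).map b.hom ≤ nilradical B' := by
    rw [Ideal.map_le_iff_le_comap]
    intro x hx
    exact (IsNilpotent.map hx b.hom : IsNilpotent _)
  have hdec : ∀ z, ∃ a, z - φ'.hom a ∈ (nilradical B).map b.hom := by
    intro z
    induction z using pushout_induction H with
    | h0 => exact ⟨0, by simp⟩
    | hadd x y hx hy =>
      obtain ⟨a, ha⟩ := hx
      obtain ⟨a', ha'⟩ := hy
      refine ⟨a + a', ?_⟩
      rw [map_add, add_sub_add_comm]
      exact add_mem ha ha'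
    | hmul x y =>
      obtain ⟨a, ha⟩ := h.surjective x
      refine ⟨g.hom a * y, ?_⟩
      rw [map_mul, hw, ← sub_mul, ← map_sub]
      exact Ideal.mul_mem_right _ _ (Ideal.mem_map_of_mem _ ha)
  have hnil' : nilradical B' = (nilradical B).map b.hom := by
    refine le_antisymm (fun z hz => ?_) hle
    obtain ⟨a, ha⟩ := hdec z
    have h1 : φ'.hom a ∈ nilradical B' := by
      have := Ideal.sub_mem _ hz (hle ha)
      rwa [sub_sub_cancel] at this
    rw [_root_.mem_nilradical, IsNilpotent.map_iff hinj, ← _root_.mem_nilradical, hnil] at h1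
    have h2 : (nilradical A).map g.hom ≤ ((nilradical B).map b.hom).comap φ'.hom := by
      rw [Ideal.map_le_iff_le_comap]
      intro x hx
      rw [Ideal.mem_comap, Ideal.mem_comap, hw]
      exact Ideal.mem_map_of_mem _ (h.mem_nilradical.mpr hx)
    have := add_mem ha (h2 h1)
    rwa [sub_add_cancel] at this
  refine ⟨⟨hinj, ?_, ?_, ?_, ?_⟩, hnil'⟩
  · rw [hw]
    exact (pushout_flat H hg).map_mem_nonZeroDivisors h.regular
  · intro z
    induction z using pushout_induction H with
    | h0 => exact ⟨0, 0, by simp⟩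
    | hadd x y hx hy =>
      obtain ⟨k, a, ha⟩ := hx
      obtain ⟨m, c, hc⟩ := hy
      refine ⟨k + m, g.hom T ^ m * a + g.hom T ^ k * c, ?_⟩
      simp only [map_add, map_mul, ← ha, ← hc, map_pow]
      ring
    | hmul x y =>
      obtain ⟨k, a, ha⟩ := h.torsion x
      refine ⟨k, g.hom a * y, ?_⟩
      rw [map_mul, hw, hw, ← ha, map_mul, map_pow]
      ring
  · obtain ⟨η, hη⟩ := h.principal
    exact ⟨b.hom η, by rw [hnil', hη, Ideal.map_span, Set.image_singleton]⟩
  · rw [hnil']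
    exact hdec

/-- The ideal of a regular divisor of the reduction, viewed as a closed subscheme. -/
lemma IsThickMod.radical_span {A B : Type*} [CommRing A] [CommRing B] {φ : A →+* B} {T : A}
    (h : IsThickMod φ T) {t : A} (ht : (Ideal.span {t} ⊔ nilradical A).IsRadical) {η : B}
    (hη : nilradical B = Ideal.span {η}) :
    (Ideal.span {φ t}).radical = Ideal.span {φ t, η} := by
  apply le_antisymm
  · have : (Ideal.span {φ t, η}).IsRadical := by
      intro b hb
      obtain ⟨n, hn⟩ := hb
      rw [Ideal.span_insert, ← hη] at hn ⊢
      obtain ⟨a, ha⟩ := h.surjective b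
      have hmem : ∀ a, φ a ∈ Ideal.span {φ t} ⊔ nilradical B → a ∈ Ideal.span {t} ⊔ nilradical A := by
        intro a ha
        obtain ⟨x, hx, y, hy, hxy⟩ := Submodule.mem_sup.mp ha
        obtain ⟨c, rfl⟩ := Ideal.mem_span_singleton'.mp hx
        obtain ⟨d, hd⟩ := h.surjective c
        have : a - d * t ∈ nilradical A := by
          rw [← h.mem_nilradical, map_sub, map_mul, ← hxy]
          have : c * φ t + y - φ d * φ t = (c - φ d) * φ t + y := by ring
          rw [this]
          exact add_mem (Ideal.mul_mem_right _ _ hd) hy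
        rw [← sub_add_cancel a (d * t), add_comm]
        exact Submodule.add_mem_sup (Ideal.mul_mem_left _ _ (Ideal.mem_span_singleton_self t)) this
      have h1 : φ a ∈ Ideal.span {φ t} ⊔ nilradical B := by
        have h2 : (φ a) ^ n ∈ Ideal.span {φ t} ⊔ nilradical B := by
          have : (φ a) ^ n - b ^ n ∈ nilradical B := by
            obtain ⟨c, hc⟩ := sub_dvd_pow_sub_pow (φ a) b n
            rw [hc]
            exact Ideal.mul_mem_right _ _ (by rw [← neg_sub]; exact neg_mem ha)
          have := add_mem (Ideal.mem_sup_right (S := Ideal.span {φ t}) this) hn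
          rwa [sub_add_cancel] at this
        have h3 := ht ⟨n, hmem (a ^ n) (by rwa [map_pow])⟩
        obtain ⟨x, hx, y, hy, rfl⟩ := Submodule.mem_sup.mp h3
        obtain ⟨c, rfl⟩ := Ideal.mem_span_singleton'.mp hx
        rw [map_add, map_mul]
        exact Submodule.add_mem_sup (Ideal.mul_mem_left _ _ (Ideal.mem_span_singleton_self _))
          (h.mem_nilradical.mpr hy)
      have := add_mem (Ideal.mem_sup_right (S := Ideal.span {φ t}) ha) h1
      rwa [sub_add_cancel] at this
    rw [← this.radical]
    exact Ideal.radical_mono (Ideal.span_mono (by simp))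
  · rw [Ideal.span_le]
    rintro x (rfl | rfl)
    · exact Ideal.le_radical (Ideal.mem_span_singleton_self _)
    · have : x ∈ nilradical B := hη ▸ Ideal.mem_span_singleton_self x
      exact Ideal.radical_mono bot_le this

/-- The algebraic heart of the factorization: if `ε = u * m * η` up to `η ^ 2`, then dilating `B`
by `m` and `A` by `m * m` gives the same ring. -/
lemma IsThickMod.exists_ringEquiv {A B A₁ B₁ : Type u} [CommRing A] [CommRing B] [CommRing A₁]
    [CommRing B₁] {φ : A →+* B} {T : A} (h : IsThickMod φ T) {ε : A} {η u c : B} {m : A}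
    (hη : nilradical B = Ideal.span {η}) (hu : IsUnit u)
    (heq : φ ε = u * φ m * η + c * η ^ 2) {k : ℕ} (hm : m ∣ T ^ k)
    {ψ : B →+* B₁} (hψ : IsDilatation ψ (φ m) η) {χ : A →+* A₁} (hχ : IsDilatation χ (m * m) ε) :
    ∃ σ : A₁ →+* B₁, Function.Bijective σ ∧ σ.comp χ = ψ.comp φ := by
  obtain ⟨e, he, -⟩ := hψ.generator
  obtain ⟨hmod, hnil⟩ := h.dilatation hm hη hψ
  have hnil := hnil e he
  have henil : IsNilpotent e :=
    _root_.mem_nilradical.mp (hnil ▸ Ideal.mem_span_singleton_self e)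
  have hw : IsUnit (ψ u + ψ c * e) :=
    IsNilpotent.isUnit_add_left_of_commute ((Commute.all _ _).isNilpotent_mul_left henil)
      (hu.map ψ) (Commute.all _ _)
  obtain ⟨w, hw⟩ := hw
  have hreg : (ψ.comp φ) (m * m) ∈ nonZeroDivisors B₁ := by
    rw [map_mul]; exact mul_mem hψ.regular hψ.regular
  -- With `η = m * e`, the two terms of `heq` are `m² e` times `u` and times `c * e`. This is where
  -- the second factor `m` comes from.
  have he' : (ψ.comp φ) (m * m) * (e * w) = (ψ.comp φ) ε := by
    rw [RingHom.comp_apply, RingHom.comp_apply, heq, hw]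
    simp only [map_add, map_mul, map_pow, ← he]
    ring
  obtain ⟨σ, hσ⟩ := hχ.exists_lift (ψ.comp φ) hreg he'
  have hσa : ∀ a, σ (χ a) = ψ (φ a) := fun a => RingHom.congr_fun hσ a
  refine ⟨σ, ⟨?_, ?_⟩, hσ⟩
  · rw [injective_iff_map_eq_zero]
    intro x hx
    obtain ⟨e₁, he₁, hgen⟩ := hχ.generator
    obtain ⟨p, rfl⟩ := hgen x
    obtain ⟨n, a, hna⟩ := exists_pow_mul_eval₂.{u} (m * m) ε p
    have h1 := hna A₁ χ e₁ he₁
    have h2 := congrArg σ h1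
    rw [map_mul, hx, mul_zero, hσa, eq_comm] at h2
    have h3 : a = 0 := h.injective (hψ.injective (by rw [h2, map_zero, map_zero]))
    rw [h3, map_zero] at h1
    exact (mul_left_mem_nonZeroDivisors_eq_zero_iff (pow_mem hχ.regular n)).mp h1
  · obtain ⟨e₁, he₁, -⟩ := hχ.generator
    have hσe : σ e₁ = e * w := by
      have h1 : (ψ.comp φ) (m * m) * (σ e₁ - e * w) = 0 := by
        rw [mul_sub, he', ← RingHom.congr_fun hσ, RingHom.comp_apply, ← map_mul, he₁, hσa,
          RingHom.comp_apply, sub_self]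
      exact sub_eq_zero.mp ((mul_left_mem_nonZeroDivisors_eq_zero_iff hreg).mp h1)
    -- The reductions agree and `σ e₁` generates the nilradical, so `σ` is surjective modulo `σ e₁`.
    -- Iterating this reaches all of `B₁`, because `σ e₁` is nilpotent.
    have hdec : ∀ b, ∃ x d, b = σ x + σ e₁ * d := by
      intro b
      obtain ⟨a, ha⟩ := hmod.surjective b
      rw [hnil] at ha
      obtain ⟨d, hd⟩ := Ideal.mem_span_singleton'.mp ha
      refine ⟨χ a, (↑w⁻¹ : B₁) * d, ?_⟩
      have h4 : e * w * (↑w⁻¹ * d) = d * e * (w * ↑w⁻¹) := by ring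
      rw [hσe, h4, Units.mul_inv, mul_one, hd, hσa, RingHom.comp_apply]
      ring
    have hpow : ∀ n b, ∃ x d, b = σ x + σ e₁ ^ n * d := by
      intro n
      induction n with
      | zero => exact fun b => ⟨0, b, by simp⟩
      | succ n ih =>
        intro b
        obtain ⟨x, d, rfl⟩ := ih b
        obtain ⟨y, f, rfl⟩ := hdec d
        exact ⟨x + e₁ ^ n * y, f, by rw [map_add, map_mul, map_pow]; ring⟩
    intro b
    obtain ⟨n, hn⟩ := henil
    obtain ⟨x, d, rfl⟩ := hpow n b
    exact ⟨x, by rw [hσe, mul_pow, hn]; ring⟩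

end Birational

end PTM

namespace PTM

/-! ### Consequences of normal flatness -/

section NormallyFlat

/-- Identifies the module in the definition of `IsPTM` with `N ^ n / N ^ (n + 1)`. -/
lemma quotient_mk_eq_zero_iff {B : Type*} [CommRing B] (N : Ideal B) (n : ℕ) (y : ↥(N ^ n)) :
    (Submodule.Quotient.mk y : ↥(N ^ n) ⧸ (N • ⊤ : Submodule B ↥(N ^ n))) = 0 ↔
      (y : B) ∈ N ^ (n + 1) := by
  rw [Submodule.Quotient.mk_eq_zero]
  have : (N • ⊤ : Submodule B ↥(N ^ n)).map (N ^ n).subtype = N ^ (n + 1) := by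
    rw [Submodule.map_smul'', Submodule.map_top, Submodule.range_subtype, pow_succ']
    rfl
  rw [← this]
  constructor
  · exact fun h => ⟨y, h, rfl⟩
  · rintro ⟨z, hz, hzy⟩
    rwa [← Subtype.ext hzy]

/-- In a ring whose nilradical `N = (η)` has flat `N / N ^ 2`, the annihilator of `η` modulo
`η ^ 2` is idempotent. -/
lemma exists_mul_mem_of_flat {B : Type*} [CommRing B] {η : B}
    (hη : nilradical B = Ideal.span {η})
    (hfl : Module.Flat (B ⧸ nilradical B)
      (↥(nilradical B ^ 1) ⧸ (nilradical B • ⊤ : Submodule B ↥(nilradical B ^ 1))))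
    {r d : B} (hr : r * η = d * η ^ 2) :
    ∃ w d', r * w ∈ nilradical B ∧ (1 - w) * η = d' * η ^ 2 := by
  have hηN : η ∈ nilradical B ^ 1 := by
    rw [pow_one, hη]; exact Ideal.mem_span_singleton_self η
  have hsq : nilradical B ^ (1 + 1) = Ideal.span {η ^ 2} := by
    rw [hη, Ideal.span_singleton_pow]
  let x : ↥(nilradical B ^ 1) ⧸ (nilradical B • ⊤ : Submodule B ↥(nilradical B ^ 1)) :=
    Submodule.Quotient.mk ⟨η, hηN⟩
  have hx : (Ideal.Quotient.mk (nilradical B) r) • x = 0 := by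
    change Submodule.Quotient.mk (r • (⟨η, hηN⟩ : ↥(nilradical B ^ 1))) = _
    rw [quotient_mk_eq_zero_iff, hsq]
    exact Ideal.mem_span_singleton'.mpr ⟨d, by simp [hr]⟩
  -- The equational criterion writes the class `x` of `η` as `∑ a j • y j` with `r * a j = 0`. The
  -- module is cyclic, so `y j = c j • x`, and `w = ∑ α j * c j` acts on `x` as the identity.
  obtain ⟨k, a, y, h1, h2⟩ := Module.Flat.isTrivialRelation_of_sum_smul_eq_zero
    (ι := Unit) (f := fun _ => Ideal.Quotient.mk (nilradical B) r) (x := fun _ => x)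
    (by simpa using hx)
  have h1 : x = ∑ j, a () j • y j := h1 ()
  have hy : ∀ j, ∃ c : B, y j = Submodule.Quotient.mk (c • (⟨η, hηN⟩ : ↥(nilradical B ^ 1))) := by
    intro j
    obtain ⟨⟨z, hz⟩, hzy⟩ := Submodule.Quotient.mk_surjective _ (y j)
    have hz' := hz
    rw [pow_one, hη] at hz'
    obtain ⟨c, rfl⟩ := Ideal.mem_span_singleton'.mp hz'
    exact ⟨c, by rw [← hzy]; rfl⟩
  choose c hc using hy
  have hα : ∀ j, ∃ α : B, a () j = Ideal.Quotient.mk _ α := fun j =>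
    (Ideal.Quotient.mk_surjective (a () j)).imp fun _ h => h.symm
  choose α hα using hα
  refine ⟨∑ j, α j * c j, ?_⟩
  have h3 : (1 - ∑ j, α j * c j) * η ∈ nilradical B ^ (1 + 1) := by
    have : Submodule.Quotient.mk ((1 - ∑ j, α j * c j) • (⟨η, hηN⟩ : ↥(nilradical B ^ 1))) =
        (0 : ↥(nilradical B ^ 1) ⧸ (nilradical B • ⊤ : Submodule B ↥(nilradical B ^ 1))) := by
      rw [sub_smul, one_smul, Submodule.Quotient.mk_sub, Finset.sum_smul, sub_eq_zero]
      change x = _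
      rw [h1, ← Submodule.mkQ_apply, map_sum]
      refine Finset.sum_congr rfl fun j _ => ?_
      rw [hc, hα, mul_smul]
      rfl
    exact (quotient_mk_eq_zero_iff _ 1 _).mp this
  rw [hsq] at h3
  obtain ⟨d', hd'⟩ := Ideal.mem_span_singleton'.mp h3
  refine ⟨d', ?_, hd'.symm⟩
  rw [Finset.mul_sum]
  refine Ideal.sum_mem _ fun j _ => ?_
  have h4 : Ideal.Quotient.mk (nilradical B) (r * α j) = 0 := by
    have := h2 j
    simp only [Finset.univ_unique, Finset.sum_singleton] at this
    rw [map_mul, ← hα]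
    exact this
  rw [← mul_assoc]
  exact Ideal.mul_mem_right _ _ (Ideal.Quotient.eq_zero_iff_mem.mp h4)

/-- Elements that are regular on the reduction of a normally flat ring are regular. -/
lemma mem_nonZeroDivisors_of_normallyFlat {B : Type*} [CommRing B] {η : B}
    (hη : nilradical B = Ideal.span {η})
    (hfl : ∀ n : ℕ, Module.Flat (B ⧸ nilradical B)
      (↥(nilradical B ^ n) ⧸ (nilradical B • ⊤ : Submodule B ↥(nilradical B ^ n))))
    {t : B} (ht : Ideal.Quotient.mk (nilradical B) t ∈ nonZeroDivisors (B ⧸ nilradical B)) :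
    t ∈ nonZeroDivisors B := by
  rw [mem_nonZeroDivisors_iff_right]
  intro b hb
  -- By flatness `t` is regular on every `N ^ n / N ^ (n + 1)`, so an element killed by `t` moves
  -- down the whole filtration, which is finite since `η` is nilpotent.
  have key : ∀ n, b ∈ nilradical B ^ n := by
    intro n
    induction n with
    | zero => simp
    | succ n ih =>
      have := hfl n
      rw [← quotient_mk_eq_zero_iff _ n ⟨b, ih⟩]
      refine Module.Flat.isSMulRegular_of_nonZeroDivisors ht ?_
      change _ • _ = _ • (0 : _)
      rw [smul_zero]
      change Submodule.Quotient.mk (t • (⟨b, ih⟩ : ↥(nilradical B ^ n))) = _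
      rw [quotient_mk_eq_zero_iff]
      simp [mul_comm t b, hb]
  obtain ⟨n, hn⟩ : IsNilpotent η :=
    _root_.mem_nilradical.mp (hη ▸ Ideal.mem_span_singleton_self η)
  have := key n
  rw [hη, Ideal.span_singleton_pow, hn] at this
  simpa using this

end NormallyFlat

/-! ### Divisors of products of primes -/

section Factors

/-- Each prime factor of the product divides either `a` or the cofactor and can be cancelled there.
Exponents of units are normalized to `0`, which later gives `E i` multiplicity zero at centers of
charts off `E i`. -/
lemma exists_associated_prod_pow_of_dvd {R ι : Type*} [CommRing R] [IsDomain R] [Fintype ι]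
    {p : ι → R} (hp : ∀ i, Prime (p i) ∨ IsUnit (p i)) (s : Multiset ι) :
    ∀ a : R, a ∣ (s.map p).prod → ∃ n : ι → ℕ, Associated a (∏ i, p i ^ n i) ∧
      ∀ i, IsUnit (p i) → n i = 0 := by
  classical
  induction s using Multiset.induction_on with
  | empty =>
    intro a ha
    refine ⟨0, ?_, fun _ _ => rfl⟩
    simpa [associated_one_iff_isUnit, isUnit_iff_dvd_one] using ha
  | cons i s ih =>
    intro a ha
    rw [Multiset.map_cons, Multiset.prod_cons] at ha
    by_cases hu : IsUnit (p i)
    · exact ih a (hu.dvd_mul_left.mp ha)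
    · have hpi := (hp i).resolve_right hu
      obtain ⟨b, hb⟩ := ha
      rcases hpi.dvd_or_dvd (Dvd.intro _ hb) with ⟨a', rfl⟩ | ⟨b', rfl⟩
      · rw [mul_assoc] at hb
        obtain ⟨n, hn, hn'⟩ := ih a' ⟨b, mul_left_cancel₀ hpi.ne_zero hb⟩
        refine ⟨n + Pi.single i 1, ?_, fun j hj => ?_⟩
        · have : ∏ j, p j ^ (n + Pi.single i 1 : ι → ℕ) j = p i * ∏ j, p j ^ n j := by
            simp only [Pi.add_apply, pow_add, Finset.prod_mul_distrib, Pi.single_apply, pow_ite,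
              pow_one, pow_zero, Finset.prod_ite_eq', Finset.mem_univ, if_true]
            ring
          rw [this]
          exact hn.mul_left _
        · have : j ≠ i := by rintro rfl; exact hu hj
          simp [hn' j hj, this]
      · refine ih a ⟨b', mul_left_cancel₀ hpi.ne_zero ?_⟩
        rw [hb]; ring

/-- After cancelling `p i ^ n' i`, a surplus factor `p i` would have to divide some other `p j`. -/
lemma le_of_prod_pow_dvd {R ι : Type*} [CommRing R] [IsDomain R] [Fintype ι]
    {p p' : ι → R} (hpp : ∀ i, Associated (p i) (p' i)) {i : ι} (hi : Prime (p i))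
    (hij : ∀ j, j ≠ i → ¬ p i ∣ p j) {n n' : ι → ℕ}
    (h : ∏ j, p j ^ n j ∣ ∏ j, p' j ^ n' j) : n i ≤ n' i := by
  classical
  have h1 : p i ^ n i ∣ ∏ j, p j ^ n' j :=
    (Finset.dvd_prod_of_mem (fun j => p j ^ n j) (Finset.mem_univ i)).trans
      (h.trans (Associated.prod _ _ _ fun j _ => (hpp j).symm.pow_pow).dvd)
  by_contra hlt
  push Not at hlt
  rw [← Finset.mul_prod_erase _ _ (Finset.mem_univ i)] at h1
  have h2 : p i ^ n' i * p i ∣ p i ^ n' i * ∏ j ∈ Finset.univ.erase i, p j ^ n' j := by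
    refine dvd_trans ?_ h1
    rw [← pow_succ]
    exact pow_dvd_pow _ hlt
  have h3 := (mul_dvd_mul_iff_left (pow_ne_zero _ hi.ne_zero)).mp h2
  obtain ⟨j, hj, hdvd⟩ := hi.exists_mem_finset_dvd h3
  exact hij j (Finset.ne_of_mem_erase hj) (hi.dvd_of_dvd_pow hdvd)

end Factors

/-! ### The coefficient relating the two nilradicals -/

section Order

variable {A B : Type*} [CommRing A] [CommRing B] {φ : A →+* B} {T : A}

/-- Elements that kill `η` modulo `η ^ 2`, up to functions `w` on the base that are invertible
where `η` does not vanish. -/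
def AnnihilatorCondition (φ : A →+* B) (η : B) : Prop :=
  ∀ r d, r * η = d * η ^ 2 → ∃ (w : A) (d' : B), r * φ w ∈ nilradical B ∧
    (1 - φ w) * η = d' * η ^ 2

/-- The function supplied by flatness can be taken from `A`, since the reductions agree; it can then
be used to shrink open subsets of `X`. -/
lemma IsThickMod.annihilatorCondition (h : IsThickMod φ T) {η : B}
    (hη : nilradical B = Ideal.span {η})
    (hfl : Module.Flat (B ⧸ nilradical B)
      (↥(nilradical B ^ 1) ⧸ (nilradical B • ⊤ : Submodule B ↥(nilradical B ^ 1)))) :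
    AnnihilatorCondition φ η := by
  intro r d hr
  obtain ⟨w, d', hw, hd'⟩ := exists_mul_mem_of_flat hη hfl hr
  obtain ⟨a, ha⟩ := h.surjective w
  have ha' := ha
  rw [hη] at ha'
  obtain ⟨x, hx⟩ := Ideal.mem_span_singleton'.mp ha'
  refine ⟨a, d' + x, ?_, ?_⟩
  · have : r * φ a = r * w - r * (w - φ a) := by ring
    rw [this]
    exact sub_mem hw (Ideal.mul_mem_left _ _ ha)
  · have : φ a = w - x * η := by rw [hx]; ring
    rw [this, add_mul, ← hd']
    ring

lemma AnnihilatorCondition.mem_nilradical {η : B} (hac : AnnihilatorCondition φ η)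
    (hη : η ∈ nilradical B) (hann : ∀ b, b * η = 0 → b ∈ nilradical B) {r d : B}
    (hr : r * η = d * η ^ 2) : r ∈ nilradical B := by
  obtain ⟨w, d', h1, h2⟩ := hac r d hr
  have h3 : 1 - φ w - d' * η ∈ nilradical B := hann _ (by rw [sub_mul, h2]; ring)
  have h4 : 1 - φ w ∈ nilradical B := by
    have := add_mem h3 (Ideal.mul_mem_left _ d' hη)
    rwa [sub_add_cancel] at this
  have h5 : r = r * φ w + r * (1 - φ w) := by ring
  rw [h5]
  exact add_mem h1 (Ideal.mul_mem_left _ _ h4)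

/-- Writing `ε' = p * ε` and `η' = q * η`, comparison of the two equations gives `p u m = u' m' q`
up to nilpotents, and `q` is invertible modulo nilpotents. Thus `m` divides `m'` on the reduction.
-/
lemma IsThickMod.exists_sub_mul_mem (h : IsThickMod φ T) {ε ε' m m' : A} {η η' u u' c c' : B}
    (hε : nilradical A = Ideal.span {ε}) (hε' : nilradical A = Ideal.span {ε'})
    (hη : nilradical B = Ideal.span {η}) (hη' : nilradical B = Ideal.span {η'})
    (hu' : IsUnit u') (heq : φ ε = u * φ m * η + c * η ^ 2)
    (heq' : φ ε' = u' * φ m' * η' + c' * η' ^ 2) (hac : AnnihilatorCondition φ η)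
    (hann : ∀ b, b * η = 0 → b ∈ nilradical B) : ∃ a, m' - a * m ∈ nilradical A := by
  have hηN : η ∈ nilradical B := hη ▸ Ideal.mem_span_singleton_self η
  obtain ⟨p, hp⟩ := Ideal.mem_span_singleton'.mp
    (show ε' ∈ Ideal.span {ε} from hε ▸ hε' ▸ Ideal.mem_span_singleton_self ε')
  obtain ⟨q, hq⟩ := Ideal.mem_span_singleton'.mp
    (show η' ∈ Ideal.span {η} from hη ▸ hη' ▸ Ideal.mem_span_singleton_self η')
  obtain ⟨q', hq'⟩ := Ideal.mem_span_singleton'.mp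
    (show η ∈ Ideal.span {η'} from hη' ▸ hη ▸ Ideal.mem_span_singleton_self η)
  obtain ⟨v, rfl⟩ := hu'
  have h1 : φ p * u * φ m - v * φ m' * q ∈ nilradical B := by
    refine hac.mem_nilradical hηN hann (d := c' * q ^ 2 - φ p * c) ?_
    have h2 : φ p * (u * φ m * η + c * η ^ 2) = v * φ m' * (q * η) + c' * (q * η) ^ 2 := by
      rw [← heq, hq, ← heq', ← map_mul, hp]
    linear_combination h2
  have h2 : 1 - q' * q ∈ nilradical B := hann _ (by rw [sub_mul, one_mul, mul_assoc, hq, hq', sub_self])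
  let b := (↑v⁻¹ : B) * q' * φ p * u
  obtain ⟨a, ha⟩ := h.surjective b
  refine ⟨a, ?_⟩
  rw [← h.mem_nilradical, map_sub, map_mul]
  have hv : (v : B) * ↑v⁻¹ = 1 := Units.mul_inv v
  have : φ m' - φ a * φ m = φ m' * (1 - q' * q) + (b - φ a) * φ m -
      ↑v⁻¹ * q' * (φ p * u * φ m - v * φ m' * q) := by
    simp only [b]
    linear_combination (-φ m' * q' * q) * hv
  rw [this]
  exact sub_mem (add_mem (Ideal.mul_mem_left _ _ h2) (Ideal.mul_mem_right _ _ ha))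
    (Ideal.mul_mem_left _ _ h1)

/-- A multiple `T ^ k * η` comes from `A` and is nilpotent, hence equals `a₁ * ε`. Substituting `ε =
a * η + d * η ^ 2` shows that `T ^ k - a₁ * a` kills `η` modulo `η ^ 2`. -/
lemma IsThickMod.exists_eq_add (h : IsThickMod φ T) {ε : A} {η : B}
    (hε : nilradical A = Ideal.span {ε})
    (hη : nilradical B = Ideal.span {η}) (hac : AnnihilatorCondition φ η) :
    ∃ (a a₁ w : A) (d d' : B) (k : ℕ), φ ε = φ a * η + d * η ^ 2 ∧
      (T ^ k - a₁ * a) * w ∈ nilradical A ∧ (1 - φ w) * η = d' * η ^ 2 := by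
  have hεB : φ ε ∈ nilradical B := h.mem_nilradical.mpr (hε ▸ Ideal.mem_span_singleton_self ε)
  rw [hη] at hεB
  obtain ⟨b, hb⟩ := Ideal.mem_span_singleton'.mp hεB
  obtain ⟨a, ha⟩ := h.surjective b
  rw [hη] at ha
  obtain ⟨d, hd⟩ := Ideal.mem_span_singleton'.mp ha
  obtain ⟨k, a₀, hk⟩ := h.torsion η
  have ha₀ : a₀ ∈ nilradical A := by
    rw [← h.mem_nilradical, ← hk, hη]
    exact Ideal.mul_mem_left _ _ (Ideal.mem_span_singleton_self η)
  rw [hε] at ha₀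
  obtain ⟨a₁, rfl⟩ := Ideal.mem_span_singleton'.mp ha₀
  have heq : φ ε = φ a * η + d * η ^ 2 := by
    rw [← hb]
    linear_combination η * (-hd)
  have h1 : φ (T ^ k - a₁ * a) * η = φ a₁ * d * η ^ 2 := by
    rw [map_mul, heq] at hk
    rw [map_sub, map_mul, map_pow]
    linear_combination hk
  obtain ⟨w, d', hw, hd'⟩ := hac _ _ h1
  refine ⟨a, a₁, w, d, d', k, heq, ?_, hd'⟩
  rwa [← h.mem_nilradical, map_mul]

end Order

end PTM

namespace PTM

/-! ### Ideal sheaves and Cartier divisors on affine opens -/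

section Sections

variable {X Y S T : Scheme.{u}}

lemma isAffineOpen_of_isPullback {f : T ⟶ S} {g : Y ⟶ X} {iX : X ⟶ S} {iY : Y ⟶ T}
    (H : IsPullback g iY iX f) {US : S.Opens} {UT : T.Opens} {UX : X.Opens} {UY : Y.Opens}
    (hUST : UT ≤ f ⁻¹ᵁ US) (hUSX : UX ≤ iX ⁻¹ᵁ US) (hUY : UY = g ⁻¹ᵁ UX ⊓ iY ⁻¹ᵁ UT)
    (hUS : IsAffineOpen US) (hUT : IsAffineOpen UT) (hUX : IsAffineOpen UX) : IsAffineOpen UY :=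
  haveI : IsAffine _ := hUS
  haveI : IsAffine _ := hUT
  haveI : IsAffine _ := hUX
  .of_isIso (Scheme.Hom.isPullback_resLE H hUST hUSX hUY).isoPullback.hom

lemma isPushout_appLE {f : T ⟶ S} {g : Y ⟶ X} {iX : X ⟶ S} {iY : Y ⟶ T}
    (H : IsPullback g iY iX f) {US : S.Opens} {UT : T.Opens} {UX : X.Opens} {UY : Y.Opens}
    (hUST : UT ≤ f ⁻¹ᵁ US) (hUSX : UX ≤ iX ⁻¹ᵁ US) (hUY : UY = g ⁻¹ᵁ UX ⊓ iY ⁻¹ᵁ UT)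
    (hUS : IsAffineOpen US) (hUT : IsAffineOpen UT) (hUX : IsAffineOpen UX) :
    IsPushout (iX.appLE US UX hUSX) (f.appLE US UT hUST)
      (g.appLE UX UY (by simp [*])) (iY.appLE UT UY (by simp [*])) :=
  (isIso_pushoutSection_iff ..).mp
    (isIso_pushoutSection_of_isAffineOpen H hUST hUSX hUY hUS hUT hUX)

/-- The inverse image of a closed subscheme is a fibre product, so on affine opens its ideal is the
kernel of a base change of a surjection. -/
lemma comap_ideal (I : Y.IdealSheafData) (f : X ⟶ Y) (U : Y.affineOpens) (V : X.affineOpens)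
    (e : V.1 ≤ f ⁻¹ᵁ U.1) : (I.comap f).ideal V = (I.ideal U).map (f.appLE U.1 V.1 e).hom := by
  have hq : QuasiCompact (pullback.fst f I.subschemeι) := inferInstance
  have hW : IsAffineOpen (I.subschemeι ⁻¹ᵁ U.1) := U.2.preimage _
  have hUY : pullback.fst f I.subschemeι ⁻¹ᵁ V.1 =
      pullback.snd f I.subschemeι ⁻¹ᵁ (I.subschemeι ⁻¹ᵁ U.1) ⊓
        pullback.fst f I.subschemeι ⁻¹ᵁ V.1 := by
    refine (inf_eq_right.mpr ?_).symm
    rw [← Scheme.Hom.comp_preimage, ← pullback.condition, Scheme.Hom.comp_preimage]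
    exact Scheme.Hom.preimage_mono _ e
  have H := isPushout_appLE (IsPullback.of_hasPullback f I.subschemeι).flip e le_rfl hUY U.2 V.2 hW
  rw [Scheme.Hom.appLE_eq_app, Scheme.Hom.appLE_eq_app] at H
  have := pushout_ker H (I.subschemeι_app_surjective U)
  rw [I.ker_subschemeι_app U] at this
  rw [← this, Scheme.IdealSheafData.comap]
  exact Scheme.Hom.ker_apply _ _

lemma appLE_apply_apply {f : X ⟶ Y} {g : Y ⟶ S} {U : S.Opens} {V : Y.Opens} {W : X.Opens}
    (e₁ : V ≤ g ⁻¹ᵁ U) (e₂ : W ≤ f ⁻¹ᵁ V) (e₃ : W ≤ (f ≫ g) ⁻¹ᵁ U) (a : Γ(S, U)) :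
    (f.appLE V W e₂).hom ((g.appLE U V e₁).hom a) = ((f ≫ g).appLE U W e₃).hom a := by
  rw [← Scheme.Hom.appLE_comp_appLE f g U V W e₁ e₂]
  rfl

/-- The restriction map between rings of sections. -/
noncomputable abbrev res (X : Scheme.{u}) {V U : X.Opens} (h : V ≤ U) : Γ(X, U) →+* Γ(X, V) :=
  (X.presheaf.map (homOfLE h).op).hom

lemma id_appLE {V U : X.Opens} (h : V ≤ U) : ((𝟙 X : X ⟶ X).appLE U V h).hom = res X h :=
  congrArg CommRingCat.Hom.hom (Category.id_comp (X.presheaf.map (homOfLE h).op))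

lemma res_flat {V U : X.Opens} (hV : IsAffineOpen V) (hU : IsAffineOpen U) (h : V ≤ U) :
    (res X h).Flat := by
  exact id_appLE h ▸ Scheme.Hom.flat_appLE (𝟙 X) hU hV h

lemma res_smooth {V U : X.Opens} (hV : IsAffineOpen V) (hU : IsAffineOpen U) (h : V ≤ U) :
    (res X h).Smooth := by
  exact id_appLE h ▸ Scheme.Hom.smooth_appLE (𝟙 X) hU hV h

lemma eq_of_res_eq {U : X.Opens} {a b : Γ(X, U)}
    (h : ∀ x ∈ U, ∃ (V : X.Opens) (hV : V ≤ U), x ∈ V ∧ res X hV a = res X hV b) : a = b := by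
  refine X.IsSheaf.section_ext fun x hx => ?_
  obtain ⟨V, hV, hxV, heq⟩ := h x hx
  exact ⟨V, hV, hxV, heq⟩

lemma exists_affineOpen_le {x : X} {U : X.Opens} (hx : x ∈ U) :
    ∃ V : X.affineOpens, x ∈ V.1 ∧ V.1 ≤ U := by
  obtain ⟨V, hV, hxV, hVU⟩ := exists_isAffineOpen_mem_and_subset hx
  exact ⟨⟨V, hV⟩, hxV, hVU⟩

lemma iSup_eq_top_of_mem {V : X → X.Opens} (h : ∀ x, x ∈ V x) : iSup V = ⊤ :=
  top_le_iff.mp fun x _ => Opens.mem_iSup.mpr ⟨x, h x⟩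

lemma mem_nonZeroDivisors_of_span_eq {R : Type*} [CommRing R] {s t : R}
    (hs : s ∈ nonZeroDivisors R) (h : Ideal.span {t} = Ideal.span {s}) :
    t ∈ nonZeroDivisors R := by
  obtain ⟨a, rfl⟩ := Ideal.mem_span_singleton'.mp (h ▸ Ideal.mem_span_singleton_self s)
  exact (mul_mem_nonZeroDivisors.mp hs).2

lemma isCartier_ideal_nonZeroDivisors {I : X.IdealSheafData} (hI : IsCartier I)
    (V : X.affineOpens) {t : Γ(X, V.1)} (ht : I.ideal V = Ideal.span {t}) :
    t ∈ nonZeroDivisors Γ(X, V.1) := by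
  rw [mem_nonZeroDivisors_iff_right]
  intro b hb
  refine eq_of_res_eq fun x hx => ?_
  obtain ⟨U, hxU, s, hs, hsU⟩ := hI x
  obtain ⟨W, hxW, hW⟩ := exists_affineOpen_le (show x ∈ V.1 ⊓ U.1 from ⟨hx, hxU⟩)
  have hWV : W ≤ V := hW.trans inf_le_left
  have hWU : W ≤ U := hW.trans inf_le_right
  refine ⟨W.1, hWV, hxW, ?_⟩
  have h1 := I.map_ideal hWV
  have h2 := I.map_ideal hWU
  rw [ht, Ideal.map_span, Set.image_singleton] at h1
  rw [hsU, Ideal.map_span, Set.image_singleton] at h2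
  have h3 : res X hWV t ∈ nonZeroDivisors Γ(X, W.1) :=
    mem_nonZeroDivisors_of_span_eq ((res_flat W.2 U.2 hWU).map_mem_nonZeroDivisors hs)
      (h1.trans h2.symm)
  rw [map_zero]
  refine (mul_right_mem_nonZeroDivisors_eq_zero_iff h3).mp ?_
  rw [← map_mul, hb, map_zero]

lemma IsCartier.comap {I : Y.IdealSheafData} (hI : IsCartier I) (f : X ⟶ Y) [Flat f] :
    IsCartier (I.comap f) := by
  intro x
  obtain ⟨U, hU, t, ht, hIU⟩ := hI (f x)
  obtain ⟨V, hxV, hV⟩ := exists_affineOpen_le (show x ∈ f ⁻¹ᵁ U.1 from hU)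
  refine ⟨V, hxV, (f.appLE U.1 V.1 hV).hom t,
    (f.flat_appLE U.2 V.2 hV).map_mem_nonZeroDivisors ht, ?_⟩
  rw [comap_ideal I f U V hV, hIU, Ideal.map_span, Set.image_singleton]

lemma isCartier_of_forall_exists {I : X.IdealSheafData}
    (h : ∀ x : X, ∃ V : X.Opens, x ∈ V ∧ IsCartier (I.comap V.ι)) : IsCartier I := by
  intro x
  obtain ⟨V, hxV, hV⟩ := h x
  obtain ⟨W, hW, t, ht, hWt⟩ := hV ⟨x, hxV⟩
  have hW' : IsAffineOpen (V.ι ''ᵁ W.1) := W.2.image_of_isOpenImmersion V.ι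
  have hle : W.1 ≤ V.ι ⁻¹ᵁ (V.ι ''ᵁ W.1) := (V.ι.preimage_image_eq W.1).ge
  refine ⟨⟨V.ι ''ᵁ W.1, hW'⟩, ⟨⟨x, hxV⟩, hW, rfl⟩, ?_⟩
  let e := V.ι.appIso W.1
  have he : e.hom = V.ι.appLE _ _ hle := Scheme.Hom.appIso_hom' _ _
  have h1 := comap_ideal I V.ι ⟨_, hW'⟩ W hle
  rw [← he] at h1
  have hinj : Function.Injective e.hom.hom := e.commRingCatIsoToRingEquiv.injective
  have hsurj : Function.Surjective e.hom.hom := e.commRingCatIsoToRingEquiv.surjective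
  obtain ⟨s, rfl⟩ := hsurj t
  refine ⟨s, ?_, ?_⟩
  · rw [mem_nonZeroDivisors_iff_right] at ht ⊢
    intro b hb
    exact hinj ((ht _ (by rw [← map_mul, hb, map_zero])).trans (map_zero _).symm)
  · have h2 := congrArg (Ideal.comap e.hom.hom) (h1.symm.trans hWt)
    rw [← Set.image_singleton, ← Ideal.map_span, Ideal.comap_map_of_surjective _ hsurj,
      Ideal.comap_map_of_surjective _ hsurj] at h2
    have h3 : Ideal.comap e.hom.hom ⊥ = ⊥ := by
      rw [eq_bot_iff]
      intro x hx
      exact hinj (hx.trans (map_zero _).symm)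
    simpa [h3] using h2

/-- A morphism lifts if it lifts locally and all lifts are unique. -/
lemma exists_lift_of_local {Z Z' : Scheme.{u}} (q : Z' ⟶ Z) (g : T ⟶ Z)
    (huniq : ∀ {S : Scheme.{u}} (j : S ⟶ T) [IsOpenImmersion j] (k k' : S ⟶ Z'),
      k ≫ q = j ≫ g → k' ≫ q = j ≫ g → k = k')
    (hex : ∀ x : T, ∃ V : T.Opens, x ∈ V ∧ ∃ k : V.toScheme ⟶ Z', k ≫ q = V.ι ≫ g) :
    ∃ k : T ⟶ Z', k ≫ q = g := by
  choose V hxV k hk using hex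
  let 𝒰 : T.OpenCover := T.openCoverOfIsOpenCover V (.mk (iSup_eq_top_of_mem hxV))
  let K : ∀ x : 𝒰.I₀, 𝒰.X x ⟶ Z' := k
  have hk : ∀ x : 𝒰.I₀, K x ≫ q = 𝒰.f x ≫ g := hk
  refine ⟨𝒰.glueMorphisms K fun x y => ?_, ?_⟩
  · refine huniq (pullback.fst (𝒰.f x) (𝒰.f y) ≫ 𝒰.f x) _ _ ?_ ?_
    · rw [Category.assoc, hk, Category.assoc]
    · rw [Category.assoc, hk, pullback.condition, Category.assoc]
  · refine 𝒰.hom_ext _ _ fun x => ?_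
    rw [Scheme.Cover.ι_glueMorphisms_assoc, hk]

end Sections

/-! ### Reduced closed subschemes under smooth pullback -/

section Vanishing

variable {X Y : Scheme.{u}}

lemma radical_eq_of_local {I : X.IdealSheafData}
    (h : ∀ x : X, ∃ U : X.affineOpens, x ∈ U.1 ∧ (I.ideal U).IsRadical) : I.radical = I := by
  choose U hxU hU using h
  refine le_antisymm ?_ I.le_radical
  exact Scheme.IdealSheafData.le_of_iSup_eq_top U (iSup_eq_top_of_mem hxU) fun x => hU x

lemma vanishingIdeal_isRadical (C : Closeds X) (U : X.affineOpens) :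
    ((Scheme.IdealSheafData.vanishingIdeal C).ideal U).IsRadical := by
  rw [Scheme.IdealSheafData.vanishingIdeal_ideal]
  exact PrimeSpectrum.isRadical_vanishingIdeal _

lemma support_vanishingIdeal (C : Closeds X) :
    (Scheme.IdealSheafData.vanishingIdeal C).support = C := by
  ext1
  simp

/-- The pullback stays radical by smoothness, and a radical ideal sheaf is determined by its
support. -/
lemma vanishingIdeal_comap (C : Closeds Y) (f : X ⟶ Y) [Smooth f] :
    (Scheme.IdealSheafData.vanishingIdeal C).comap f =
      Scheme.IdealSheafData.vanishingIdeal (preimage f C) := by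
  have h : ((Scheme.IdealSheafData.vanishingIdeal C).comap f).radical =
      (Scheme.IdealSheafData.vanishingIdeal C).comap f := by
    refine radical_eq_of_local fun x => ?_
    obtain ⟨U, hxU, -⟩ := exists_affineOpen_le (show f x ∈ (⊤ : Y.Opens) from trivial)
    obtain ⟨V, hxV, hV⟩ := exists_affineOpen_le (show x ∈ f ⁻¹ᵁ U.1 from hxU)
    refine ⟨V, hxV, ?_⟩
    rw [comap_ideal _ f U V hV]
    exact isRadical_map_of_smooth (f.smooth_appLE U.2 V.2 hV) (vanishingIdeal_isRadical C U)
  rw [← h, ← Scheme.IdealSheafData.vanishingIdeal_support, Scheme.IdealSheafData.support_comap,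
    support_vanishingIdeal]
  rfl

lemma nilradical_map_of_smooth {A B : Type u} [CommRing A] [CommRing B] {φ : A →+* B}
    (hφ : φ.Smooth) : nilradical B = (nilradical A).map φ := by
  apply le_antisymm
  · exact (isRadical_map_of_smooth hφ (Ideal.radical_isRadical _)).radical_le_iff.mpr bot_le
  · rw [Ideal.map_le_iff_le_comap]
    exact fun x hx => (_root_.mem_nilradical.mp hx).map φ

end Vanishing

end PTM

namespace PTM

/-! ### Blowings up from the universal property -/

section Blowup

variable {Z Z' : Scheme.{u}} {q : Z' ⟶ Z} {I : Z.IdealSheafData}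

lemma IsBlowup.hom_ext (hq : IsBlowup q I) {W : Scheme.{u}} {k k' : W ⟶ Z'}
    (hk : IsCartier (I.comap (k ≫ q))) (h : k ≫ q = k' ≫ q) : k = k' :=
  (hq.2 W (k ≫ q) hk).unique rfl h.symm

lemma IsBlowup.baseChange (hq : IsBlowup q I) {X X' : Scheme.{u}} {k : X' ⟶ Z'} {q' : X' ⟶ X}
    {φ : X ⟶ Z} (H : IsPullback k q' q φ) [Flat φ] : IsBlowup q' (I.comap φ) := by
  have hk : Flat k := MorphismProperty.of_isPullback (P := @Flat) H.flip ‹_›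
  refine ⟨?_, fun W g hg => ?_⟩
  · rw [← Scheme.IdealSheafData.comap_comp, ← H.w, Scheme.IdealSheafData.comap_comp]
    exact hq.1.comap k
  · rw [← Scheme.IdealSheafData.comap_comp] at hg
    obtain ⟨m, hm, huniq⟩ := hq.2 W (g ≫ φ) hg
    refine ⟨H.lift m g hm, H.lift_snd _ _ _, fun m' hm' => ?_⟩
    refine H.hom_ext ?_ (by rw [hm', H.lift_snd])
    rw [H.lift_fst]
    refine huniq _ ?_
    simp only [Category.assoc]
    rw [H.w, ← hm', Category.assoc]

lemma IsBlowup.exists_iso (hq : IsBlowup q I) {Z'' : Scheme.{u}} {q₂ : Z'' ⟶ Z}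
    (hq₂ : IsBlowup q₂ I) : ∃ e : Z' ≅ Z'', e.hom ≫ q₂ = q := by
  obtain ⟨a, ha, -⟩ := hq₂.2 Z' q hq.1
  obtain ⟨b, hb, -⟩ := hq.2 Z'' q₂ hq₂.1
  refine ⟨⟨a, b, ?_, ?_⟩, ha⟩
  · refine hq.hom_ext ?_ ?_
    · rw [Category.assoc, hb, ha]; exact hq.1
    · rw [Category.assoc, hb, ha, Category.id_comp]
  · refine hq₂.hom_ext ?_ ?_
    · rw [Category.assoc, ha, hb]; exact hq₂.1
    · rw [Category.assoc, ha, hb, Category.id_comp]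

/-- Blowings up chosen independently upstairs and downstairs are related by a cartesian square,
because the base change is also a blowing up and blowings up are unique. -/
lemma IsBlowup.exists_isPullback (hq : IsBlowup q I) {X X' : Scheme.{u}} {q' : X' ⟶ X}
    (φ : X ⟶ Z) [Flat φ] (hq' : IsBlowup q' (I.comap φ)) : ∃ k, IsPullback k q' q φ := by
  have H := IsPullback.of_hasPullback q φ
  obtain ⟨e, he⟩ := hq'.exists_iso (hq.baseChange H)
  exact ⟨e.hom ≫ pullback.fst q φ, H.of_iso e.symm (Iso.refl _) (Iso.refl _) (Iso.refl _)
    (by simp) (by simp [← he]) (by simp) (by simp)⟩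

lemma IsBlowup.morphismRestrict (hq : IsBlowup q I) (W : Z.Opens) :
    IsBlowup (q ∣_ W) (I.comap W.ι) :=
  hq.baseChange (isPullback_morphismRestrict q W).flip

/-- Local lifts glue because lifts are unique over every open subscheme of the test scheme. -/
lemma isBlowup_of_local
    (h : ∀ z : Z, ∃ W : Z.Opens, z ∈ W ∧ IsBlowup (q ∣_ W) (I.comap W.ι)) : IsBlowup q I := by
  have huniq : ∀ {S : Scheme.{u}} (k k' : S ⟶ Z'), k ≫ q = k' ≫ q →
      IsCartier (I.comap (k ≫ q)) → k = k' := by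
    intro S k k' hk hc
    refine Scheme.hom_ext_of_forall _ _ fun s => ?_
    obtain ⟨W, hW, hqW⟩ := h ((k ≫ q) s)
    refine ⟨(k ≫ q) ⁻¹ᵁ W, hW, ?_⟩
    have H := isPullback_morphismRestrict q W
    have hl : ∀ m : S ⟶ Z', m ≫ q = k ≫ q →
        ((k ≫ q) ∣_ W) ≫ W.ι = (((k ≫ q) ⁻¹ᵁ W).ι ≫ m) ≫ q := by
      intro m hm
      rw [morphismRestrict_ι, Category.assoc, hm]
    have : H.lift _ _ (hl k rfl) = H.lift _ _ (hl k' hk.symm) := by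
      refine hqW.hom_ext ?_ ?_
      · rw [H.lift_fst, ← Scheme.IdealSheafData.comap_comp, morphismRestrict_ι,
          Scheme.IdealSheafData.comap_comp]
        exact hc.comap _
      · rw [H.lift_fst, H.lift_fst]
    rw [← H.lift_snd _ _ (hl k rfl), this, H.lift_snd]
  refine ⟨isCartier_of_forall_exists fun x => ?_, fun T g hg => ?_⟩
  · obtain ⟨W, hW, hqW⟩ := h (q x)
    refine ⟨q ⁻¹ᵁ W, hW, ?_⟩
    rw [← Scheme.IdealSheafData.comap_comp, ← morphismRestrict_ι, Scheme.IdealSheafData.comap_comp]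
    exact hqW.1
  · obtain ⟨k, hk⟩ := exists_lift_of_local q g (fun j _ k k' hk hk' => huniq k k'
      (hk.trans hk'.symm) (by rw [hk, Scheme.IdealSheafData.comap_comp]; exact hg.comap j))
      (fun x => by
        obtain ⟨W, hW, hqW⟩ := h (g x)
        obtain ⟨k, hk, -⟩ := hqW.2 _ (g ∣_ W) (by
          rw [← Scheme.IdealSheafData.comap_comp, morphismRestrict_ι,
            Scheme.IdealSheafData.comap_comp]
          exact hg.comap _)
        refine ⟨g ⁻¹ᵁ W, hW, k ≫ (q ⁻¹ᵁ W).ι, ?_⟩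
        rw [Category.assoc, ← morphismRestrict_ι, reassoc_of% hk, morphismRestrict_ι])
    refine ⟨k, hk, fun k' hk' => huniq _ _ (hk'.trans hk.symm) (by rw [hk']; exact hg)⟩

end Blowup

/-! ### Over an affine open, blowing up `(t, ε)` is a dilatation -/

section Affine

/-- Write `t = a * s` and `ε = b * s`. Then `b` is nilpotent as `s` is regular, and `a` and `b`
generate the unit ideal, so `a` is a unit. This is why one affine chart suffices for the blowing up.
-/
lemma regular_and_dvd_of_span_pair {R : Type*} [CommRing R] {t ε s : R}
    (hs : s ∈ nonZeroDivisors R) (hε : IsNilpotent ε) (h : Ideal.span {t, ε} = Ideal.span {s}) :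
    t ∈ nonZeroDivisors R ∧ t ∣ ε := by
  obtain ⟨a, ha⟩ := Ideal.mem_span_singleton'.mp
    (show t ∈ Ideal.span {s} from h ▸ Ideal.subset_span (by simp))
  obtain ⟨b, hb⟩ := Ideal.mem_span_singleton'.mp
    (show ε ∈ Ideal.span {s} from h ▸ Ideal.subset_span (by simp))
  obtain ⟨c, d, hcd⟩ := Ideal.mem_span_pair.mp
    (show s ∈ Ideal.span {t, ε} from h ▸ Ideal.mem_span_singleton_self s)
  have hb' : IsNilpotent b := by
    obtain ⟨n, hn⟩ := hε
    refine ⟨n, ?_⟩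
    rw [← hb, mul_pow] at hn
    exact (mul_right_mem_nonZeroDivisors_eq_zero_iff (pow_mem hs n)).mp hn
  have h1 : c * a + d * b = 1 := by
    have : (c * a + d * b - 1) * s = 0 := by
      rw [← ha, ← hb] at hcd
      linear_combination hcd
    exact sub_eq_zero.mp ((mul_right_mem_nonZeroDivisors_eq_zero_iff hs).mp this)
  have ha' : IsUnit a := by
    have h2 : IsUnit (c * a) := by
      rw [eq_sub_of_add_eq h1]
      exact IsNilpotent.isUnit_one_sub ((Commute.all _ _).isNilpotent_mul_left hb')
    exact isUnit_of_mul_isUnit_right h2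
  obtain ⟨a, rfl⟩ := ha'
  refine ⟨ha ▸ mul_mem a.isUnit.mem_nonZeroDivisors hs, ⟨↑a⁻¹ * b, ?_⟩⟩
  have h3 : (a : R) * ↑a⁻¹ = 1 := a.mul_inv
  rw [← ha, ← hb]
  linear_combination (-(b * s)) * h3

variable {Z : Scheme.{u}} {I : Z.IdealSheafData} {W : Z.Opens} (hW : IsAffineOpen W)
  {B : CommRingCat.{u}} (ψ : Γ(Z, W) ⟶ B)

lemma appLE_SpecMap_comp_fromSpec (e : ⊤ ≤ (Spec.map ψ ≫ hW.fromSpec) ⁻¹ᵁ W) :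
    (Spec.map ψ ≫ hW.fromSpec).appLE W ⊤ e = ψ ≫ (Scheme.ΓSpecIso B).inv := by
  have h := IsAffineOpen.SpecMap_appLE_fromSpec (Spec.map ψ ≫ hW.fromSpec) hW
    (isAffineOpen_top (Spec B)) e
  rw [IsAffineOpen.fromSpec_top, ← Category.assoc, cancel_mono, Scheme.isoSpec_Spec_inv,
    ← Spec.map_comp] at h
  exact Spec.map_injective h

lemma top_le_preimage_SpecMap_fromSpec : ⊤ ≤ (Spec.map ψ ≫ hW.fromSpec) ⁻¹ᵁ W := by
  rw [Scheme.Hom.comp_preimage, hW.fromSpec_preimage_self]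
  exact le_rfl

lemma exists_SpecMap_of_isAffineOpen {T : Scheme.{u}} {V : T.Opens} (hV : IsAffineOpen V)
    (p : T ⟶ Z) (e : V ≤ p ⁻¹ᵁ W) (k : V.toScheme ⟶ Spec B)
    (hk : k ≫ Spec.map ψ ≫ hW.fromSpec = V.ι ≫ p) :
    ∃ β : B ⟶ Γ(T, V), ψ ≫ β = p.appLE W V e ∧ k = hV.isoSpec.hom ≫ Spec.map β := by
  obtain ⟨β, hβ⟩ := Spec.map_surjective (hV.isoSpec.inv ≫ k)
  refine ⟨β, ?_, ?_⟩
  · apply Spec.map_injective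
    rw [← cancel_mono hW.fromSpec, IsAffineOpen.SpecMap_appLE_fromSpec p hW hV e, Spec.map_comp,
      hβ, Category.assoc, Category.assoc, hk, IsAffineOpen.isoSpec_inv_ι_assoc]
  · rw [hβ, Iso.hom_inv_id_assoc]

lemma dilatation_hom_ext {t ε : Γ(Z, W)} (hψ : IsDilatation ψ.hom t ε)
    (hI : I.ideal ⟨W, hW⟩ = Ideal.span {t, ε}) {T : Scheme.{u}} {k k' : T ⟶ Spec B}
    (hc : IsCartier (I.comap (k ≫ Spec.map ψ ≫ hW.fromSpec)))
    (h : k ≫ Spec.map ψ ≫ hW.fromSpec = k' ≫ Spec.map ψ ≫ hW.fromSpec) : k = k' := by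
  set p := k ≫ Spec.map ψ ≫ hW.fromSpec with hp
  refine Scheme.hom_ext_of_forall _ _ fun x => ?_
  obtain ⟨V, hxV, s, hs, hV⟩ := hc x
  have e : V.1 ≤ p ⁻¹ᵁ W := by
    intro y _
    exact top_le_preimage_SpecMap_fromSpec hW ψ (show k y ∈ ⊤ from trivial)
  refine ⟨V.1, hxV, ?_⟩
  obtain ⟨β, h1, h2⟩ := exists_SpecMap_of_isAffineOpen hW ψ V.2 p e (V.1.ι ≫ k)
    (by rw [Category.assoc])
  obtain ⟨β', h1', h2'⟩ := exists_SpecMap_of_isAffineOpen hW ψ V.2 p e (V.1.ι ≫ k')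
    (by rw [Category.assoc, ← h])
  rw [h2, h2']
  rw [comap_ideal I p ⟨W, hW⟩ V e, hI, Ideal.map_span, Set.image_pair] at hV
  have hreg := (regular_and_dvd_of_span_pair hs (hψ.nilpotent.map _) hV).1
  congr 2
  ext1
  refine hψ.hom_ext (congrArg CommRingCat.Hom.hom (h1.trans h1'.symm)) ?_
  rw [← CommRingCat.comp_apply, h1]
  exact hreg

lemma dilatation_exists_lift {t ε : Γ(Z, W)} (hψ : IsDilatation ψ.hom t ε)
    (hI : I.ideal ⟨W, hW⟩ = Ideal.span {t, ε}) {T : Scheme.{u}} (p : T ⟶ Z)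
    (e : ⊤ ≤ p ⁻¹ᵁ W) (hc : IsCartier (I.comap p)) :
    ∃ k : T ⟶ Spec B, k ≫ Spec.map ψ ≫ hW.fromSpec = p := by
  refine exists_lift_of_local _ p (fun j _ k k' hk hk' => dilatation_hom_ext hW ψ hψ hI
    (by rw [hk, Scheme.IdealSheafData.comap_comp]; exact hc.comap j) (hk.trans hk'.symm))
    fun x => ?_
  obtain ⟨V, hxV, s, hs, hV⟩ := hc x
  have e : V.1 ≤ p ⁻¹ᵁ W := le_top.trans e
  rw [comap_ideal I p ⟨W, hW⟩ V e, hI, Ideal.map_span, Set.image_pair] at hV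
  obtain ⟨hreg, c, hc⟩ := regular_and_dvd_of_span_pair hs (hψ.nilpotent.map _) hV
  obtain ⟨χ, hχ⟩ := hψ.exists_lift _ hreg hc.symm
  have hVa : IsAffineOpen V.1 := V.2
  refine ⟨V.1, hxV, hVa.isoSpec.hom ≫ Spec.map (CommRingCat.ofHom χ), ?_⟩
  have : ψ ≫ CommRingCat.ofHom χ = p.appLE W V.1 e := by ext1; exact hχ
  rw [Category.assoc, ← Spec.map_comp_assoc, this, IsAffineOpen.SpecMap_appLE_fromSpec p hW hVa e,
    IsAffineOpen.isoSpec_hom_fromSpec_assoc]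

lemma isBlowup_SpecMap {t ε : Γ(Z, W)} (hψ : IsDilatation ψ.hom t ε)
    (hI : I.ideal ⟨W, hW⟩ = Ideal.span {t, ε}) :
    IsBlowup (Spec.map ψ ≫ hW.isoSpec.inv) (I.comap W.ι) := by
  have hq : (Spec.map ψ ≫ hW.isoSpec.inv) ≫ W.ι = Spec.map ψ ≫ hW.fromSpec := by
    rw [Category.assoc, IsAffineOpen.isoSpec_inv_ι]
  refine ⟨?_, fun T g hg => ?_⟩
  · rw [← Scheme.IdealSheafData.comap_comp, hq]
    intro x
    refine ⟨⟨⊤, isAffineOpen_top _⟩, trivial,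
      ((Spec.map ψ ≫ hW.fromSpec).appLE W ⊤ (top_le_preimage_SpecMap_fromSpec hW ψ)).hom t,
      ?_, ?_⟩
    · rw [appLE_SpecMap_comp_fromSpec, CommRingCat.comp_apply]
      exact (RingHom.Flat.of_bijective (ConcreteCategory.bijective_of_isIso
        (Scheme.ΓSpecIso B).inv)).map_mem_nonZeroDivisors hψ.regular
    · rw [comap_ideal I _ ⟨W, hW⟩ ⟨⊤, isAffineOpen_top _⟩ (top_le_preimage_SpecMap_fromSpec hW ψ),
        hI, Ideal.map_span, Set.image_pair]
      refine le_antisymm ?_ (Ideal.span_mono (by simp))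
      rw [Ideal.span_le]
      rintro y (rfl | rfl)
      · exact Ideal.mem_span_singleton_self _
      · obtain ⟨e, he, -⟩ := hψ.generator
        rw [appLE_SpecMap_comp_fromSpec, CommRingCat.comp_apply, CommRingCat.comp_apply, ← he,
          map_mul]
        exact Ideal.mul_mem_right _ _ (Ideal.mem_span_singleton_self _)
  · rw [← Scheme.IdealSheafData.comap_comp] at hg
    have hmono : ∀ k : T ⟶ Spec B, k ≫ Spec.map ψ ≫ hW.isoSpec.inv = g ↔
        k ≫ Spec.map ψ ≫ hW.fromSpec = g ≫ W.ι := by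
      intro k
      rw [← cancel_mono W.ι, Category.assoc, hq]
    obtain ⟨k, hk⟩ := dilatation_exists_lift hW ψ hψ hI (g ≫ W.ι) (by
      rw [Scheme.Hom.comp_preimage, Scheme.Opens.ι_preimage_self]; exact le_rfl) hg
    refine ⟨k, (hmono k).mpr hk, fun k' hk' => ?_⟩
    have hk' := (hmono k').mp hk'
    exact dilatation_hom_ext hW ψ hψ hI (by rw [hk']; exact hg) (hk'.trans hk.symm)

lemma exists_isBlowup_of_isAffineOpen {t ε : Γ(Z, W)} (ht : t ∈ nonZeroDivisors Γ(Z, W))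
    (hε : IsNilpotent ε) (hI : I.ideal ⟨W, hW⟩ = Ideal.span {t, ε}) :
    ∃ (Z' : Scheme.{u}) (q : Z' ⟶ W), IsBlowup q (I.comap W.ι) := by
  obtain ⟨B, _, ψ, hψ⟩ := exists_isDilatation ht hε
  exact ⟨_, _, isBlowup_SpecMap hW (CommRingCat.ofHom ψ : _ ⟶ CommRingCat.of B) hψ hI⟩

end Affine

/-- Uniqueness of blowings up transfers the affine model to an arbitrary `q`. -/
lemma IsBlowup.isDilatation {Z Z' : Scheme.{u}} {I : Z.IdealSheafData} {W : Z.Opens}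
    (hW : IsAffineOpen W) {q : Z' ⟶ Z} (hq : IsBlowup q I) {t ε : Γ(Z, W)}
    (ht : t ∈ nonZeroDivisors Γ(Z, W)) (hε : IsNilpotent ε)
    (hI : I.ideal ⟨W, hW⟩ = Ideal.span {t, ε}) :
    IsAffineOpen (q ⁻¹ᵁ W) ∧ IsDilatation (q.app W).hom t ε := by
  obtain ⟨B, _, ψ, hψ⟩ := exists_isDilatation ht hε
  let ψ' : Γ(Z, W) ⟶ CommRingCat.of B := CommRingCat.ofHom ψ
  obtain ⟨e, he⟩ := (hq.morphismRestrict W).exists_iso (isBlowup_SpecMap hW ψ' hψ hI)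
  have hV : IsAffineOpen (q ⁻¹ᵁ W) := .of_isIso e.hom
  refine ⟨hV, ?_⟩
  obtain ⟨β, h1, h2⟩ := exists_SpecMap_of_isAffineOpen hW ψ' hV q le_rfl e.hom (by
    rw [← morphismRestrict_ι, ← he, Category.assoc, Category.assoc, IsAffineOpen.isoSpec_inv_ι])
  rw [Scheme.Hom.appLE_eq_app] at h1
  have hβ : IsIso (Spec.map β) := by
    rw [show Spec.map β = hV.isoSpec.inv ≫ e.hom by rw [h2, Iso.inv_hom_id_assoc]]
    infer_instance
  have hβ' : IsIso β := (ConcreteCategory.isIso_iff_bijective β).mpr (isIso_SpecMap_iff.mp hβ)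
  refine IsDilatation.of_iso (g := 𝟙 _) (b := inv β) (φ' := ψ') ?_ hψ
  rw [← h1, Category.assoc, IsIso.hom_inv_id, Category.comp_id, Category.id_comp]

end PTM

namespace PTM

/-! ### Gluing local blowings up -/

section Gluing

variable {Z : Scheme.{u}}

lemma IsBlowup.of_iso {Z' Z'' : Scheme.{u}} {q : Z' ⟶ Z} {q' : Z'' ⟶ Z} {I : Z.IdealSheafData}
    (hq : IsBlowup q I) (e : Z'' ≅ Z') (he : e.hom ≫ q = q') : IsBlowup q' I := by
  have H : IsPullback e.hom q' q (𝟙 Z) := .of_horiz_isIso ⟨by simp [he]⟩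
  simpa using hq.baseChange H

/-- Supplies the directedness of the open cover: the fibre product is the open subscheme `V ⊓ W`. -/
lemma exists_open_pullback_lift_eq {V W : Z.Opens} (x : ↥(pullback V.ι W.ι)) :
    ∃ (U : Z.Opens) (h₁ : U ≤ V) (h₂ : U ≤ W) (y : U),
      pullback.lift (f := V.ι) (g := W.ι) (Z.homOfLE h₁) (Z.homOfLE h₂) (by simp) y = x := by
  let p := pullback.fst V.ι W.ι ≫ V.ι
  have h₁ : p.opensRange ≤ V := by
    rintro _ ⟨y, rfl⟩
    exact (pullback.fst V.ι W.ι y).2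
  have h₂ : p.opensRange ≤ W := by
    rintro _ ⟨y, rfl⟩
    have : p y = (pullback.snd V.ι W.ι ≫ W.ι) y := by
      rw [← pullback.condition]
    rw [this]
    exact (pullback.snd V.ι W.ι y).2
  have hmem : p x ∈ p.opensRange := ⟨x, rfl⟩
  have key : pullback.lift (f := V.ι) (g := W.ι) (Z.homOfLE h₁) (Z.homOfLE h₂) (by simp) ≫ p =
      p.opensRange.ι := by
    rw [pullback.lift_fst_assoc, Scheme.homOfLE_ι]
  refine ⟨p.opensRange, h₁, h₂, ⟨p x, hmem⟩, ?_⟩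
  exact p.isOpenEmbedding.injective congr($key ⟨p x, hmem⟩)

/-- The open subschemes over which a blowing up exists. -/
def BlowupOpens (I : Z.IdealSheafData) : Type u :=
  {W : Z.Opens // ∃ (Z' : Scheme.{u}) (q : Z' ⟶ W), IsBlowup q (I.comap W.ι)}

instance (I : Z.IdealSheafData) : Preorder (BlowupOpens I) :=
  inferInstanceAs (Preorder {_W : Z.Opens // _})

namespace BlowupOpens

variable {I : Z.IdealSheafData}

noncomputable def obj (W : BlowupOpens I) : Scheme.{u} := W.2.choose

noncomputable def hom (W : BlowupOpens I) : W.obj ⟶ W.1 := W.2.choose_spec.choose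

lemma isBlowup (W : BlowupOpens I) : IsBlowup W.hom (I.comap W.1.ι) := W.2.choose_spec.choose_spec

lemma exists_of_le {V : Z.Opens} (W : BlowupOpens I) (h : V ≤ W.1) :
    ∃ (Z' : Scheme.{u}) (q : Z' ⟶ V), IsBlowup q (I.comap V.ι) := by
  refine ⟨pullback W.hom (Z.homOfLE h), pullback.snd _ _, ?_⟩
  have := W.isBlowup.baseChange (IsPullback.of_hasPullback W.hom (Z.homOfLE h))
  rwa [← Scheme.IdealSheafData.comap_comp, Scheme.homOfLE_ι] at this

lemma exists_isPullback {V W : BlowupOpens I} (h : V.1 ≤ W.1) :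
    ∃ k : V.obj ⟶ W.obj, IsPullback k V.hom W.hom (Z.homOfLE h) := by
  refine W.isBlowup.exists_isPullback (Z.homOfLE h) ?_
  rw [← Scheme.IdealSheafData.comap_comp, Scheme.homOfLE_ι]
  exact V.isBlowup

noncomputable def map {V W : BlowupOpens I} (h : V.1 ≤ W.1) : V.obj ⟶ W.obj :=
  (exists_isPullback h).choose

lemma isPullback_map {V W : BlowupOpens I} (h : V.1 ≤ W.1) :
    IsPullback (map h) V.hom W.hom (Z.homOfLE h) :=
  (exists_isPullback h).choose_spec

lemma hom_ext {V W : BlowupOpens I} (h : V.1 ≤ W.1) {k k' : V.obj ⟶ W.obj}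
    (hk : k ≫ W.hom = V.hom ≫ Z.homOfLE h) (hk' : k' ≫ W.hom = V.hom ≫ Z.homOfLE h) : k = k' := by
  refine W.isBlowup.hom_ext ?_ (hk.trans hk'.symm)
  rw [hk, ← Scheme.IdealSheafData.comap_comp, Category.assoc, Scheme.homOfLE_ι,
    Scheme.IdealSheafData.comap_comp]
  exact V.isBlowup.1

/-- The local blowings up and the maps between them are arbitrary choices, yet functoriality is
strict, because a morphism over the inclusion of opens is unique. -/
noncomputable abbrev functor (I : Z.IdealSheafData) : BlowupOpens I ⥤ Scheme.{u} where
  obj := obj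
  map f := map (leOfHom f)
  map_id _ := hom_ext le_rfl (isPullback_map _).w (by simp)
  map_comp f g := by
    refine hom_ext (leOfHom (f ≫ g)) (isPullback_map _).w ?_
    rw [Category.assoc, (isPullback_map (leOfHom g)).w, reassoc_of% (isPullback_map (leOfHom f)).w,
      Scheme.homOfLE_homOfLE]

lemma exists_pullback_lift_eq (V W : BlowupOpens I) (x : ↥(pullback V.1.ι W.1.ι)) :
    ∃ (U : BlowupOpens I) (h₁ : U.1 ≤ V.1) (h₂ : U.1 ≤ W.1) (y : U.1),
      pullback.lift (f := V.1.ι) (g := W.1.ι) (Z.homOfLE h₁) (Z.homOfLE h₂) (by simp) y = x := by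
  obtain ⟨U, h₁, h₂, y, hy⟩ := exists_open_pullback_lift_eq x
  exact ⟨⟨U, exists_of_le V h₁⟩, h₁, h₂, y, hy⟩

variable (hI : ∀ z : Z, ∃ W : BlowupOpens I, z ∈ W.1)

@[simps]
noncomputable abbrev cover : Z.OpenCover where
  I₀ := BlowupOpens I
  X W := W.1
  f W := W.1.ι
  mem₀ := by
    rw [Scheme.presieve₀_mem_precoverage_iff]
    exact ⟨fun z => ⟨(hI z).choose, by simpa using (hI z).choose_spec⟩, inferInstance⟩

noncomputable instance : (cover hI).LocallyDirected where
  trans {V W} f := Z.homOfLE (leOfHom f)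
  trans_id W := by simp
  trans_comp f g := by simp
  w f := by simp
  directed {V W} x := by
    obtain ⟨U, h₁, h₂, y, hy⟩ := exists_pullback_lift_eq V W x
    exact ⟨U, homOfLE h₁, homOfLE h₂, y, hy⟩
  property_trans {V W} f := inferInstanceAs (IsOpenImmersion (Z.homOfLE (leOfHom f)))

instance : Quiver.IsThin (cover hI).I₀ := inferInstanceAs (Quiver.IsThin (BlowupOpens I))

noncomputable def gluingData : Scheme.Cover.RelativeGluingData (cover hI) where
  functor := functor I
  natTrans := { app := hom, naturality := fun _ _ f => (isPullback_map (leOfHom f)).w }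
  equifibered := fun _ _ f => isPullback_map (leOfHom f)

end BlowupOpens

lemma exists_isBlowup_of_local {I : Z.IdealSheafData} (hI : ∀ z : Z, ∃ W : Z.Opens, z ∈ W ∧
    ∃ (Z' : Scheme.{u}) (q : Z' ⟶ W), IsBlowup q (I.comap W.ι)) :
    ∃ (Z' : Scheme.{u}) (q : Z' ⟶ Z), IsBlowup q I := by
  have hI' : ∀ z : Z, ∃ W : BlowupOpens I, z ∈ W.1 := fun z =>
    ⟨⟨(hI z).choose, (hI z).choose_spec.2⟩, (hI z).choose_spec.1⟩
  let d := BlowupOpens.gluingData hI'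
  refine ⟨d.glued, d.toBase, isBlowup_of_local fun z => ?_⟩
  obtain ⟨W, hW⟩ := hI' z
  refine ⟨W.1, hW, ?_⟩
  have h1 : IsPullback W.hom _ W.1.ι d.toBase := d.isPullback_natTrans_ι_toBase W
  have h2 := isPullback_morphismRestrict d.toBase W.1
  exact W.isBlowup.of_iso (h2.isoIsPullback _ _ h1) (h2.isoIsPullback_hom_fst _ _ h1)

/-- An ideal sheaf that is locally generated by a non-zero-divisor and a nilpotent element. -/
def IsThickCartier (I : Z.IdealSheafData) : Prop :=
  ∀ z : Z, ∃ W : Z.affineOpens, z ∈ W.1 ∧ ∃ t ∈ nonZeroDivisors Γ(Z, W.1), ∃ ε : Γ(Z, W.1),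
    IsNilpotent ε ∧ I.ideal W = Ideal.span {t, ε}

lemma IsThickCartier.exists_isBlowup {I : Z.IdealSheafData} (hI : IsThickCartier I) :
    ∃ (Z' : Scheme.{u}) (q : Z' ⟶ Z), IsBlowup q I :=
  exists_isBlowup_of_local fun z => by
    obtain ⟨W, hzW, t, ht, ε, hε, h⟩ := hI z
    exact ⟨W.1, hzW, exists_isBlowup_of_isAffineOpen W.2 ht hε h⟩

/-- Used for centers that become empty after base change. -/
lemma isBlowup_id_top : IsBlowup (𝟙 Z) (⊤ : Z.IdealSheafData) := by
  refine ⟨fun z => ?_, fun W g _ => ⟨g, Category.comp_id g, fun k hk => by simpa using hk⟩⟩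
  obtain ⟨U, hzU, -⟩ := exists_affineOpen_le (show z ∈ (⊤ : Z.Opens) from trivial)
  refine ⟨U, hzU, 1, one_mem _, ?_⟩
  rw [Scheme.IdealSheafData.comap_id, Scheme.IdealSheafData.ideal_top, Ideal.span_singleton_one]
  rfl

end Gluing

end PTM

namespace PTM

/-! ### Comparing sequences through their lists of centers -/

section Pullback

lemma preimage_comp {Z Y X : Scheme.{u}} (h : Z ⟶ Y) (g : Y ⟶ X) (C : Closeds X) :
    preimage (h ≫ g) C = preimage h (preimage g C) := by
  ext x
  rfl

lemma center_comap {Z Z' X X' : Scheme.{u}} {φ : Z' ⟶ Z} {h' : Z' ⟶ X'} {h : Z ⟶ X} {g : X' ⟶ X}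
    [Smooth φ] (w : φ ≫ h = h' ≫ g) (C : Closeds X) :
    (center h C).comap φ = center h' (preimage g C) := by
  rw [center, center, vanishingIdeal_comap, ← preimage_comp, ← preimage_comp, w]

lemma center_eq_top {Z X : Scheme.{u}} (h : Z ⟶ X) : center h ⊥ = ⊤ := by
  rw [center, ← Scheme.IdealSheafData.vanishingIdeal_bot]
  congr 1

namespace BlowupSequence

variable {X X' : Scheme.{u}} {l : ℕ} {E : Fin l → X.IdealSheafData}
  {E' : Fin l → X'.IdealSheafData}

/-- The centers of a sequence of blowings up. -/
def centers {Z : Scheme.{u}} {h : Z ⟶ X} : BlowupSequence E h → List (Fin l × Closeds X)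
  | nil _ => []
  | cons _ i C _ _ _ S => (i, C) :: S.centers

/-- The nonempty inverse images of a list of centers. -/
noncomputable def pullbackCenters (g : X' ⟶ X) (L : List (Fin l × Closeds X)) :
    List (Fin l × Closeds X') :=
  open Classical in
  (L.map fun c => (c.1, preimage g c.2)).filter fun c => c.2 ≠ ⊥

/-- The centers determine a sequence up to isomorphism, so equality of lists suffices. A nonempty
center gives a cartesian square of blowings up; an empty one pulls back to the unit ideal, whose
blowing up is the identity, and is skipped. -/
theorem exists_isPullbackOf {g : X' ⟶ X} [Smooth g] {Z : Scheme.{u}} {h : Z ⟶ X}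
    (S : BlowupSequence E h) {Z' : Scheme.{u}} {h' : Z' ⟶ X'} {φ : Z' ⟶ Z}
    (H : IsPullback φ h' h g) (S' : BlowupSequence E' h')
    (hS : S'.centers = pullbackCenters g S.centers) :
    ∃ ψ : S'.top ⟶ S.top, IsPullbackOf g φ S' S ψ ∧ S'.map ≫ φ = ψ ≫ S.map := by
  induction S generalizing Z' with
  | nil h =>
    cases S' with
    | nil => exact ⟨φ, .nil _ _ _, (Category.id_comp φ).trans (Category.comp_id φ).symm⟩
    | cons => simp [centers, pullbackCenters] at hS
  | @cons Z Z₁ h i C hC q hq S ih =>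
    have hφ : Smooth φ := MorphismProperty.of_isPullback (P := @Smooth) H.flip ‹_›
    have hcenter := center_comap H.w C
    by_cases hne : preimage g C = ⊥
    · have hq' : IsBlowup (𝟙 Z') ((center h C).comap φ) := by
        rw [hcenter, hne, center_eq_top]
        exact isBlowup_id_top
      obtain ⟨φ₁, Hφ⟩ := hq.exists_isPullback φ hq'
      obtain ⟨ψ, hψ, hw⟩ := ih (h' := h') (φ := φ₁)
        (by simpa using Hφ.paste_vert H) S' (by
          rw [hS]; simp [centers, pullbackCenters, hne])
      refine ⟨ψ, .skip h' h φ i C hC q hq S S' hne φ₁ Hφ ψ hψ, ?_⟩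
      have : S'.map ≫ φ = ψ ≫ (S.map ≫ q) := by
        rw [← Category.assoc, ← hw, Category.assoc, Hφ.w, Category.id_comp]
      exact this
    · cases S' with
      | nil => simp [centers, pullbackCenters, hne] at hS
      | @cons _ Z₁' _ i' C' hC' q' hq' S' =>
        have hS₂ : ((i', C') :: S'.centers) = (i, preimage g C) :: pullbackCenters g S.centers := by
          simpa [centers, pullbackCenters, hne] using hS
        simp only [List.cons.injEq, Prod.mk.injEq] at hS₂
        obtain ⟨⟨rfl, rfl⟩, hS₂⟩ := hS₂
        obtain ⟨φ₁, Hφ⟩ := hq.exists_isPullback φ (q' := q') (by rwa [hcenter])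
        obtain ⟨ψ, hψ, hw⟩ := ih (h' := q' ≫ h') (φ := φ₁) (Hφ.paste_vert H) S' hS₂
        refine ⟨ψ, .step h' h φ i' C hC q hq S hC' q' hq' S' hne φ₁ Hφ ψ hψ, ?_⟩
        have : (S'.map ≫ q') ≫ φ = ψ ≫ (S.map ≫ q) := by
          rw [← Category.assoc ψ, ← hw, Category.assoc, Category.assoc, Hφ.w]
        exact this

end BlowupSequence

end Pullback

end PTM

namespace PTM

/-! ### Charts of thickenings and their behaviour under blowing up -/

section Charts

variable {X Z : Scheme.{u}} {l : ℕ} {E : Fin l → X.IdealSheafData}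

/-- An affine open subscheme of `X` over which `h : Z ⟶ X` is described by a ring homomorphism as
in `IsThickMod`, together with equations of the `E i`. -/
structure IsChart (E : Fin l → X.IdealSheafData) (h : Z ⟶ X) (U : X.affineOpens)
    (t : Fin l → Γ(X, U.1)) : Prop where
  eq : ∀ i, (E i).ideal U = Ideal.span {t i}
  rad : ∀ i, (Ideal.span {t i} ⊔ nilradical Γ(X, U.1)).IsRadical
  affine : IsAffineOpen (h ⁻¹ᵁ U.1)
  thick : IsThickMod (h.app U.1).hom (∏ i, t i)

lemma IsChart.preimage_le {X' Z' : Scheme.{u}} {φ : Z' ⟶ Z} {h' : Z' ⟶ X'} {h : Z ⟶ X}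
    {g : X' ⟶ X} (w : φ ≫ h = h' ≫ g) {U : X.Opens} {U' : X'.Opens} (e : U' ≤ g ⁻¹ᵁ U) :
    h' ⁻¹ᵁ U' ≤ φ ⁻¹ᵁ (h ⁻¹ᵁ U) := by
  rw [← Scheme.Hom.comp_preimage, w, Scheme.Hom.comp_preimage]
  exact Scheme.Hom.preimage_mono _ e

lemma IsChart.isPushout {X' Z' : Scheme.{u}} {φ : Z' ⟶ Z} {h' : Z' ⟶ X'} {h : Z ⟶ X}
    {g : X' ⟶ X} (H : IsPullback φ h' h g) {U : X.affineOpens} {U' : X'.affineOpens}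
    (e : U'.1 ≤ g ⁻¹ᵁ U.1) (hU : IsAffineOpen (h ⁻¹ᵁ U.1)) :
    IsAffineOpen (h' ⁻¹ᵁ U'.1) ∧ IsPushout (h.app U.1) (g.appLE U.1 U'.1 e)
      (φ.appLE (h ⁻¹ᵁ U.1) (h' ⁻¹ᵁ U'.1) (preimage_le H.w e)) (h'.app U'.1) := by
  have hUY : h' ⁻¹ᵁ U'.1 = φ ⁻¹ᵁ (h ⁻¹ᵁ U.1) ⊓ h' ⁻¹ᵁ U'.1 :=
    (inf_eq_right.mpr (preimage_le H.w e)).symm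
  refine ⟨isAffineOpen_of_isPullback H e le_rfl hUY U.2 U'.2 hU, ?_⟩
  have := isPushout_appLE H e le_rfl hUY U.2 U'.2 hU
  rwa [Scheme.Hom.appLE_eq_app, Scheme.Hom.appLE_eq_app] at this

lemma IsChart.baseChange {X' Z' : Scheme.{u}} {φ : Z' ⟶ Z} {h' : Z' ⟶ X'} {h : Z ⟶ X}
    {g : X' ⟶ X} (H : IsPullback φ h' h g) [Smooth g] {E' : Fin l → X'.IdealSheafData}
    (hE : ∀ i, E' i = (E i).comap g) {U : X.affineOpens} {t : Fin l → Γ(X, U.1)}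
    (hc : IsChart E h U t) (U' : X'.affineOpens) (e : U'.1 ≤ g ⁻¹ᵁ U.1) :
    IsChart E' h' U' (fun i => (g.appLE U.1 U'.1 e).hom (t i)) ∧
      nilradical Γ(Z', h' ⁻¹ᵁ U'.1) = (nilradical Γ(Z, h ⁻¹ᵁ U.1)).map
        (φ.appLE (h ⁻¹ᵁ U.1) (h' ⁻¹ᵁ U'.1) (preimage_le H.w e)).hom := by
  obtain ⟨haff, hpush⟩ := isPushout H e hc.affine
  have hsm := g.smooth_appLE U.2 U'.2 e
  have hnil : nilradical Γ(X', U'.1) = (nilradical Γ(X, U.1)).map (g.appLE U.1 U'.1 e).hom :=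
    nilradical_map_of_smooth hsm
  obtain ⟨h1, h2⟩ := hc.thick.baseChange hpush hsm.flat hnil
  refine ⟨⟨fun i => ?_, fun i => ?_, haff, ?_⟩, h2⟩
  · rw [hE, comap_ideal _ g U U' e, hc.eq, Ideal.map_span, Set.image_singleton]
  · have := isRadical_map_of_smooth hsm (hc.rad i)
    rwa [Ideal.map_sup, Ideal.map_span, Set.image_singleton, ← hnil] at this
  · rwa [map_prod] at h1

lemma isPullback_id_id (h : Z ⟶ X) : IsPullback (𝟙 Z) h h (𝟙 X) := .of_id_fst

lemma IsChart.restrict {h : Z ⟶ X} {U : X.affineOpens} {t : Fin l → Γ(X, U.1)}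
    (hc : IsChart E h U t) (U' : X.affineOpens) (hle : U'.1 ≤ U.1) :
    IsChart E h U' (fun i => res X hle (t i)) := by
  have := (hc.baseChange (isPullback_id_id h) (fun i => ((E i).comap_id).symm) U' hle).1
  simpa only [id_appLE] using this

/-- `h : Z ⟶ X` is locally described by ring homomorphisms as in `IsThickMod`. -/
def HasCharts (E : Fin l → X.IdealSheafData) (h : Z ⟶ X) : Prop :=
  ∀ x : X, ∃ (U : X.affineOpens) (t : Fin l → Γ(X, U.1)), x ∈ U.1 ∧ IsChart E h U t

/-- On `U`, the center `c` is either empty or all of the divisor; `s` is its equation. -/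
def IsLocalEquation (E : Fin l → X.IdealSheafData) (U : X.affineOpens) (t : Fin l → Γ(X, U.1))
    (c : Fin l × Closeds X) (s : Γ(X, U.1)) : Prop :=
  (s = t c.1 ∧ ∀ x ∈ U.1, x ∈ c.2 ↔ x ∈ (E c.1).support) ∨ (s = 1 ∧ ∀ x ∈ U.1, x ∉ c.2)

lemma vanishingIdeal_ideal_congr {C C' : Closeds Z} (V : Z.affineOpens)
    (h : ∀ z ∈ V.1, z ∈ C ↔ z ∈ C') : (Scheme.IdealSheafData.vanishingIdeal C).ideal V =
      (Scheme.IdealSheafData.vanishingIdeal C').ideal V := by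
  rw [Scheme.IdealSheafData.vanishingIdeal_ideal, Scheme.IdealSheafData.vanishingIdeal_ideal]
  congr 1
  ext p
  have hV : IsAffineOpen V.1 := V.2
  have hp : hV.fromSpec p ∈ Set.range hV.fromSpec := ⟨p, rfl⟩
  rw [hV.range_fromSpec] at hp
  exact h _ hp

lemma IsLocalEquation.dvd {U : X.affineOpens} {t : Fin l → Γ(X, U.1)} {c : Fin l × Closeds X}
    {s : Γ(X, U.1)} (hs : IsLocalEquation E U t c s) : s ∣ (∏ i, t i) ^ 1 := by
  rw [pow_one]
  rcases hs with ⟨rfl, -⟩ | ⟨rfl, -⟩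
  · exact Finset.dvd_prod_of_mem t (Finset.mem_univ _)
  · exact one_dvd _

lemma mem_nonZeroDivisors_of_dvd {R : Type*} [CommRing R] {s t : R} (h : s ∣ t)
    (ht : t ∈ nonZeroDivisors R) : s ∈ nonZeroDivisors R := by
  obtain ⟨r, rfl⟩ := h
  exact (mul_mem_nonZeroDivisors.mp ht).1

variable {h : Z ⟶ X} {U : X.affineOpens} {t : Fin l → Γ(X, U.1)} {c : Fin l × Closeds X}
  {s : Γ(X, U.1)}

lemma IsLocalEquation.regular (hc : IsChart E h U t) (hs : IsLocalEquation E U t c s) :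
    (h.app U.1).hom s ∈ nonZeroDivisors Γ(Z, h ⁻¹ᵁ U.1) :=
  mem_nonZeroDivisors_of_dvd (map_dvd _ hs.dvd) (by rw [pow_one]; exact hc.thick.regular)

/-- Where the center is the whole divisor, its ideal is the radical of `(t)`, which is `(t, η)`
because `t` is a radical equation on the reduction. Where it is empty, both sides are the unit
ideal. -/
lemma IsChart.center_ideal (hc : IsChart E h U t) (hs : IsLocalEquation E U t c s)
    {η : Γ(Z, h ⁻¹ᵁ U.1)} (hη : nilradical Γ(Z, h ⁻¹ᵁ U.1) = Ideal.span {η}) :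
    (center h c.2).ideal ⟨h ⁻¹ᵁ U.1, hc.affine⟩ = Ideal.span {(h.app U.1).hom s, η} := by
  rcases hs with ⟨rfl, hC⟩ | ⟨rfl, hC⟩
  · have h1 : (center h c.2).ideal ⟨h ⁻¹ᵁ U.1, hc.affine⟩ =
        (Scheme.IdealSheafData.vanishingIdeal ((E c.1).comap h).support).ideal
          ⟨h ⁻¹ᵁ U.1, hc.affine⟩ := by
      refine vanishingIdeal_ideal_congr _ fun z hz => ?_
      rw [Scheme.IdealSheafData.support_comap]
      exact hC (h z) hz
    rw [h1, Scheme.IdealSheafData.vanishingIdeal_support, Scheme.IdealSheafData.radical_ideal,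
      comap_ideal _ h U ⟨h ⁻¹ᵁ U.1, hc.affine⟩ le_rfl, hc.eq, Ideal.map_span, Set.image_singleton,
      Scheme.Hom.appLE_eq_app]
    exact hc.thick.radical_span (hc.rad _) hη
  · have h1 : (center h c.2).ideal ⟨h ⁻¹ᵁ U.1, hc.affine⟩ =
        (Scheme.IdealSheafData.vanishingIdeal ⊥).ideal ⟨h ⁻¹ᵁ U.1, hc.affine⟩ := by
      refine vanishingIdeal_ideal_congr _ fun z hz => ?_
      exact iff_of_false (hC (h z) hz) (Set.notMem_empty z)
    rw [h1, Scheme.IdealSheafData.vanishingIdeal_bot, Scheme.IdealSheafData.ideal_top, map_one]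
    exact (Ideal.eq_top_of_isUnit_mem _ (Ideal.subset_span (by simp)) isUnit_one).symm

lemma IsChart.isNilpotent {η : Γ(Z, h ⁻¹ᵁ U.1)}
    (hη : nilradical Γ(Z, h ⁻¹ᵁ U.1) = Ideal.span {η}) : IsNilpotent η :=
  _root_.mem_nilradical.mp (hη ▸ Ideal.mem_span_singleton_self η)

lemma IsChart.blowup (hc : IsChart E h U t) (hs : IsLocalEquation E U t c s)
    {Z₁ : Scheme.{u}} {q : Z₁ ⟶ Z} (hq : IsBlowup q (center h c.2)) {η : Γ(Z, h ⁻¹ᵁ U.1)}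
    (hη : nilradical Γ(Z, h ⁻¹ᵁ U.1) = Ideal.span {η}) :
    IsChart E (q ≫ h) U t ∧
      IsDilatation (q.app (h ⁻¹ᵁ U.1)).hom ((h.app U.1).hom s) η := by
  obtain ⟨h1, h2⟩ := hq.isDilatation hc.affine (hs.regular hc) (isNilpotent hη)
    (hc.center_ideal hs hη)
  refine ⟨⟨hc.eq, hc.rad, h1, ?_⟩, h2⟩
  have := (hc.thick.dilatation hs.dvd hη h2).1
  rwa [Scheme.Hom.comp_app]

/-- A center that is a union of connected components of a divisor. -/
structure IsCenter (E : Fin l → X.IdealSheafData) (c : Fin l × Closeds X) : Prop where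
  le : c.2 ≤ (E c.1).support
  isClosed : IsClosed (((E c.1).support : Set X) \ c.2)

/-- A connected component cannot meet both of the two disjoint closed pieces of the divisor. -/
lemma IsCenter.isComponent (hc : IsCenter E c) : IsComponent c.2 (E c.1) := by
  refine ⟨hc.le, fun x hx y hy => ?_⟩
  by_contra hyc
  have hsub := connectedComponentIn_subset ((E c.1).support : Set X) x
  obtain ⟨z, -, hz, -, hz'⟩ := isPreconnected_closed_iff.mp
    (isPreconnected_connectedComponentIn (F := ((E c.1).support : Set X)) (x := x)) _ _
    c.2.isClosed hc.isClosed (fun z hz => or_iff_not_imp_left.mpr fun hz' => ⟨hsub hz, hz'⟩)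
    ⟨x, mem_connectedComponentIn (hc.le hx), hx⟩ ⟨y, hy, hsub hy, hyc⟩
  exact hz' hz

lemma exists_chart_isLocalEquation (hh : HasCharts E h) (hc : IsCenter E c) (x : X) :
    ∃ (U : X.affineOpens) (t : Fin l → Γ(X, U.1)) (s : Γ(X, U.1)), x ∈ U.1 ∧ IsChart E h U t ∧
      IsLocalEquation E U t c s := by
  obtain ⟨U, t, hx, hU⟩ := hh x
  by_cases hxc : x ∈ c.2
  · obtain ⟨V, hxV, hV⟩ := exists_affineOpen_le
      (show x ∈ U.1 ⊓ ⟨_, hc.isClosed.isOpen_compl⟩ from ⟨hx, fun hx' => hx'.2 hxc⟩)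
    refine ⟨V, _, _, hxV, hU.restrict V (hV.trans inf_le_left), .inl ⟨rfl, fun y hy => ?_⟩⟩
    refine ⟨fun hy' => hc.le hy', fun hy' => ?_⟩
    by_contra hy''
    exact (hV hy).2 ⟨hy', hy''⟩
  · obtain ⟨V, hxV, hV⟩ := exists_affineOpen_le (show x ∈ U.1 ⊓ c.2.compl from ⟨hx, hxc⟩)
    exact ⟨V, _, _, hxV, hU.restrict V (hV.trans inf_le_left), .inr ⟨rfl, fun y hy => (hV hy).2⟩⟩

lemma HasCharts.isThickCartier (hh : HasCharts E h) (hc : IsCenter E c) :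
    IsThickCartier (center h c.2) := by
  intro z
  obtain ⟨U, t, s, hx, hU, hs⟩ := exists_chart_isLocalEquation hh hc (h z)
  obtain ⟨η, hη⟩ := hU.thick.principal
  exact ⟨⟨h ⁻¹ᵁ U.1, hU.affine⟩, hx, _, hs.regular hU, η, IsChart.isNilpotent hη,
    hU.center_ideal hs hη⟩

lemma HasCharts.blowup (hh : HasCharts E h) (hc : IsCenter E c) {Z₁ : Scheme.{u}} {q : Z₁ ⟶ Z}
    (hq : IsBlowup q (center h c.2)) : HasCharts E (q ≫ h) := by
  intro x
  obtain ⟨U, t, s, hx, hU, hs⟩ := exists_chart_isLocalEquation hh hc x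
  obtain ⟨η, hη⟩ := hU.thick.principal
  exact ⟨U, t, hx, (hU.blowup hs hq hη).1⟩

lemma HasCharts.exists_blowupSequence (L : List (Fin l × Closeds X)) (hL : ∀ c ∈ L, IsCenter E c) :
    ∀ {Z : Scheme.{u}} {h : Z ⟶ X}, HasCharts E h →
      ∃ S : BlowupSequence E h, S.centers = L ∧ HasCharts E (S.map ≫ h) := by
  induction L with
  | nil =>
    intro Z h hh
    refine ⟨.nil h, rfl, ?_⟩
    rw [show (BlowupSequence.nil (E := E) h).map ≫ h = h from Category.id_comp h]
    exact hh
  | cons c L ih =>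
    intro Z h hh
    have hc := hL c (by simp)
    obtain ⟨Z₁, q, hq⟩ := (hh.isThickCartier hc).exists_isBlowup
    obtain ⟨S, hS, hS'⟩ := ih (fun c hc => hL c (by simp [hc])) (hh.blowup hc hq)
    refine ⟨.cons h c.1 c.2 hc.isComponent q hq S, by rw [BlowupSequence.centers, hS], ?_⟩
    rw [show (BlowupSequence.cons h c.1 c.2 hc.isComponent q hq S).map ≫ h = S.map ≫ q ≫ h from
      Category.assoc _ _ _]
    exact hS'

lemma isDilatation_id {R : Type*} [CommRing R] {ε : R} (hε : IsNilpotent ε) :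
    IsDilatation (RingHom.id R) 1 ε :=
  ⟨fun _ _ h => h, one_mem _, hε, ε, one_mul _, fun b => ⟨Polynomial.C b, by simp⟩⟩

/-- The nilradical at each stage is generated by `η` divided by the equations used so far, so the
successive dilatations compose to division by their product. -/
lemma IsChart.blowupSequence {Z : Scheme.{u}} {h : Z ⟶ X} (S : BlowupSequence E h)
    (hc : IsChart E h U t) {s : List Γ(X, U.1)}
    (hs : List.Forall₂ (IsLocalEquation E U t) S.centers s) {η : Γ(Z, h ⁻¹ᵁ U.1)}
    (hη : nilradical Γ(Z, h ⁻¹ᵁ U.1) = Ideal.span {η}) :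
    IsChart E (S.map ≫ h) U t ∧
      IsDilatation (S.map.app (h ⁻¹ᵁ U.1)).hom ((h.app U.1).hom s.prod) η := by
  induction S generalizing s with
  | nil h =>
    cases hs
    refine ⟨?_, ?_⟩
    · rw [show (BlowupSequence.nil (E := E) h).map ≫ h = h from Category.id_comp h]
      exact hc
    · rw [List.prod_nil, map_one]
      exact isDilatation_id (isNilpotent hη)
  | @cons Z Z₁ h i C hC q hq S ih =>
    obtain _ | ⟨hs₁, hs⟩ := hs
    rename_i s₁ s
    obtain ⟨h1, h2⟩ := hc.blowup (c := (i, C)) hs₁ hq hη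
    obtain ⟨e, he, -⟩ := h2.generator
    have hnil := (hc.thick.dilatation hs₁.dvd hη h2).2 e he
    obtain ⟨h3, h4⟩ := ih h1 hs hnil
    refine ⟨?_, ?_⟩
    · rw [show (BlowupSequence.cons h i C hC q hq S).map ≫ h = S.map ≫ q ≫ h from
        Category.assoc _ _ _]
      exact h3
    · rw [List.prod_cons, map_mul]
      rw [Scheme.Hom.comp_app] at h4
      exact h2.comp he h4

end Charts

end PTM

namespace PTM

/-! ### Uniqueness and gluing of morphisms over `X` -/

section Uniqueness

variable {X Z W : Scheme.{u}} {l : ℕ} {E : Fin l → X.IdealSheafData} {h : Z ⟶ X}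

lemma IsChart.prod_mem_nonZeroDivisors {U : X.affineOpens} {t : Fin l → Γ(X, U.1)}
    (hc : IsChart E h U t) {p : W ⟶ X} (hp : ∀ i, IsCartier ((E i).comap p)) (V : W.affineOpens)
    (e : V.1 ≤ p ⁻¹ᵁ U.1) :
    (p.appLE U.1 V.1 e).hom (∏ i, t i) ∈ nonZeroDivisors Γ(W, V.1) := by
  rw [map_prod]
  refine prod_mem fun i _ => isCartier_ideal_nonZeroDivisors (hp i) V ?_
  rw [comap_ideal _ p U V e, hc.eq, Ideal.map_span, Set.image_singleton]

/-- A section `b` of `Z` becomes a section of `X` after multiplication by a power of `T`. As `T` is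
regular on `W`, the pullback of `b` is determined. -/
lemma HasCharts.hom_ext (hh : HasCharts E h) {p : W ⟶ X} (hp : ∀ i, IsCartier ((E i).comap p))
    {k k' : W ⟶ Z} (hk : k ≫ h = p) (hk' : k' ≫ h = p) : k = k' := by
  refine Scheme.hom_ext_of_forall _ _ fun w => ?_
  obtain ⟨U, t, hxU, hU⟩ := hh (p w)
  obtain ⟨V, hwV, e⟩ := exists_affineOpen_le (show w ∈ p ⁻¹ᵁ U.1 from hxU)
  have hV : IsAffineOpen V.1 := V.2
  have e₁ : V.1 ≤ k ⁻¹ᵁ (h ⁻¹ᵁ U.1) := by rwa [← Scheme.Hom.comp_preimage, hk]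
  have e₂ : V.1 ≤ k' ⁻¹ᵁ (h ⁻¹ᵁ U.1) := by rwa [← Scheme.Hom.comp_preimage, hk']
  have hreg := hU.prod_mem_nonZeroDivisors hp V e
  have h₁ : ∀ a, (k.appLE _ _ e₁).hom ((h.app U.1).hom a) = (p.appLE U.1 V.1 e).hom a := by
    intro a
    subst hk
    rw [← Scheme.Hom.appLE_eq_app]
    exact appLE_apply_apply le_rfl e₁ e a
  have h₂ : ∀ a, (k'.appLE _ _ e₂).hom ((h.app U.1).hom a) = (p.appLE U.1 V.1 e).hom a := by
    intro a
    subst hk'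
    rw [← Scheme.Hom.appLE_eq_app]
    exact appLE_apply_apply le_rfl e₂ e a
  have heq : k.appLE _ _ e₁ = k'.appLE _ _ e₂ := by
    ext b
    obtain ⟨j, a, hb⟩ := hU.thick.torsion b
    have hb₁ := congrArg (k.appLE _ _ e₁).hom hb
    have hb₂ := congrArg (k'.appLE _ _ e₂).hom hb
    rw [map_mul, map_pow, h₁, h₁] at hb₁
    rw [map_mul, map_pow, h₂, h₂, ← hb₁] at hb₂
    refine (sub_eq_zero.mp ((mul_left_mem_nonZeroDivisors_eq_zero_iff (pow_mem hreg j)).mp ?_)).symm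
    rw [mul_sub, hb₂, sub_self]
  refine ⟨V.1, hwV, ?_⟩
  rw [← cancel_epi hV.isoSpec.inv, IsAffineOpen.isoSpec_inv_ι_assoc,
    IsAffineOpen.isoSpec_inv_ι_assoc, ← IsAffineOpen.SpecMap_appLE_fromSpec k hU.affine hV e₁,
    ← IsAffineOpen.SpecMap_appLE_fromSpec k' hU.affine hV e₂, heq]

lemma HasCharts.isCartier (hh : HasCharts E h) (i : Fin l) : IsCartier ((E i).comap h) := by
  intro z
  obtain ⟨U, t, hxU, hU⟩ := hh (h z)
  refine ⟨⟨h ⁻¹ᵁ U.1, hU.affine⟩, hxU, (h.app U.1).hom (t i), mem_nonZeroDivisors_of_dvd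
    (map_dvd _ (Finset.dvd_prod_of_mem t (Finset.mem_univ i))) hU.thick.regular, ?_⟩
  rw [comap_ideal _ h U ⟨h ⁻¹ᵁ U.1, hU.affine⟩ le_rfl, hU.eq, Ideal.map_span, Set.image_singleton,
    Scheme.Hom.appLE_eq_app]

variable {h' : W ⟶ X}

lemma HasCharts.exists_hom (hh : HasCharts E h) (hh' : HasCharts E h')
    (hloc : ∀ x : X, ∃ (U : X.affineOpens) (_ : x ∈ U.1) (_ : IsAffineOpen (h ⁻¹ᵁ U.1))
      (_ : IsAffineOpen (h' ⁻¹ᵁ U.1)) (σ : Γ(Z, h ⁻¹ᵁ U.1) →+* Γ(W, h' ⁻¹ᵁ U.1)),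
      σ.comp (h.app U.1).hom = (h'.app U.1).hom) : ∃ k : W ⟶ Z, k ≫ h = h' := by
  refine exists_lift_of_local h h' (fun j _ k k' hk hk' => hh.hom_ext (p := j ≫ h') (fun i => ?_)
    hk hk') fun w => ?_
  · rw [Scheme.IdealSheafData.comap_comp]
    exact (hh'.isCartier i).comap j
  · obtain ⟨U, hx, hZ, hW, σ, hσ⟩ := hloc (h' w)
    refine ⟨h' ⁻¹ᵁ U.1, hx, hW.isoSpec.hom ≫ Spec.map (CommRingCat.ofHom σ) ≫ hZ.fromSpec, ?_⟩
    have hσ' : h.app U.1 ≫ CommRingCat.ofHom σ = h'.app U.1 := by ext1; exact hσ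
    rw [Category.assoc, Category.assoc,
      ← IsAffineOpen.SpecMap_appLE_fromSpec h U.2 hZ le_rfl, Scheme.Hom.appLE_eq_app,
      ← Spec.map_comp_assoc, hσ', ← Scheme.Hom.appLE_eq_app,
      IsAffineOpen.SpecMap_appLE_fromSpec h' U.2 hW le_rfl, IsAffineOpen.isoSpec_hom_fromSpec_assoc]

lemma HasCharts.exists_iso (hh : HasCharts E h) (hh' : HasCharts E h')
    (hloc : ∀ x : X, ∃ (U : X.affineOpens) (_ : x ∈ U.1) (_ : IsAffineOpen (h ⁻¹ᵁ U.1))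
      (_ : IsAffineOpen (h' ⁻¹ᵁ U.1)) (σ : Γ(Z, h ⁻¹ᵁ U.1) →+* Γ(W, h' ⁻¹ᵁ U.1)),
      Function.Bijective σ ∧ σ.comp (h.app U.1).hom = (h'.app U.1).hom) :
    ∃ e : W ≅ Z, e.hom ≫ h = h' := by
  obtain ⟨a, ha⟩ := hh.exists_hom hh' fun x => by
    obtain ⟨U, hx, hZ, hW, σ, -, hσ⟩ := hloc x
    exact ⟨U, hx, hZ, hW, σ, hσ⟩
  obtain ⟨b, hb⟩ := hh'.exists_hom hh fun x => by
    obtain ⟨U, hx, hZ, hW, σ, hbij, hσ⟩ := hloc x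
    refine ⟨U, hx, hW, hZ, (RingEquiv.ofBijective σ hbij).symm.toRingHom, ?_⟩
    rw [← hσ]
    ext y
    exact (RingEquiv.ofBijective σ hbij).symm_apply_apply _
  refine ⟨⟨a, b, ?_, ?_⟩, ha⟩
  · exact hh'.hom_ext hh'.isCartier (by rw [Category.assoc, hb, ha]) (Category.id_comp _)
  · exact hh.hom_ext hh.isCartier (by rw [Category.assoc, ha, hb]) (Category.id_comp _)

end Uniqueness

end PTM

namespace PTM

/-! ### Stalks of the reduction and spreading out -/

section Stalks

variable {X : Scheme.{u}} {U : X.Opens} {x : X}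

/-- The map from the sections to the local ring of the reduction. -/
noncomputable def rgerm (hx : x ∈ U) : Γ(X, U) →+* ReducedStalk X x :=
  (Ideal.Quotient.mk _).comp (X.presheaf.germ U x hx).hom

lemma rgerm_res {V : X.Opens} (hx : x ∈ V) (h : V ≤ U) (a : Γ(X, U)) :
    rgerm hx (res X h a) = rgerm (h hx) a :=
  congrArg (Ideal.Quotient.mk _) (X.presheaf.germ_res_apply (homOfLE h) x hx a)

lemma isUnit_rgerm_iff (hx : x ∈ U) {a : Γ(X, U)} :
    IsUnit (rgerm hx a) ↔ x ∈ X.basicOpen a := by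
  rw [X.mem_basicOpen _ x hx]
  have : IsLocalHom (Ideal.Quotient.mk (nilradical (X.presheaf.stalk x))) :=
    Ideal.Quotient.mk_surjective.isLocalHom
  exact isUnit_map_iff (Ideal.Quotient.mk (nilradical (X.presheaf.stalk x))) _

lemma exists_mul_eq_zero_of_germ (hU : IsAffineOpen U) (hx : x ∈ U) {a : Γ(X, U)}
    (ha : X.presheaf.germ U x hx a = 0) : ∃ s : Γ(X, U), x ∈ X.basicOpen s ∧ s * a = 0 := by
  let := TopCat.Presheaf.algebra_section_stalk X.presheaf (⟨x, hx⟩ : U)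
  have := hU.isLocalization_stalk ⟨x, hx⟩
  obtain ⟨m, hm⟩ := (IsLocalization.map_eq_zero_iff (hU.primeIdealOf ⟨x, hx⟩).asIdeal.primeCompl
    (X.presheaf.stalk x) a).mp ha
  exact ⟨m, (X.mem_basicOpen _ x hx).mpr (IsLocalization.map_units (X.presheaf.stalk x) m), hm⟩

lemma exists_mul_eq_germ (hU : IsAffineOpen U) (hx : x ∈ U) (z : X.presheaf.stalk x) :
    ∃ s a : Γ(X, U), x ∈ X.basicOpen s ∧
      X.presheaf.germ U x hx s * z = X.presheaf.germ U x hx a := by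
  let := TopCat.Presheaf.algebra_section_stalk X.presheaf (⟨x, hx⟩ : U)
  have := hU.isLocalization_stalk ⟨x, hx⟩
  obtain ⟨⟨a, m⟩, hm⟩ := IsLocalization.surj (hU.primeIdealOf ⟨x, hx⟩).asIdeal.primeCompl z
  refine ⟨m, a, (X.mem_basicOpen _ x hx).mpr (IsLocalization.map_units (X.presheaf.stalk x) m), ?_⟩
  rw [mul_comm]
  exact hm

lemma exists_mul_mem_nilradical (hU : IsAffineOpen U) (hx : x ∈ U) {a : Γ(X, U)}
    (ha : rgerm hx a = 0) :
    ∃ s : Γ(X, U), x ∈ X.basicOpen s ∧ s * a ∈ nilradical Γ(X, U) := by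
  obtain ⟨n, hn⟩ := _root_.mem_nilradical.mp (Ideal.Quotient.eq_zero_iff_mem.mp ha)
  obtain ⟨s, hs, hsa⟩ := exists_mul_eq_zero_of_germ hU hx (a := a ^ n)
    ((map_pow (X.presheaf.germ U x hx).hom a n).trans hn)
  refine ⟨s, hs, _root_.mem_nilradical.mpr ⟨n + 1, ?_⟩⟩
  rw [mul_pow, pow_succ, pow_succ]
  linear_combination (s ^ n * a) * hsa

lemma rgerm_eq_zero (hx : x ∈ U) {a : Γ(X, U)} (ha : a ∈ nilradical Γ(X, U)) : rgerm hx a = 0 :=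
  Ideal.Quotient.eq_zero_iff_mem.mpr (_root_.mem_nilradical.mpr
    ((_root_.mem_nilradical.mp ha).map (X.presheaf.germ U x hx).hom))

lemma exists_mul_eq_rgerm (hU : IsAffineOpen U) (hx : x ∈ U) (z : ReducedStalk X x) :
    ∃ s a : Γ(X, U), x ∈ X.basicOpen s ∧ rgerm hx s * z = rgerm hx a := by
  obtain ⟨z, rfl⟩ := Ideal.Quotient.mk_surjective z
  obtain ⟨s, a, hs, h⟩ := exists_mul_eq_germ hU hx z
  exact ⟨s, a, hs, by rw [rgerm, RingHom.comp_apply, RingHom.comp_apply, ← map_mul]; exact congrArg _ h⟩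

lemma mem_basicOpen_mul {a b : Γ(X, U)} (ha : x ∈ X.basicOpen a) (hb : x ∈ X.basicOpen b) :
    x ∈ X.basicOpen (a * b) := by
  rw [Scheme.basicOpen_mul]
  exact ⟨ha, hb⟩

lemma mem_ideal_of_local (hU : IsAffineOpen U) {J : Ideal Γ(X, U)} {a : Γ(X, U)}
    (h : ∀ x ∈ U, ∃ s : Γ(X, U), x ∈ X.basicOpen s ∧ s * a ∈ J) : a ∈ J := by
  have h1 : Ideal.span {s : Γ(X, U) | s * a ∈ J} = ⊤ := by
    rw [← hU.self_le_iSup_basicOpen_iff]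
    intro x hx
    obtain ⟨s, hs, hsJ⟩ := h x hx
    exact Opens.mem_iSup.mpr ⟨⟨s, hsJ⟩, hs⟩
  have h2 : Ideal.span {s : Γ(X, U) | s * a ∈ J} ≤ Submodule.comap (LinearMap.toSpanSingleton _ _ a) J :=
    Ideal.span_le.mpr fun s hs => hs
  have h3 : (1 : Γ(X, U)) ∈ Submodule.comap (LinearMap.toSpanSingleton _ _ a) J :=
    h2 (h1 ▸ Submodule.mem_top)
  simpa using h3

lemma isRadical_of_stalk (hU : IsAffineOpen U) {t : Γ(X, U)}
    (h : ∀ (x : X) (hx : x ∈ U), (Ideal.span {rgerm hx t}).IsRadical) :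
    (Ideal.span {t} ⊔ nilradical Γ(X, U)).IsRadical := by
  rintro a ⟨n, hn⟩
  refine mem_ideal_of_local hU fun x hx => ?_
  have h1 : rgerm hx a ∈ Ideal.span {rgerm hx t} := by
    refine h x hx ⟨n, ?_⟩
    obtain ⟨y, hy, z, hz, hyz⟩ := Submodule.mem_sup.mp hn
    obtain ⟨c, rfl⟩ := Ideal.mem_span_singleton'.mp hy
    rw [← map_pow, ← hyz, map_add, rgerm_eq_zero hx hz, add_zero, map_mul]
    exact Ideal.mul_mem_left _ _ (Ideal.mem_span_singleton_self _)
  obtain ⟨z, hz⟩ := Ideal.mem_span_singleton'.mp h1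
  obtain ⟨s, b, hs, hsb⟩ := exists_mul_eq_rgerm hU hx z
  obtain ⟨s', hs', hN⟩ := exists_mul_mem_nilradical hU hx (a := s * a - b * t) (by
    rw [map_sub, map_mul, map_mul, ← hz, ← hsb]
    ring)
  refine ⟨s' * s, mem_basicOpen_mul hs' hs, ?_⟩
  have : s' * s * a = s' * b * t + s' * (s * a - b * t) := by ring
  rw [this]
  exact Submodule.add_mem_sup (Ideal.mul_mem_left _ _ (Ideal.mem_span_singleton_self t)) hN

lemma associated_rgerm [IsDomain (ReducedStalk X x)] {I : X.IdealSheafData} {U U' : X.affineOpens}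
    {t : Γ(X, U.1)} {t' : Γ(X, U'.1)} (ht : I.ideal U = Ideal.span {t})
    (ht' : I.ideal U' = Ideal.span {t'}) (hx : x ∈ U.1) (hx' : x ∈ U'.1) :
    Associated (rgerm hx t) (rgerm hx' t') := by
  obtain ⟨V, hxV, hV⟩ := exists_affineOpen_le (show x ∈ U.1 ⊓ U'.1 from ⟨hx, hx'⟩)
  have h1 := I.map_ideal (hV.trans inf_le_left : V ≤ U)
  have h2 := I.map_ideal (hV.trans inf_le_right : V ≤ U')
  rw [ht, Ideal.map_span, Set.image_singleton] at h1
  rw [ht', Ideal.map_span, Set.image_singleton, ← h1] at h2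
  have h3 := congrArg (Ideal.map (rgerm hxV)) h2
  rw [Ideal.map_span, Ideal.map_span, Set.image_singleton, Set.image_singleton] at h3
  have h4 : rgerm hxV (res X (hV.trans inf_le_left) t) = rgerm hx t := rgerm_res _ _ _
  have h5 : rgerm hxV (res X (hV.trans inf_le_right) t') = rgerm hx' t' := rgerm_res _ _ _
  rw [← h4, ← h5]
  exact (Ideal.span_singleton_eq_span_singleton.mp h3).symm

end Stalks

/-! ### Equations of the boundary in the stalks of the reduction -/

section Boundary

variable {X : Scheme.{u}} {l : ℕ} {E : Fin l → X.IdealSheafData}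

lemma IsOrderedBoundary.isDomain [IsLocallyNoetherian X] (hE : IsOrderedBoundary E) (x : X) :
    IsDomain (ReducedStalk X x) := by
  obtain ⟨_, _, _, _, _, _, _, hs, _⟩ := hE x
  exact hs.isDomain

variable {U : X.affineOpens} {t : Fin l → Γ(X, U.1)} {x : X}

lemma isUnit_rgerm_of_notMem (ht : ∀ i, (E i).ideal U = Ideal.span {t i}) (hx : x ∈ U.1) {i : Fin l} (hi : x ∉ (E i).support) : IsUnit (rgerm hx (t i)) := by
  rw [Scheme.IdealSheafData.mem_support_iff_of_mem hx, ht, Scheme.mem_zeroLocus_iff] at hi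
  push Not at hi
  obtain ⟨a, ha, hxa⟩ := hi
  obtain ⟨b, rfl⟩ := Ideal.mem_span_singleton'.mp ha
  rw [← isUnit_rgerm_iff hx, map_mul] at hxa
  exact isUnit_of_mul_isUnit_right hxa

/-- Two equations of the same divisor are associated in the stalk, so primality passes from the
parameters in the definition to any equations. -/
lemma IsOrderedBoundary.prime [IsLocallyNoetherian X] (ht : ∀ i, (E i).ideal U = Ideal.span {t i})
    (hx : x ∈ U.1) (hE : IsOrderedBoundary E) {i : Fin l} (hi : x ∈ (E i).support) :
    Prime (rgerm hx (t i)) := by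
  have := hE.isDomain x
  obtain ⟨U₀, hx₀, t₀, ht₀, d, s, j, hs, hj⟩ := hE x
  have h1 := associated_rgerm (ht i) (ht₀ i).2 hx hx₀
  rw [show rgerm hx₀ (t₀ i) = s (j ⟨i, hi⟩) from hj ⟨i, hi⟩] at h1
  exact h1.symm.prime (hs.prime _)

lemma IsOrderedBoundary.not_dvd [IsLocallyNoetherian X]
    (ht : ∀ i, (E i).ideal U = Ideal.span {t i})
    (hx : x ∈ U.1) (hE : IsOrderedBoundary E) {i k : Fin l} (hi : x ∈ (E i).support)
    (hk : k ≠ i) : ¬ rgerm hx (t i) ∣ rgerm hx (t k) := by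
  by_cases hk' : x ∈ (E k).support
  · have := hE.isDomain x
    obtain ⟨U₀, hx₀, t₀, ht₀, d, s, j, hs, hj⟩ := hE x
    have h1 := associated_rgerm (ht i) (ht₀ i).2 hx hx₀
    have h2 := associated_rgerm (ht k) (ht₀ k).2 hx hx₀
    rw [show rgerm hx₀ (t₀ i) = s (j ⟨i, hi⟩) from hj ⟨i, hi⟩] at h1
    rw [show rgerm hx₀ (t₀ k) = s (j ⟨k, hk'⟩) from hj ⟨k, hk'⟩] at h2
    rw [h1.dvd_iff_dvd_left, h2.dvd_iff_dvd_right]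
    refine hs.not_dvd fun h => hk ?_
    exact (Subtype.ext_iff.mp (j.injective h)).symm
  · intro h
    exact (hE.prime ht hx hi).not_isUnit (isUnit_of_dvd_unit h (isUnit_rgerm_of_notMem ht hx hk'))

lemma IsOrderedBoundary.isRadical [IsLocallyNoetherian X]
    (ht : ∀ i, (E i).ideal U = Ideal.span {t i})
    (hE : IsOrderedBoundary E) (i : Fin l) :
    (Ideal.span {t i} ⊔ nilradical Γ(X, U.1)).IsRadical := by
  refine isRadical_of_stalk U.2 fun x hx => ?_
  have := hE.isDomain x
  by_cases hi : x ∈ (E i).support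
  · have hp := hE.prime ht hx hi
    exact ((Ideal.span_singleton_prime hp.ne_zero).mpr hp).isRadical
  · rw [Ideal.span_singleton_eq_top.mpr (isUnit_rgerm_of_notMem ht hx hi)]
    exact fun _ _ => trivial

end Boundary

end PTM

namespace PTM

/-! ### Morphisms with trivial reduction -/

section ReductionIso

variable {X Y : Scheme.{u}} {f : Y ⟶ X}

lemma subschemeι_nilradical_isHomeomorph (X : Scheme.{u}) :
    IsHomeomorph X.nilradical.subschemeι :=
  isHomeomorph_iff_isEmbedding_surjective.mpr
    ⟨X.nilradical.subschemeι.isClosedEmbedding.isEmbedding, fun x => by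
      have : x ∈ Set.range X.nilradical.subschemeι := by
        rw [Scheme.IdealSheafData.range_subschemeι, Scheme.support_nilradical]
        trivial
      exact this⟩

lemma reductionMap_subschemeι (f : Y ⟶ X) :
    reductionMap f ≫ X.nilradical.subschemeι = Y.nilradical.subschemeι ≫ f :=
  Scheme.IdealSheafData.subschemeMap_subschemeι _ _ _ _

/-- A scheme and its reduction have the same underlying space. -/
lemma isHomeomorph_of_isIso_reductionMap (hf : IsIso (reductionMap f)) : IsHomeomorph f := by
  have h1 : IsHomeomorph (reductionMap f ≫ X.nilradical.subschemeι) := by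
    rw [Scheme.Hom.comp_base]
    exact (subschemeι_nilradical_isHomeomorph X).comp (reductionMap f).homeomorph.isHomeomorph
  rw [reductionMap_subschemeι, Scheme.Hom.comp_base] at h1
  let e := (subschemeι_nilradical_isHomeomorph Y).homeomorph
  have h2 : (f : Y → X) = (f ∘ Y.nilradical.subschemeι) ∘ e.symm := by
    funext y
    exact congrArg f (e.apply_symm_apply y).symm
  rw [h2]
  exact h1.comp e.symm.isHomeomorph

lemma isAffineHom_of_isIso_reductionMap (hf : IsIso (reductionMap f)) : IsAffineHom f := by
  have h := isHomeomorph_of_isIso_reductionMap hf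
  exact isAffineHom_of_isInducing f h.isEmbedding.isInducing
    (by rw [h.surjective.range_eq]; exact isClosed_univ)

lemma exists_sub_app_mem_nilradical (hf : IsIso (reductionMap f)) (U : X.affineOpens)
    (hU : IsAffineOpen (f ⁻¹ᵁ U.1)) (b : Γ(Y, f ⁻¹ᵁ U.1)) :
    ∃ a, b - (f.app U.1).hom a ∈ nilradical Γ(Y, f ⁻¹ᵁ U.1) := by
  have h1 : Function.Surjective ((reductionMap f ≫ X.nilradical.subschemeι).app U.1) := by
    rw [Scheme.Hom.comp_app]
    exact ((ConcreteCategory.bijective_of_isIso ((reductionMap f).app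
      (X.nilradical.subschemeι ⁻¹ᵁ U.1))).surjective).comp
      (X.nilradical.subschemeι_app_surjective U)
  have h2 : Function.Surjective ((Y.nilradical.subschemeι ≫ f).app U.1) :=
    reductionMap_subschemeι f ▸ h1
  obtain ⟨a, ha⟩ := h2 ((Y.nilradical.subschemeι.app (f ⁻¹ᵁ U.1)).hom b)
  refine ⟨a, ?_⟩
  have h3 : b - (f.app U.1).hom a ∈ RingHom.ker (Y.nilradical.subschemeι.app (f ⁻¹ᵁ U.1)).hom := by
    rw [RingHom.mem_ker, map_sub, sub_eq_zero, ← ha, Scheme.Hom.comp_app]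
    rfl
  rw [Y.nilradical.ker_subschemeι_app ⟨f ⁻¹ᵁ U.1, hU⟩] at h3
  exact h3

end ReductionIso

/-! ### Isomorphisms outside the boundary -/

section IsoOverBasicOpen

variable {X Y : Scheme.{u}} {f : Y ⟶ X}

lemma isIso_app_of_le {V W : X.Opens} (hV : IsIso (f ∣_ V)) (hW : W ≤ V) : IsIso (f.app W) := by
  have h1 : IsIso ((f ∣_ V).app (V.ι ⁻¹ᵁ W)) := inferInstance
  rw [morphismRestrict_app] at h1
  have h2 : IsIso (f.app (V.ι ''ᵁ V.ι ⁻¹ᵁ W)) := by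
    have h3 : IsIso (eqToHom (image_morphismRestrict_preimage f V (V.ι ⁻¹ᵁ W))).op := inferInstance
    have h4 := Functor.map_isIso Y.presheaf
      (eqToHom (image_morphismRestrict_preimage f V (V.ι ⁻¹ᵁ W))).op
    exact @IsIso.of_isIso_comp_right _ _ _ _ _ _ _ h4 h1
  have h3 : V.ι ''ᵁ V.ι ⁻¹ᵁ W = W := by
    rw [Scheme.Hom.image_preimage_eq_opensRange_inf, Scheme.Opens.opensRange_ι, inf_eq_right.mpr hW]
  rwa [h3] at h2

lemma exists_pow_mul_eq_zero {U : X.Opens} (hU : IsAffineOpen U) {T a : Γ(X, U)}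
    (h : res X (X.basicOpen_le T) a = 0) : ∃ n : ℕ, T ^ n * a = 0 :=
  exists_pow_mul_eq_zero_of_res_basicOpen_eq_zero_of_isCompact X hU.isCompact a T h

lemma exists_pow_mul_eq_res {U : X.Opens} (hU : IsAffineOpen U) (T : Γ(X, U))
    (z : Γ(X, X.basicOpen T)) :
    ∃ (n : ℕ) (a : Γ(X, U)), res X (X.basicOpen_le T) T ^ n * z = res X (X.basicOpen_le T) a := by
  obtain ⟨n, a, h⟩ := exists_eq_pow_mul_of_isAffineOpen X U hU T z
  exact ⟨n, a, h.symm⟩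

lemma res_app (f : Y ⟶ X) {V U : X.Opens} (h : V ≤ U) (a : Γ(X, U)) :
    res Y (Scheme.Hom.preimage_mono f h) ((f.app U).hom a) = (f.app V).hom (res X h a) :=
  congrArg (fun φ : Γ(X, U) ⟶ Γ(Y, f ⁻¹ᵁ V) => φ.hom a) (f.naturality (homOfLE h).op).symm

/-- Sections over the locus where `T` is invertible are fractions with denominators powers of `T`,
and sections vanishing there are killed by a power of `T`. -/
lemma injective_torsion_of_isIso {U : X.Opens} (hU : IsAffineOpen U)
    (hfU : IsAffineOpen (f ⁻¹ᵁ U)) {T : Γ(X, U)} (hT : T ∈ nonZeroDivisors Γ(X, U))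
    (hf : IsIso (f.app (X.basicOpen T))) :
    Function.Injective (f.app U).hom ∧
      ∀ b, ∃ (k : ℕ) (a : Γ(X, U)), (f.app U).hom T ^ k * b = (f.app U).hom a := by
  have hbij : Function.Bijective (f.app (X.basicOpen T)).hom :=
    ConcreteCategory.bijective_of_isIso _
  have hle : f ⁻¹ᵁ X.basicOpen T ≤ f ⁻¹ᵁ U := Scheme.Hom.preimage_mono f (X.basicOpen_le T)
  have heq : Y.basicOpen ((f.app U).hom T) = f ⁻¹ᵁ X.basicOpen T :=
    (Scheme.preimage_basicOpen f T).symm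
  have h0 : ∀ b, res Y hle b = 0 → ∃ n : ℕ, (f.app U).hom T ^ n * b = 0 := by
    intro b hb
    refine exists_pow_mul_eq_zero hfU ?_
    generalize_proofs h1
    revert h1
    rw [heq]
    exact fun _ => hb
  have hinj : Function.Injective (f.app U).hom := by
    rw [injective_iff_map_eq_zero]
    intro a ha
    have h1 : res X (X.basicOpen_le T) a = 0 := by
      refine hbij.injective ?_
      rw [map_zero, ← res_app, ha, map_zero]
    obtain ⟨n, hn⟩ := exists_pow_mul_eq_zero hU h1
    exact (mul_left_mem_nonZeroDivisors_eq_zero_iff (pow_mem hT n)).mp hn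
  refine ⟨hinj, fun b => ?_⟩
  obtain ⟨z, hz⟩ := hbij.surjective (res Y hle b)
  obtain ⟨n, a, hna⟩ := exists_pow_mul_eq_res hU T z
  obtain ⟨k, hk⟩ := h0 ((f.app U).hom T ^ n * b - (f.app U).hom a) (by
    rw [map_sub, map_mul, map_pow, res_app f (X.basicOpen_le T),
      res_app f (X.basicOpen_le T), ← hz, ← map_pow, ← map_mul, hna, sub_self])
  refine ⟨k + n, T ^ k * a, ?_⟩
  rw [map_mul, map_pow]
  linear_combination hk

lemma mem_support_finsetProd {ι : Type*} (s : Finset ι) (E : ι → X.IdealSheafData) {x : X}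
    (hx : x ∈ (∏ i ∈ s, E i).support) : ∃ i ∈ s, x ∈ (E i).support := by
  classical
  induction s using Finset.induction_on with
  | empty => exact absurd hx (Set.notMem_empty x)
  | insert i s hi ih =>
    rw [Finset.prod_insert hi, Scheme.IdealSheafData.support_mul] at hx
    rcases hx with hx | hx
    · exact ⟨i, by simp, hx⟩
    · obtain ⟨j, hj, hxj⟩ := ih hx
      exact ⟨j, by simp [hj], hxj⟩

lemma notMem_support_of_mem_basicOpen {I : X.IdealSheafData} {U : X.affineOpens} {t : Γ(X, U.1)}
    (ht : I.ideal U = Ideal.span {t}) {x : X} (hx : x ∈ X.basicOpen t) : x ∉ I.support := by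
  rw [Scheme.IdealSheafData.mem_support_iff_of_mem (X.basicOpen_le t hx), Scheme.mem_zeroLocus_iff]
  exact fun h => h t (ht ▸ Ideal.mem_span_singleton_self t) hx

lemma basicOpen_prod_le {l : ℕ} {E : Fin l → X.IdealSheafData} {U : X.affineOpens}
    {t : Fin l → Γ(X, U.1)} (ht : ∀ i, (E i).ideal U = Ideal.span {t i}) :
    X.basicOpen (∏ i, t i) ≤ boundaryCompl E := by
  intro x hx hx'
  obtain ⟨i, -, hi⟩ := mem_support_finsetProd _ _ hx'
  refine notMem_support_of_mem_basicOpen (ht i) ?_ hi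
  classical
  rw [← Finset.mul_prod_erase _ _ (Finset.mem_univ i), Scheme.basicOpen_mul] at hx
  exact hx.1

end IsoOverBasicOpen

/-! ### Charts for a datum -/

section ThickCharts

/-- The point at issue is regularity of `T` in `B`. Normal flatness reduces it to the reduction,
where it follows from regularity in `A`. -/
lemma isThickMod_of_normallyFlat {A B : Type*} [CommRing A] [CommRing B] {φ : A →+* B} {T : A}
    (hT : T ∈ nonZeroDivisors A) (hinj : Function.Injective φ)
    (htor : ∀ b, ∃ (k : ℕ) (a : A), φ T ^ k * b = φ a) (hB : (nilradical B).IsPrincipal)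
    (hfl : ∀ n : ℕ, Module.Flat (B ⧸ nilradical B)
      (↥(nilradical B ^ n) ⧸ (nilradical B • ⊤ : Submodule B ↥(nilradical B ^ n))))
    (hsurj : ∀ b, ∃ a, b - φ a ∈ nilradical B) : IsThickMod φ T := by
  obtain ⟨η, hη⟩ := hB
  refine ⟨hinj, mem_nonZeroDivisors_of_normallyFlat hη hfl ?_, htor, ⟨η, hη⟩, hsurj⟩
  rw [mem_nonZeroDivisors_iff_right]
  intro z hz
  obtain ⟨b, rfl⟩ := Ideal.Quotient.mk_surjective z
  rw [← map_mul, Ideal.Quotient.eq_zero_iff_mem] at hz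
  rw [Ideal.Quotient.eq_zero_iff_mem]
  obtain ⟨a, ha⟩ := hsurj b
  have h1 : φ (a * T) ∈ nilradical B := by
    have := sub_mem hz (Ideal.mul_mem_right (φ T) _ ha)
    rwa [show b * φ T - (b - φ a) * φ T = φ (a * T) by rw [map_mul]; ring] at this
  rw [_root_.mem_nilradical, IsNilpotent.map_iff hinj] at h1
  obtain ⟨n, hn⟩ := h1
  rw [mul_pow] at hn
  have h2 := (mul_right_mem_nonZeroDivisors_eq_zero_iff (pow_mem hT n)).mp hn
  have h3 : φ a ∈ nilradical B := _root_.mem_nilradical.mpr (IsNilpotent.map ⟨n, h2⟩ φ)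
  have := add_mem ha h3
  rwa [sub_add_cancel] at this

lemma isThickMod_of_bijective {A B : Type*} [CommRing A] [CommRing B] {φ : A →+* B} {T : A}
    (hφ : Function.Bijective φ) (hT : T ∈ nonZeroDivisors A) (hA : (nilradical A).IsPrincipal) :
    IsThickMod φ T := by
  obtain ⟨ε, hε⟩ := hA
  refine ⟨hφ.1, ?_, fun b => ?_, ⟨φ ε, ?_⟩, fun b => ?_⟩
  · rw [mem_nonZeroDivisors_iff_right]
    intro b hb
    obtain ⟨a, rfl⟩ := hφ.2 b
    rw [← map_mul, map_eq_zero_iff φ hφ.1] at hb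
    rw [mem_nonZeroDivisors_iff_right.mp hT a hb, map_zero]
  · obtain ⟨a, rfl⟩ := hφ.2 b
    exact ⟨0, a, by rw [pow_zero, one_mul]⟩
  · ext b
    obtain ⟨a, rfl⟩ := hφ.2 b
    rw [_root_.mem_nilradical, IsNilpotent.map_iff hφ.1, ← _root_.mem_nilradical, hε,
      Ideal.mem_span_singleton']
    refine (Ideal.mem_span_singleton'.trans ⟨?_, ?_⟩).symm
    · rintro ⟨c, hc⟩
      obtain ⟨c, rfl⟩ := hφ.2 c
      exact ⟨c, hφ.1 (by rw [map_mul, hc])⟩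
    · rintro ⟨c, hc⟩
      exact ⟨φ c, by rw [← map_mul, hc]⟩
  · obtain ⟨a, rfl⟩ := hφ.2 b
    exact ⟨a, by rw [sub_self]; exact zero_mem _⟩

lemma nilradical_isPrincipal_of_le {X : Scheme.{u}} {U V : X.Opens} (hU : IsAffineOpen U)
    (hV : IsAffineOpen V) (h : V ≤ U) (hp : (nilradical Γ(X, U)).IsPrincipal) :
    (nilradical Γ(X, V)).IsPrincipal := by
  obtain ⟨ε, hε⟩ := hp
  refine ⟨res X h ε, ?_⟩
  rw [nilradical_map_of_smooth (res_smooth hV hU h), hε]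
  exact (Ideal.map_span _ _).trans (by rw [Set.image_singleton])

variable {l : ℕ} (D : Datum.{u} l)

lemma Datum.exists_chart (x : D.X) : ∃ (U : D.X.affineOpens) (t : Fin l → Γ(D.X, U.1)), x ∈ U.1 ∧
    IsChart D.E (𝟙 D.X) U t ∧ IsChart D.E D.f U t := by
  have hX := D.isPTM_X.locallyNoetherian
  have hred := D.modification.2
  have hhom := isHomeomorph_of_isIso_reductionMap hred
  have haff := isAffineHom_of_isIso_reductionMap hred
  obtain ⟨y, rfl⟩ := hhom.surjective x
  obtain ⟨U₀, hx₀, t₀, ht₀, -⟩ := D.boundary (D.f y)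
  obtain ⟨UX, hxX, hUX⟩ := D.isPTM_X.nilprincipal (D.f y)
  obtain ⟨VY, hyY, hVY⟩ := D.isPTM_Y.nilprincipal y
  -- As `D.f` is a homeomorphism, the open set of `Y` with principal nilradical may be shrunk to the
  -- preimage of an open set of `X`.
  obtain ⟨U, hxU, hU⟩ := exists_affineOpen_le (show D.f y ∈ (U₀.1 ⊓ UX.1) ⊓
    ⟨_, hhom.isOpenMap _ VY.1.2⟩ from ⟨⟨hx₀, hxX⟩, ⟨y, hyY, rfl⟩⟩)
  have hfU : IsAffineOpen (D.f ⁻¹ᵁ U.1) := U.2.preimage D.f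
  have hle₀ : U.1 ≤ U₀.1 := hU.trans (inf_le_left.trans inf_le_left)
  have hleX : U.1 ≤ UX.1 := hU.trans (inf_le_left.trans inf_le_right)
  have hleY : D.f ⁻¹ᵁ U.1 ≤ VY.1 := by
    intro z hz
    obtain ⟨z', hz', h⟩ := (hU hz).2
    exact hhom.injective h ▸ hz'
  have hA := nilradical_isPrincipal_of_le UX.2 U.2 hleX hUX
  have hB := nilradical_isPrincipal_of_le VY.2 hfU hleY hVY
  let t : Fin l → Γ(D.X, U.1) := fun i => res D.X hle₀ (t₀ i)
  have ht : ∀ i, (D.E i).ideal U = Ideal.span {t i} := by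
    intro i
    have := (D.E i).map_ideal (show U ≤ U₀ from hle₀)
    rw [(ht₀ i).2, Ideal.map_span, Set.image_singleton] at this
    exact this.symm
  have hT : ∏ i, t i ∈ nonZeroDivisors Γ(D.X, U.1) := prod_mem fun i _ =>
    (res_flat U.2 U₀.2 hle₀).map_mem_nonZeroDivisors (ht₀ i).1
  have hrad := D.boundary.isRadical ht
  refine ⟨U, t, hxU, ⟨ht, hrad, U.2, isThickMod_of_bijective
    (ConcreteCategory.bijective_of_isIso ((𝟙 D.X : D.X ⟶ D.X).app U.1)) hT hA⟩, ht, hrad, hfU, ?_⟩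
  obtain ⟨h1, h2⟩ := injective_torsion_of_isIso U.2 hfU hT
    (isIso_app_of_le D.isIso_compl (basicOpen_prod_le ht))
  exact isThickMod_of_normallyFlat hT h1 h2 hB (D.isPTM_Y.normallyFlat ⟨_, hfU⟩)
    (exists_sub_app_mem_nilradical hred U hfU)

end ThickCharts

end PTM

namespace PTM

/-! ### Multiplicities of the boundary in charts -/

section OrderChart

variable {X Y : Scheme.{u}} {l : ℕ} {E : Fin l → X.IdealSheafData} {f : Y ⟶ X}

/-- On the affine open subscheme `U`, the pullback of the nilradical of `X` to `Y` is the
nilradical of `Y` multiplied by the divisor `∑ i, n i • E i`, up to the square of the latter. -/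
structure IsOrderChart (E : Fin l → X.IdealSheafData) (f : Y ⟶ X) (U : X.affineOpens)
    (t : Fin l → Γ(X, U.1)) (n : Fin l → ℕ) : Prop where
  chart_id : IsChart E (𝟙 X) U t
  chart : IsChart E f U t
  exists_eq : ∃ (ε : Γ(X, U.1)) (η v c : Γ(Y, f ⁻¹ᵁ U.1)), nilradical Γ(X, U.1) = Ideal.span {ε} ∧
    nilradical Γ(Y, f ⁻¹ᵁ U.1) = Ideal.span {η} ∧ IsUnit v ∧
    (f.app U.1).hom ε = v * (f.app U.1).hom (∏ i, t i ^ n i) * η + c * η ^ 2 ∧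
    -- Uniqueness of the exponents needs this only when one of them is nonzero. Where `η = 0`, every
    -- function kills `η`, and the exponents are taken to be `0`.
    ((∃ i, n i ≠ 0) → ∀ b, b * η = 0 → b ∈ nilradical Γ(Y, f ⁻¹ᵁ U.1))

lemma IsOrderChart.baseChange {X' Y' : Scheme.{u}} {φ : Y' ⟶ Y} {f' : Y' ⟶ X'} {g : X' ⟶ X}
    (H : IsPullback φ f' f g) [Smooth g] {E' : Fin l → X'.IdealSheafData}
    (hE : ∀ i, E' i = (E i).comap g) {U : X.affineOpens} {t : Fin l → Γ(X, U.1)} {n : Fin l → ℕ}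
    (hc : IsOrderChart E f U t n) (U' : X'.affineOpens) (e : U'.1 ≤ g ⁻¹ᵁ U.1) :
    IsOrderChart E' f' U' (fun i => (g.appLE U.1 U'.1 e).hom (t i)) n := by
  obtain ⟨ε, η, v, c, hε, hη, hv, heq, hann⟩ := hc.exists_eq
  obtain ⟨h1, h2⟩ := hc.chart.baseChange H hE U' e
  have h3 := (hc.chart_id.baseChange (IsPullback.of_id_snd : IsPullback g (𝟙 X') (𝟙 X) g) hE U' e).1
  have hpush := (IsChart.isPushout H e hc.chart.affine).2
  have hsm := g.smooth_appLE U.2 U'.2 e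
  have hfl := pushout_flat hpush hsm.flat
  have hw : ∀ a, (f'.app U'.1).hom ((g.appLE U.1 U'.1 e).hom a) =
      (φ.appLE _ _ (IsChart.preimage_le H.w e)).hom ((f.app U.1).hom a) := fun a => by
    rw [← CommRingCat.comp_apply, ← CommRingCat.comp_apply, hpush.w]
  refine ⟨h3, h1, (g.appLE U.1 U'.1 e).hom ε, (φ.appLE _ _ (IsChart.preimage_le H.w e)).hom η,
    (φ.appLE _ _ (IsChart.preimage_le H.w e)).hom v,
    (φ.appLE _ _ (IsChart.preimage_le H.w e)).hom c, ?_, ?_, hv.map _, ?_, ?_⟩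
  · rw [nilradical_map_of_smooth hsm, hε, Ideal.map_span, Set.image_singleton]
  · rw [h2, hη, Ideal.map_span, Set.image_singleton]
  · have := congrArg (φ.appLE _ _ (IsChart.preimage_le H.w e)).hom heq
    simp only [← map_pow, ← map_prod, hw, this, map_add, map_mul]
  · intro hn b hb
    rw [h2]
    exact hfl.mem_map_annihilator (a := η) (by rw [mul_comm]; exact hb)
      fun x hx => hann hn x (by rw [mul_comm]; exact hx)

lemma IsOrderChart.restrict {U : X.affineOpens} {t : Fin l → Γ(X, U.1)} {n : Fin l → ℕ}
    (hc : IsOrderChart E f U t n) (V : X.affineOpens) (hle : V.1 ≤ U.1) :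
    IsOrderChart E f V (fun i => res X hle (t i)) n := by
  have := hc.baseChange (isPullback_id_id f) (fun i => ((E i).comap_id).symm) V hle
  simpa only [id_appLE] using this

/-- A nonzero exponent makes the annihilator of `η` nilpotent, so `∏ t i ^ n i` divides its
counterpart in the stalk of the reduction. Exchanging the two charts gives equality. -/
lemma IsOrderChart.le [IsLocallyNoetherian X] (hE : IsOrderedBoundary E) (hY : IsPTM Y)
    {U U' : X.affineOpens} {t : Fin l → Γ(X, U.1)} {t' : Fin l → Γ(X, U'.1)} {n n' : Fin l → ℕ}
    (hc : IsOrderChart E f U t n) (hc' : IsOrderChart E f U' t' n') {x : X} (hx : x ∈ U.1)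
    (hx' : x ∈ U'.1) {i : Fin l} (hi : x ∈ (E i).support) : n i ≤ n' i := by
  by_cases hn : n i = 0
  · rw [hn]; exact zero_le
  obtain ⟨V, hxV, hV⟩ := exists_affineOpen_le (show x ∈ U.1 ⊓ U'.1 from ⟨hx, hx'⟩)
  have h1 := hc.restrict V (hV.trans inf_le_left)
  have h2 := hc'.restrict V (hV.trans inf_le_right)
  obtain ⟨ε, η, v, c, hε, hη, hv, heq, hann⟩ := h1.exists_eq
  obtain ⟨ε', η', v', c', hε', hη', hv', heq', -⟩ := h2.exists_eq
  obtain ⟨a, ha⟩ := h1.chart.thick.exists_sub_mul_mem hε hε' hη hη' hv' heq heq'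
    (h1.chart.thick.annihilatorCondition hη (hY.normallyFlat ⟨_, h1.chart.affine⟩ 1))
    (hann ⟨i, hn⟩)
  have hdom := hE.isDomain x
  refine le_of_prod_pow_dvd (p := fun j => rgerm hxV (res X (hV.trans inf_le_left) (t j)))
    (p' := fun j => rgerm hxV (res X (hV.trans inf_le_right) (t' j)))
    (fun j => associated_rgerm (h1.chart.eq j) (h2.chart.eq j) hxV hxV)
    (hE.prime h1.chart.eq hxV hi) (fun j hj => hE.not_dvd h1.chart.eq hxV hi hj) ?_
  have h3 := rgerm_eq_zero hxV ha
  rw [map_sub, map_mul, sub_eq_zero, map_prod, map_prod] at h3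
  simp only [map_pow] at h3
  rw [h3]
  exact dvd_mul_left _ _

end OrderChart

/-! ### Existence of the multiplicities -/

section Existence

variable {X : Scheme.{u}} {U : X.Opens} {x : X}

/-- If `w` were not invertible at `x`, then `1 - w` would be. Iterating `hw` gives `(1 - w) ^ j * η
= d ^ j * η ^ (j + 1)`, which vanishes for large `j`, contrary to `h0`. -/
lemma mem_basicOpen_of_one_sub_mul {B : Type*} [CommRing B] {φ : Γ(X, U) →+* B} {η : B}
    (hx : x ∈ U) (hη : IsNilpotent η) (h0 : ∀ s, x ∈ X.basicOpen s → φ s * η ≠ 0) {w : Γ(X, U)}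
    {d : B} (hw : (1 - φ w) * η = d * η ^ 2) : x ∈ X.basicOpen w := by
  by_contra hxw
  rw [← isUnit_rgerm_iff hx] at hxw
  have h1 : IsUnit (rgerm hx (1 - w)) := by
    rw [map_sub, map_one]
    exact (IsLocalRing.isUnit_or_isUnit_one_sub_self (rgerm hx w)).resolve_left hxw
  have h2 : ∀ j : ℕ, φ ((1 - w) ^ j) * η = d ^ j * η ^ (j + 1) := by
    intro j
    induction j with
    | zero => simp
    | succ j ih =>
      rw [pow_succ, map_mul, mul_right_comm, ih, map_sub, map_one]
      linear_combination (d ^ j * η ^ j) * hw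
  obtain ⟨j, hj⟩ := hη
  refine h0 ((1 - w) ^ j) ?_ ?_
  · rw [← isUnit_rgerm_iff hx, map_pow]
    exact h1.pow j
  · rw [h2, pow_succ, hj]
    ring

/-- The annihilator of `η` is finitely generated, so the product of the functions obtained for its
generators serves for all its elements. -/
lemma exists_annihilator_mul_mem {B : Type*} [CommRing B] [IsNoetherianRing B]
    {φ : Γ(X, U) →+* B} {η : B} (hx : x ∈ U) (hη : IsNilpotent η)
    (h0 : ∀ s, x ∈ X.basicOpen s → φ s * η ≠ 0) (hac : AnnihilatorCondition φ η) :
    ∃ w : Γ(X, U), x ∈ X.basicOpen w ∧ ∀ b, η * b = 0 → b * φ w ∈ nilradical B := by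
  classical
  have h1 : ∀ b, ∃ w : Γ(X, U), b * η = 0 → x ∈ X.basicOpen w ∧ b * φ w ∈ nilradical B := by
    intro b
    by_cases hb : b * η = 0
    · obtain ⟨w, d, h, hw⟩ := hac b 0 (by rw [hb, zero_mul])
      exact ⟨w, fun _ => ⟨mem_basicOpen_of_one_sub_mul hx hη h0 hw, h⟩⟩
    · exact ⟨0, fun h => absurd h hb⟩
  choose w hw using h1
  obtain ⟨S, hS⟩ := (inferInstance : IsNoetherian B B).noetherian
    (LinearMap.ker (LinearMap.toSpanSingleton B B η))
  have hS' : ∀ b, b ∈ Submodule.span B (S : Set B) ↔ b * η = 0 := fun b => by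
    rw [hS, LinearMap.mem_ker, LinearMap.toSpanSingleton_apply, smul_eq_mul]
  refine ⟨∏ b ∈ S, w b, ?_, ?_⟩
  · rw [← isUnit_rgerm_iff hx, map_prod]
    refine Submonoid.prod_mem (IsUnit.submonoid _) fun b hb => (isUnit_rgerm_iff hx).mpr ?_
    exact (hw b ((hS' b).mp (Submodule.subset_span hb))).1
  · intro b hb
    have h2 : Submodule.span B (S : Set B) ≤ Submodule.comap
        (LinearMap.toSpanSingleton B B (φ (∏ b ∈ S, w b))) (nilradical B) := by
      refine Submodule.span_le.mpr fun b hb => ?_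
      change b * φ _ ∈ nilradical B
      rw [← Finset.mul_prod_erase S w hb, map_mul, ← mul_assoc]
      exact Ideal.mul_mem_right _ _ (hw b ((hS' b).mp (Submodule.subset_span hb))).2
    exact h2 ((hS' b).mpr (by rw [mul_comm]; exact hb))

/-- In the stalk `a` divides a power of `∏ i, t i` and so is a unit times a monomial in the `t i`.
The pair `s`, `v` represents that unit as a fraction on `U`. -/
lemma exists_mul_sub_mem_of_dvd {l : ℕ} {E : Fin l → X.IdealSheafData} [IsLocallyNoetherian X]
    (hE : IsOrderedBoundary E) {U : X.affineOpens} {t : Fin l → Γ(X, U.1)}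
    (ht : ∀ i, (E i).ideal U = Ideal.span {t i}) (hx : x ∈ U.1) {a a₁ w : Γ(X, U.1)} {k : ℕ}
    (h : ((∏ i, t i) ^ k - a₁ * a) * w ∈ nilradical Γ(X, U.1)) (hw : x ∈ X.basicOpen w) :
    ∃ (n : Fin l → ℕ) (s v : Γ(X, U.1)), x ∈ X.basicOpen s ∧ x ∈ X.basicOpen v ∧
      s * a - v * ∏ i, t i ^ n i ∈ nilradical Γ(X, U.1) ∧ ∀ i, n i ≠ 0 → x ∈ (E i).support := by
  have hdom := hE.isDomain x
  have h1 : rgerm hx a ∣ (Multiset.map (fun i => rgerm hx (t i))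
      (k • (Finset.univ : Finset (Fin l)).val)).prod := by
    have h2 := rgerm_eq_zero hx h
    rw [map_mul, mul_eq_zero, map_sub, map_mul, map_pow, map_prod, sub_eq_zero] at h2
    rw [Multiset.map_nsmul, Multiset.prod_nsmul]
    change _ ∣ (∏ i, rgerm hx (t i)) ^ k
    rw [h2.resolve_right ((isUnit_rgerm_iff hx).mpr hw).ne_zero]
    exact dvd_mul_left _ _
  obtain ⟨n, hn, hn0⟩ := exists_associated_prod_pow_of_dvd (p := fun i => rgerm hx (t i))
    (fun i => by
      by_cases hi : x ∈ (E i).support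
      · exact .inl (hE.prime ht hx hi)
      · exact .inr (isUnit_rgerm_of_notMem ht hx hi)) _ _ h1
  obtain ⟨r, hr⟩ := hn.symm
  obtain ⟨s, v, hs, hsv⟩ := exists_mul_eq_rgerm U.2 hx (r : ReducedStalk X x)
  obtain ⟨s', hs', hN⟩ := exists_mul_mem_nilradical U.2 hx (a := s * a - v * ∏ i, t i ^ n i) (by
    rw [map_sub, map_mul, map_mul, map_prod, ← hr, ← hsv]
    simp only [map_pow]
    ring)
  have hv : x ∈ X.basicOpen v := by
    rw [← isUnit_rgerm_iff hx, ← hsv]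
    exact ((isUnit_rgerm_iff hx).mpr hs).mul r.isUnit
  refine ⟨n, s' * s, s' * v, mem_basicOpen_mul hs' hs, mem_basicOpen_mul hs' hv, ?_, fun i hi => ?_⟩
  · convert hN using 1
    ring
  · by_contra h
    exact hi (hn0 i (isUnit_rgerm_of_notMem ht hx h))

variable {Y : Scheme.{u}} {l : ℕ} {E : Fin l → X.IdealSheafData} {f : Y ⟶ X}

lemma IsChart.exists_isOrderChart [IsLocallyNoetherian X] (hE : IsOrderedBoundary E)
    (hY : IsPTM Y) {U : X.affineOpens} {t : Fin l → Γ(X, U.1)} (hc₁ : IsChart E (𝟙 X) U t)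
    (hc : IsChart E f U t) (hx : x ∈ U.1) :
    ∃ (V : X.affineOpens) (t' : Fin l → Γ(X, V.1)) (n : Fin l → ℕ), x ∈ V.1 ∧
      IsOrderChart E f V t' n ∧ ∀ i, n i ≠ 0 → x ∈ (E i).support := by
  obtain ⟨ε, hε⟩ : ∃ ε, nilradical Γ(X, U.1) = Ideal.span {ε} := hc₁.thick.principal
  obtain ⟨η, hη⟩ := hc.thick.principal
  have hηn := IsChart.isNilpotent hη
  have hac := hc.thick.annihilatorCondition hη (hY.normallyFlat ⟨_, hc.affine⟩ 1)
  have hY' := hY.locallyNoetherian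
  have hnoeth : IsNoetherianRing Γ(Y, f ⁻¹ᵁ U.1) :=
    IsLocallyNoetherian.component_noetherian ⟨f ⁻¹ᵁ U.1, hc.affine⟩
  have hres : ∀ s : Γ(X, U.1), x ∈ X.basicOpen s → ∃ (V : X.affineOpens) (hle : V.1 ≤ U.1),
      x ∈ V.1 ∧ IsUnit (res X hle s) := by
    intro s hs
    exact ⟨⟨X.basicOpen s, U.2.basicOpen s⟩, X.basicOpen_le s, hs,
      RingedSpace.isUnit_res_basicOpen X.toRingedSpace s⟩
  have hnil : ∀ (V : X.affineOpens) (hle : V.1 ≤ U.1),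
      nilradical Γ(X, V.1) = Ideal.span {res X hle ε} ∧ nilradical Γ(Y, f ⁻¹ᵁ V.1) =
        Ideal.span {res Y (Scheme.Hom.preimage_mono f hle) η} := by
    intro V hle
    refine ⟨?_, ?_⟩
    · rw [nilradical_map_of_smooth (res_smooth V.2 U.2 hle), hε, Ideal.map_span,
        Set.image_singleton]
    · rw [nilradical_map_of_smooth (res_smooth (hc.restrict V hle).affine hc.affine
        (Scheme.Hom.preimage_mono f hle)), hη, Ideal.map_span, Set.image_singleton]
  -- In the first case `Y`, and with it `X`, is reduced near `x`, and all exponents are `0`.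
  by_cases h0 : ∃ s, x ∈ X.basicOpen s ∧ (f.app U.1).hom s * η = 0
  · obtain ⟨s, hs, hsη⟩ := h0
    obtain ⟨V, hle, hxV, hsV⟩ := hres s hs
    obtain ⟨hεV, hηV⟩ := hnil V hle
    have hη0 : res Y (Scheme.Hom.preimage_mono f hle) η = 0 := by
      have := congrArg (res Y (Scheme.Hom.preimage_mono f hle)) hsη
      rw [map_mul, map_zero, res_app f hle] at this
      exact ((hsV.map (f.app V.1).hom).mul_right_eq_zero).mp this
    refine ⟨V, fun i => res X hle (t i), 0, hxV, ⟨hc₁.restrict V hle, hc.restrict V hle,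
      _, _, 1, 0, hεV, hηV, isUnit_one, ?_, fun h => absurd rfl h.choose_spec⟩,
      fun i hi => absurd rfl hi⟩
    have h1 : (f.app V.1).hom (res X hle ε) ∈ nilradical Γ(Y, f ⁻¹ᵁ V.1) :=
      (hc.restrict V hle).thick.mem_nilradical.mpr (hεV ▸ Ideal.mem_span_singleton_self _)
    rw [hηV, hη0, Ideal.span_singleton_zero, Ideal.mem_bot] at h1
    rw [h1, hη0]
    ring
  · have h0' : ∀ s, x ∈ X.basicOpen s → (f.app U.1).hom s * η ≠ 0 := fun s hs h => h0 ⟨s, hs, h⟩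
    obtain ⟨a, a₁, w, d, d', k, heq, hw, hd'⟩ := hc.thick.exists_eq_add hε hη hac
    obtain ⟨n, s, v, hs, hv, hsv, hn⟩ := exists_mul_sub_mem_of_dvd hE hc.eq hx hw
      (mem_basicOpen_of_one_sub_mul hx hηn h0' hd')
    obtain ⟨w', hxw', hw'⟩ := exists_annihilator_mul_mem hx hηn h0' hac
    -- On `V` the coefficient `a` is a unit times the monomial up to nilpotents, and the annihilator
    -- of `η` is nilpotent.
    obtain ⟨V, hle, hxV, hV⟩ := hres (s * v * w')
      (mem_basicOpen_mul (mem_basicOpen_mul hs hv) hxw')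
    obtain ⟨hεV, hηV⟩ := hnil V hle
    have hfle := Scheme.Hom.preimage_mono f hle
    rw [map_mul, map_mul] at hV
    have hw'V := isUnit_of_mul_isUnit_right hV
    have hvV := isUnit_of_mul_isUnit_right (isUnit_of_mul_isUnit_left hV)
    obtain ⟨s', hs'⟩ := (isUnit_of_mul_isUnit_left (isUnit_of_mul_isUnit_left hV)).exists_left_inv
    have hs'u : IsUnit s' := IsUnit.of_mul_eq_one _ hs'
    obtain ⟨p, hp⟩ := Ideal.mem_span_singleton'.mp (hε ▸ hsv)
    have hεB : (f.app U.1).hom ε ∈ nilradical Γ(Y, f ⁻¹ᵁ U.1) :=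
      hc.thick.mem_nilradical.mpr (hε ▸ Ideal.mem_span_singleton_self ε)
    rw [hη] at hεB
    obtain ⟨q, hq⟩ := Ideal.mem_span_singleton'.mp hεB
    -- Dividing `s * a = v * ∏ t i ^ n i + p * ε` by `s` gives the unit `s' * v`. As `ε = q * η`,
    -- the error term contributes `s' * p * q` to the coefficient of `η ^ 2`, besides `d`.
    refine ⟨V, fun i => res X hle (t i), n, hxV, ⟨hc₁.restrict V hle, hc.restrict V hle,
      _, _, (f.app V.1).hom (s' * res X hle v), (f.app V.1).hom (s' * res X hle p) * res Y hfle q +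
        res Y hfle d, hεV, hηV, (hs'u.mul hvV).map _, ?_, fun _ b hb => ?_⟩, hn⟩
    · have h1 := congrArg (fun z => (f.app V.1).hom (res X hle z)) hp
      have h2 := congrArg (res Y hfle) hq
      have h3 := congrArg (res Y hfle) heq
      have h4 := congrArg (f.app V.1).hom hs'
      simp only [map_mul, map_add, map_sub, map_pow, map_prod, map_one,
        res_app f hle] at h1 h2 h3 h4 ⊢
      rw [h3]
      linear_combination (-(f.app V.1).hom (res X hle a) * res Y hfle η) * h4 -
        (f.app V.1).hom s' * res Y hfle η * h1 -
        (f.app V.1).hom s' * (f.app V.1).hom (res X hle p) * res Y hfle η * h2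
    · have hflat := res_flat (hc.restrict V hle).affine hc.affine hfle
      have h1 := hflat.mem_map_annihilator (a := η) (b := b)
        (I := LinearMap.ker (LinearMap.toSpanSingleton _ _ η)) (by rw [mul_comm]; exact hb)
        (fun z hz => by
          rw [LinearMap.mem_ker, LinearMap.toSpanSingleton_apply, smul_eq_mul, mul_comm, hz])
      refine (Ideal.map_le_iff_le_comap.mpr fun z hz => ?_ :
        Ideal.map _ _ ≤ nilradical Γ(Y, f ⁻¹ᵁ V.1)) h1
      rw [LinearMap.mem_ker, LinearMap.toSpanSingleton_apply, smul_eq_mul, mul_comm] at hz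
      have h2 : res Y hfle (z * (f.app U.1).hom w') ∈ nilradical Γ(Y, f ⁻¹ᵁ V.1) :=
        (_root_.mem_nilradical.mp (hw' z hz)).map _
      rw [map_mul, res_app f hle] at h2
      exact (Ideal.mul_unit_mem_iff_mem _ (hw'V.map (f.app V.1).hom)).mp h2

end Existence

end PTM

namespace PTM

/-! ### The centers cut out by the multiplicities -/

section OrderCenter

variable {l : ℕ} (D : Datum.{u} l)

lemma Datum.exists_isOrderChart (x : D.X) : ∃ (U : D.X.affineOpens) (t : Fin l → Γ(D.X, U.1))
    (n : Fin l → ℕ), x ∈ U.1 ∧ IsOrderChart D.E D.f U t n ∧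
      ∀ i, n i ≠ 0 → x ∈ (D.E i).support := by
  have := D.isPTM_X.locallyNoetherian
  obtain ⟨U, t, hx, h1, h2⟩ := D.exists_chart x
  exact h1.exists_isOrderChart D.boundary D.isPTM_Y h2 hx

/-- The points of the divisor `E i` at which its multiplicity exceeds `k`. -/
def Datum.orderSet (i : Fin l) (k : ℕ) : Set D.X :=
  {x | x ∈ (D.E i).support ∧ ∃ (U : D.X.affineOpens) (t : Fin l → Γ(D.X, U.1)) (n : Fin l → ℕ),
    x ∈ U.1 ∧ IsOrderChart D.E D.f U t n ∧ k < n i}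

variable {D}

lemma IsOrderChart.mem_orderSet {U : D.X.affineOpens} {t : Fin l → Γ(D.X, U.1)} {n : Fin l → ℕ}
    (hc : IsOrderChart D.E D.f U t n) {x : D.X} (hx : x ∈ U.1) {i : Fin l} {k : ℕ} :
    x ∈ D.orderSet i k ↔ x ∈ (D.E i).support ∧ k < n i := by
  have := D.isPTM_X.locallyNoetherian
  constructor
  · rintro ⟨hi, U', t', n', hx', hc', hk⟩
    exact ⟨hi, hk.trans_le (hc'.le D.boundary D.isPTM_Y hc hx' hx hi)⟩
  · rintro ⟨hi, hk⟩
    exact ⟨hi, U, t, n, hx, hc, hk⟩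

lemma Datum.isClosed_orderSet (i : Fin l) (k : ℕ) : IsClosed (D.orderSet i k) := by
  rw [← isOpen_compl_iff, isOpen_iff_forall_mem_open]
  intro x hx
  obtain ⟨U, t, n, hxU, hc, -⟩ := D.exists_isOrderChart x
  rw [Set.mem_compl_iff, hc.mem_orderSet hxU] at hx
  by_cases hk : k < n i
  · exact ⟨U.1 ∩ ((D.E i).support : Set D.X)ᶜ, fun y hy hy' => hy.2 hy'.1,
      U.1.2.inter (D.E i).support.isClosed.isOpen_compl, hxU, fun h => hx ⟨h, hk⟩⟩
  · exact ⟨U.1, fun y hy hy' => hk ((hc.mem_orderSet hy).mp hy').2, U.1.2, hxU⟩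

variable (D) in
/-- The closed subset of `E i` where its multiplicity exceeds `k`. -/
def Datum.orderCenter (i : Fin l) (k : ℕ) : Closeds D.X :=
  ⟨D.orderSet i k, Datum.isClosed_orderSet i k⟩

lemma IsOrderChart.mem_orderCenter {U : D.X.affineOpens} {t : Fin l → Γ(D.X, U.1)}
    {n : Fin l → ℕ} (hc : IsOrderChart D.E D.f U t n) {x : D.X} (hx : x ∈ U.1) {i : Fin l}
    {k : ℕ} : x ∈ D.orderCenter i k ↔ x ∈ (D.E i).support ∧ k < n i :=
  hc.mem_orderSet hx

/-- The exponents are constant on a chart, so there the locus is either all of `E i` or empty, and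
its complement in `E i` is closed too. -/
lemma Datum.isCenter_orderCenter (i : Fin l) (k : ℕ) :
    IsCenter D.E (i, D.orderCenter i k) := by
  refine ⟨fun x hx => hx.1, ?_⟩
  rw [← isOpen_compl_iff, isOpen_iff_forall_mem_open]
  intro x hx
  obtain ⟨U, t, n, hxU, hc, -⟩ := D.exists_isOrderChart x
  by_cases hi : x ∈ (D.E i).support
  · have hxC : x ∈ D.orderCenter i k := by
      by_contra h
      exact hx ⟨hi, h⟩
    rw [hc.mem_orderCenter hxU] at hxC
    exact ⟨U.1, fun y hy hy' => hy'.2 ((hc.mem_orderCenter hy).mpr ⟨hy'.1, hxC.2⟩), U.1.2, hxU⟩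
  · exact ⟨((D.E i).support : Set D.X)ᶜ, fun y hy hy' => hy hy'.1,
      (D.E i).support.isClosed.isOpen_compl, hi⟩

/-- By quasi-compactness finitely many charts cover `X`, so the exponents are bounded. -/
lemma Datum.exists_orderCenter_eq_bot (D : Datum.{u} l) (i : Fin l) :
    ∃ k, D.orderCenter i k = ⊥ := by
  have := D.compactSpace_X
  choose U t n hx hc hn using D.exists_isOrderChart
  obtain ⟨s, hs⟩ := isCompact_univ.elim_finite_subcover (fun x => ((U x).1 : Set D.X))
    (fun x => (U x).1.2) (fun x _ => Set.mem_iUnion.mpr ⟨x, hx x⟩)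
  refine ⟨s.sup fun x => n x i, ?_⟩
  rw [eq_bot_iff]
  intro y hy
  obtain ⟨x, hxs, hyx⟩ := Set.mem_iUnion₂.mp (hs (Set.mem_univ y))
  have h1 := ((hc x).mem_orderCenter hyx).mp hy
  exact absurd h1.2 (not_lt.mpr (Finset.le_sup (f := fun x => n x i) hxs))

open Classical in
/-- The maximal multiplicity of the divisor `E i`. -/
noncomputable def Datum.maxOrder (D : Datum.{u} l) (i : Fin l) : ℕ :=
  Nat.find (D.exists_orderCenter_eq_bot i)

lemma Datum.orderCenter_ne_bot_of_lt {i : Fin l} {k : ℕ} (hk : k < D.maxOrder i) :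
    D.orderCenter i k ≠ ⊥ := by
  classical
  exact Nat.find_min (D.exists_orderCenter_eq_bot i) hk

lemma Datum.orderCenter_eq_bot_of_le {i : Fin l} {k : ℕ} (hk : D.maxOrder i ≤ k) :
    D.orderCenter i k = ⊥ := by
  classical
  rw [eq_bot_iff, ← Nat.find_spec (D.exists_orderCenter_eq_bot i)]
  rintro x ⟨hx, U, t, n, hxU, hc, hkn⟩
  exact ⟨hx, U, t, n, hxU, hc, hk.trans_lt hkn⟩

lemma IsOrderChart.le_maxOrder {U : D.X.affineOpens} {t : Fin l → Γ(D.X, U.1)} {n : Fin l → ℕ}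
    (hc : IsOrderChart D.E D.f U t n) {x : D.X} (hx : x ∈ U.1) {i : Fin l}
    (hi : n i ≠ 0 → x ∈ (D.E i).support) : n i ≤ D.maxOrder i := by
  by_contra! h
  have h1 : x ∈ D.orderCenter i (D.maxOrder i) := (hc.mem_orderCenter hx).mpr ⟨hi (by omega), h⟩
  rw [Datum.orderCenter_eq_bot_of_le le_rfl] at h1
  exact h1

variable (D) in
/-- The centers of the blowings up of `Y`. -/
noncomputable def Datum.orderCenters : List (Fin l × Closeds D.X) :=
  (List.finRange l).flatMap fun i =>
    (List.range (D.maxOrder i)).map fun k => (i, D.orderCenter i k)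

lemma Datum.isCenter_of_mem_orderCenters {c : Fin l × Closeds D.X} (hc : c ∈ D.orderCenters) :
    IsCenter D.E c := by
  obtain ⟨i, -, hi⟩ := List.mem_flatMap.mp hc
  obtain ⟨k, -, rfl⟩ := List.mem_map.mp hi
  exact Datum.isCenter_orderCenter i k

/-- The equations of the centers. -/
noncomputable def orderEquations (D : Datum.{u} l) {R : Type*} [CommRing R] (t : Fin l → R)
    (n : Fin l → ℕ) : List R :=
  (List.finRange l).flatMap fun i =>
    (List.range (D.maxOrder i)).map fun k => if k < n i then t i else 1

/-- Of the `maxOrder i` equations listed for `i`, exactly `n i` are `t i`; the others are `1`. -/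
lemma prod_orderEquations {R : Type*} [CommRing R] (t : Fin l → R) {n : Fin l → ℕ}
    (hn : ∀ i, n i ≤ D.maxOrder i) : (orderEquations D t n).prod = ∏ i, t i ^ n i := by
  have h1 : ∀ i m, ((List.range m).map fun k => if k < n i then t i else 1).prod =
      t i ^ min m (n i) := by
    intro i m
    induction m with
    | zero => simp
    | succ m ih =>
      rw [List.range_succ, List.map_append, List.prod_append, ih, List.map_singleton,
        List.prod_singleton]
      split_ifs with h
      · rw [min_eq_left h.le, min_eq_left h, pow_succ]
      · rw [min_eq_right (not_lt.mp h), min_eq_right ((not_lt.mp h).trans m.le_succ), mul_one]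
  rw [orderEquations, List.flatMap, List.prod_flatten, List.map_map, ← List.ofFn_eq_map,
    List.prod_ofFn]
  refine Finset.prod_congr rfl fun i _ => (h1 i _).trans ?_
  rw [min_eq_right (hn i)]

lemma IsOrderChart.forall₂_isLocalEquation {U : D.X.affineOpens} {t : Fin l → Γ(D.X, U.1)}
    {n : Fin l → ℕ} (hc : IsOrderChart D.E D.f U t n) :
    List.Forall₂ (IsLocalEquation D.E U t) D.orderCenters (orderEquations D t n) := by
  refine List.rel_flatMap (R := Eq) (List.forall₂_eq_eq_eq ▸ rfl) ?_
  rintro i _ rfl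
  rw [List.forall₂_map_left_iff, List.forall₂_map_right_iff, List.forall₂_same]
  intro k _
  by_cases hk : k < n i
  · exact .inl ⟨if_pos hk, fun x hx => by rw [hc.mem_orderCenter hx]; exact and_iff_left hk⟩
  · exact .inr ⟨if_neg hk, fun x hx => by rw [hc.mem_orderCenter hx]; exact fun h => hk h.2⟩

variable {D' : Datum.{u} l}

/-- Order charts pull back along smooth morphisms with unchanged exponents. -/
lemma SmoothPullback.preimage_orderCenter (m : SmoothPullback D' D) (i : Fin l) (k : ℕ) :
    preimage m.g (D.orderCenter i k) = D'.orderCenter i k := by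
  have := m.smooth
  ext x
  change m.g x ∈ D.orderCenter i k ↔ x ∈ D'.orderCenter i k
  obtain ⟨U, t, n, hx, hc, -⟩ := D.exists_isOrderChart (m.g x)
  obtain ⟨U', hxU', hU'⟩ := exists_affineOpen_le (show x ∈ m.g ⁻¹ᵁ U.1 from hx)
  rw [hc.mem_orderCenter hx, (hc.baseChange m.isPullback m.comap_E U' hU').mem_orderCenter hxU',
    m.comap_E, Scheme.IdealSheafData.support_comap]
  rfl

lemma SmoothPullback.maxOrder_le (m : SmoothPullback D' D) (i : Fin l) :
    D'.maxOrder i ≤ D.maxOrder i := by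
  by_contra! h
  refine Datum.orderCenter_ne_bot_of_lt h ?_
  rw [← m.preimage_orderCenter, Datum.orderCenter_eq_bot_of_le le_rfl]
  rfl

lemma SmoothPullback.pullbackCenters_orderCenters (m : SmoothPullback D' D) :
    BlowupSequence.pullbackCenters m.g D.orderCenters = D'.orderCenters := by
  classical
  rw [BlowupSequence.pullbackCenters, Datum.orderCenters, Datum.orderCenters, List.map_flatMap,
    List.filter_flatMap]
  congr 1
  funext i
  rw [List.map_map]
  -- The indices from `D'.maxOrder i` up to `D.maxOrder i` are exactly those whose centers become
  -- empty and are filtered out.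
  obtain ⟨d, hd⟩ := Nat.exists_eq_add_of_le (m.maxOrder_le i)
  rw [hd, List.range_add, List.map_append, List.filter_append, List.filter_eq_self.mpr,
    List.filter_eq_nil_iff.mpr, List.append_nil]
  · refine List.map_congr_left fun k _ => ?_
    exact Prod.ext rfl (m.preimage_orderCenter i k)
  · intro c hc
    obtain ⟨k, hk, rfl⟩ := List.mem_map.mp hc
    obtain ⟨j, -, rfl⟩ := List.mem_map.mp hk
    simp only [Function.comp_apply, m.preimage_orderCenter, ne_eq, decide_not, Bool.not_eq_true',
      decide_eq_false_iff_not, not_not]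
    exact Datum.orderCenter_eq_bot_of_le (Nat.le_add_right _ _)
  · intro c hc
    obtain ⟨k, hk, rfl⟩ := List.mem_map.mp hc
    simp only [Function.comp_apply, m.preimage_orderCenter, ne_eq, decide_not, Bool.not_eq_true',
      decide_eq_false_iff_not]
    exact Datum.orderCenter_ne_bot_of_lt (List.mem_range.mp hk)

end OrderCenter

end PTM

namespace PTM

/-! ### The factorization and its functoriality -/

section Factorization

variable {l : ℕ}

lemma Datum.hasCharts_id (D : Datum.{u} l) : HasCharts D.E (𝟙 D.X) := fun x => by
  obtain ⟨U, t, hx, h, -⟩ := D.exists_chart x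
  exact ⟨U, t, hx, h⟩

lemma Datum.hasCharts (D : Datum.{u} l) : HasCharts D.E D.f := fun x => by
  obtain ⟨U, t, hx, -, h⟩ := D.exists_chart x
  exact ⟨U, t, hx, h⟩

/-- The list of centers is used once on `Y` and twice on `X`, which locally divides `η` by `m` and
`ε` by `m * m`. The isomorphisms given by `IsThickMod.exists_ringEquiv` then glue by uniqueness. -/
lemma Datum.exists_factorization (D : Datum.{u} l) : ∃ F : Factorization D,
    F.seqY.centers = D.orderCenters ∧ F.seqX.centers = D.orderCenters ++ D.orderCenters ∧
      HasCharts D.E (F.seqY.map ≫ D.f) ∧ HasCharts D.E (F.seqX.map ≫ 𝟙 D.X) := by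
  obtain ⟨S, hS, hSc⟩ := D.hasCharts.exists_blowupSequence D.orderCenters
    fun c hc => Datum.isCenter_of_mem_orderCenters hc
  obtain ⟨S', hS', hSc'⟩ := D.hasCharts_id.exists_blowupSequence (D.orderCenters ++ D.orderCenters)
    fun c hc => Datum.isCenter_of_mem_orderCenters ((List.mem_append.mp hc).elim id id)
  obtain ⟨e, he⟩ := hSc'.exists_iso hSc fun x => by
    obtain ⟨U, t, n, hx, hc, hn⟩ := D.exists_isOrderChart x
    obtain ⟨ε, η, v, c, hε, hη, hv, heq, -⟩ := hc.exists_eq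
    have hprod := prod_orderEquations (D := D) t fun i => hc.le_maxOrder hx (hn i)
    obtain ⟨h1, h2⟩ := hc.chart.blowupSequence S (hS ▸ hc.forall₂_isLocalEquation) hη
    obtain ⟨h1', h2'⟩ := hc.chart_id.blowupSequence S'
      (s := orderEquations D t n ++ orderEquations D t n)
      (hS' ▸ List.rel_append hc.forall₂_isLocalEquation hc.forall₂_isLocalEquation) hε
    rw [List.prod_append, hprod] at h2'
    rw [hprod] at h2
    obtain ⟨k, hk⟩ : ∃ k, ∏ i, t i ^ n i ∣ (∏ i, t i) ^ k := by
      refine ⟨Finset.univ.sup n, ?_⟩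
      rw [← Finset.prod_pow]
      exact Finset.prod_dvd_prod_of_dvd _ _ fun i _ =>
        pow_dvd_pow _ (Finset.le_sup (f := n) (Finset.mem_univ i))
    obtain ⟨σ, hσ, hσ'⟩ := hc.chart.thick.exists_ringEquiv hη hv heq hk h2 h2'
    refine ⟨U, hx, h1'.affine, h1.affine, σ, hσ, ?_⟩
    rw [Scheme.Hom.comp_app, Scheme.Hom.comp_app]
    exact hσ'
  exact ⟨⟨S, S', e, by simpa using he⟩, hS, hS', hSc, hSc'⟩

/-- The factorization that blows up the components of the divisors by which the nilradicals of `X`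
and `Y` differ. -/
noncomputable def Datum.factorization (D : Datum.{u} l) : Factorization D :=
  D.exists_factorization.choose

lemma SmoothPullback.isPullbackOf_factorization {D' D : Datum.{u} l} (m : SmoothPullback D' D) :
    Factorization.IsPullbackOf m D'.factorization D.factorization := by
  have := m.smooth
  obtain ⟨h1, h2, h3, h4⟩ := D.exists_factorization.choose_spec
  obtain ⟨h1', h2', h3', h4'⟩ := D'.exists_factorization.choose_spec
  change D.factorization.seqY.centers = _ at h1
  change D.factorization.seqX.centers = _ at h2
  change HasCharts _ (D.factorization.seqX.map ≫ _) at h4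
  change D'.factorization.seqY.centers = _ at h1'
  change D'.factorization.seqX.centers = _ at h2'
  change HasCharts _ (D'.factorization.seqY.map ≫ _) at h3'
  obtain ⟨ψY, hψY, hwY⟩ := D.factorization.seqY.exists_isPullbackOf m.isPullback
    D'.factorization.seqY (by rw [h1, h1', m.pullbackCenters_orderCenters])
  obtain ⟨ψX, hψX, hwX⟩ := D.factorization.seqX.exists_isPullbackOf
    (IsPullback.of_id_snd : IsPullback m.g (𝟙 D'.X) (𝟙 D.X) m.g) D'.factorization.seqX (by
      rw [h2, h2', ← m.pullbackCenters_orderCenters]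
      simp [BlowupSequence.pullbackCenters])
  refine ⟨ψY, ψX, hψY, hψX, ?_⟩
  -- The two morphisms to the last scheme over `D.X` agree after projection to `D.X`, and the
  -- divisors `D.E i` are Cartier on their common source, so the morphisms are equal.
  refine h4.hom_ext (p := (D'.factorization.seqY.map ≫ D'.f) ≫ m.g) (fun i => ?_) ?_ ?_
  · rw [Scheme.IdealSheafData.comap_comp, ← m.comap_E]
    exact h3'.isCartier i
  · rw [Category.comp_id, Category.assoc, ← hwX, ← Category.assoc, D'.factorization.w]
  · rw [Category.comp_id, Category.assoc, D.factorization.w, ← Category.assoc, ← hwY,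
      Category.assoc, Category.assoc, m.isPullback.w]

end Factorization

end PTM

theorem theorem4p1 (l : ℕ) :
    ∃ F : (D : PTM.Datum.{u} l) → PTM.Factorization D,
      ∀ (D' D : PTM.Datum.{u} l) (m : PTM.SmoothPullback D' D),
        PTM.Factorization.IsPullbackOf m (F D') (F D) :=
  ⟨fun D => D.factorization, fun _ _ m => m.isPullbackOf_factorization⟩
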